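/- Let $A_\mu$ ($\mu=1,\dots,4$) be a smooth gauge field on $\mathbb R^4$ with values in a Lie algebra $\mathfrak g$ of Hermitian matrices, $D_\mu=\partial_\mu-iA_\mu$, $\mathcal D_\mu\alpha=\partial_\mu\alpha-i[A_\mu,\alpha]$, and let $U(w,x)$ be the path-ordered exponential $\mathrm{Pexp}(i\int_{x\to w}A)$ along the straight path from $x$ to $w$. Let $\hat Q=Q(x,-iD)$ be a finite sum of terms $\mathbf f^{\mu_1\dots\mu_m}_{\nu_1\dots\nu_n}\,(x^{\nu_1}\cdots x^{\nu_n}D_{\mu_1}\cdots D_{\mu_m}+\text{all permutations})$, where the $\mathbf f$ are matrices in the Dirac and internal non-gauge indices, let $Q(x,p)$ be the corresponding function, with $-iD_\mu$ replaced by $p_\mu$, and let $\gamma^5=\gamma_1\gamma_2\gamma_3\gamma_4$ for Euclidean gamma matrices. Let $G(x,y)=\langle\psi(x)\bar\psi(y)\rangle$ be a Green function, $\hat Q\hat G=1$, of the theory with action $S=-\int d^4x\,\bar\psi\,Q(x,-iD)\psi$. The (generalized) Wigner transform is $$X_W(x,p)=\int d^4y\,e^{ipy}\,U(x,x-\tfrac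 y2)\,\langle x-\tfrac y2|\hat X|x+\tfrac y2\rangle\,U(x+\tfrac y2,x),$$ in the distributional sense for differential operators, and $G_W$ is assumed to exist as an absolutely convergent integral. Let $\mathrm{tr}_D$ be the trace over all indices except the gauge index and $\mathrm{tr}_G$ the trace over the gauge index. Consider the local axial transformation $\psi\to e^{i\alpha(x)\gamma^5}\psi$, $\bar\psi\to\bar\psi e^{i\alpha(x)\gamma^5}$ with smooth $\alpha:\mathbb R^4\to\mathfrak g$. Let $\delta\hat Q=\{\hat Q,i\alpha\gamma^5\}$ be its infinitesimal effect on the operator in the action, and $$\langle\delta S\rangle=\int d^4x\,\langle\delta s\rangle(x),\qquad \langle\delta s\rangle(x)=\int\frac{d^4p}{(2\pi)^4}\,\mathrm{tr}_D\mathrm{tr}_G\big((\delta\hat Q)_W\,G_W\big)$$ the averaged variation of the action and its density. The averaged axial Noether current $\langle J^5_\mu\rangle$ is minus the coefficient of the first derivative in the expansion of $\langle\delta s\rangle$ in covariant derivatives of $\alpha$: for some matrix function $B$ one has $\langle\delta s\rangle(x)=\mathrm{tr}_G\big(\alpha B-\mathcal D_\mu\alpha\,\langle J^5_\mu\rangle\big)(x)$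 for every $\alpha$ and every $x$ at which all symmetrized covariant derivatives of $\alpha$ of order at least two vanish. Assume that the momentum integrals of $\mathrm{tr}_D(\gamma^5\{Q,G_W\})$ and $\mathrm{tr}_D(G_W\partial_{p_\mu}[Q,\gamma^5])$ converge absolutely at every $x$. Then the averaged axial current exists, and its components along $\mathfrak g$ (the numbers $\mathrm{tr}_G(X\langle J^5_\mu\rangle)$, $X\in\mathfrak g$) are uniquely determined and are those of $$\langle J^5_\mu(x)\rangle=-\frac12\,\mathrm{tr}_D\int\frac{d^4p}{(2\pi)^4}\,G_W\,\partial_{p_\mu}[Q,\gamma^5],$$ with $B=i\,\mathrm{tr}_D\,\gamma^5\int\frac{d^4p}{(2\pi)^4}\{Q,G_W\}$ as the term of explicit chiral symmetry breaking. If moreover all third derivatives of $Q(x,p)$ with respect to $p$ vanish, then for every smooth $\mathfrak g$-valued $\alpha$ and every $x$ $$\langle\delta s\rangle=\mathrm{tr}_G\big(\alpha B-\mathcal D_\mu\alpha\,\langle J^5_\mu\rangle+\mathcal D_\mu\mathcal D_\nu\alpha\,K_{\mu\nu}\big),\qquad K_{\mu\nu}=-\frac i8\,\mathrm{tr}_D\,\gamma^5\int\frac{d^4p}{(2\pi)^4}\{\partial_{p_\mu}\partial_{p_\nu}Q,G_W\},$$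 provided that the integrands $\mathrm{tr}_D(\gamma^5\{\partial_{p_\mu}\partial_{p_\nu}Q,G_W\})$ are also absolutely integrable; here $K_{\mu\nu}=0$ if $\gamma^5$ anticommutes with $\partial_{p_\mu}\partial_{p_\nu}Q$. -/

import Mathlib

open scoped Matrix Kronecker ContDiff

noncomputable section

namespace WignerWeyl

/-- Four-dimensional Euclidean space-time, and also its momentum space. -/
abbrev R4 : Type := EuclideanSpace ℝ (Fin 4)

/-- The unit vector in the direction `μ`. -/
def unitVec (μ : Fin 4) : R4 := EuclideanSpace.single μ 1

/-- The constant `(2π)⁻⁴`. -/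
def phaseNorm : ℂ := (((2 * Real.pi) ^ 4 : ℝ) : ℂ)⁻¹

/-- Smoothness of a matrix-valued function, entry by entry. -/
def SmoothMat {m n : Type*} (F : R4 → Matrix m n ℂ) : Prop :=
  ∀ i j, ContDiff ℝ ∞ (fun x => F x i j)

/-- Entrywise partial derivative `∂_μ` of a matrix-valued function on `ℝ⁴`. -/
def partialMat {m n : Type*} (μ : Fin 4) (F : R4 → Matrix m n ℂ) (x : R4) : Matrix m n ℂ :=
  Matrix.of fun i j => fderiv ℝ (fun z => F z i j) x (unitVec μ)

/-- The derivative `∂_{p_μ}` of a matrix-valued function of `(x, p)`. -/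
def dp {m n : Type*} (μ : Fin 4) (F : R4 → R4 → Matrix m n ℂ) : R4 → R4 → Matrix m n ℂ :=
  fun x p => partialMat μ (F x) p

/-- The trace over all indices other than the gauge index. -/
def trD {s g : Type*} [Fintype s] (M : Matrix (s × g) (s × g) ℂ) : Matrix g g ℂ :=
  Matrix.of fun a b => ∑ i, M (i, a) (i, b)

section Gauge

variable {g : Type*} [Fintype g] [DecidableEq g]

/-- A Lie algebra of Hermitian generators: a real subspace of the Hermitian matrices that is
closed under `(X, Y) ↦ i[X, Y]`. -/
structure IsGaugeAlgebra (𝔤 : Submodule ℝ (Matrix g g ℂ)) : Prop where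
  hermitian : ∀ X ∈ 𝔤, X.IsHermitian
  bracket : ∀ X ∈ 𝔤, ∀ Y ∈ 𝔤, Complex.I • (X * Y - Y * X) ∈ 𝔤

/-- The terms of the path-ordered exponential (Dyson) series of the matrix function `a`:
`T₀ = 1` and `T_{n+1}(t) = ∫₀ᵗ a(s) T_n(s) ds`. -/
def dysonTerm (a : ℝ → Matrix g g ℂ) : ℕ → ℝ → Matrix g g ℂ
  | 0 => fun _ => 1
  | n + 1 => fun t => Matrix.of fun i j => ∫ s in (0 : ℝ)..t, (a s * dysonTerm a n s) i j

/-- `U(w, x) = Pexp (i ∫_{x → w} dz A(z))` along the straight path from `x` to `w`; the factors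
near `w` stand on the left. -/
def wilson (A : Fin 4 → R4 → Matrix g g ℂ) (w x : R4) : Matrix g g ℂ :=
  Matrix.of fun i j => ∑' n : ℕ,
    dysonTerm (fun t => Complex.I • ∑ μ, (((w - x) μ : ℝ) : ℂ) • A μ (x + t • (w - x))) n 1 i j

/-- The covariant derivative in the adjoint representation, `∂_μ α - i [A_μ, α]`. -/
def covD (A : Fin 4 → R4 → Matrix g g ℂ) (μ : Fin 4) (α : R4 → Matrix g g ℂ) :
    R4 → Matrix g g ℂ :=
  fun x => partialMat μ α x - Complex.I • (A μ x * α x - α x * A μ x)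

/-- The directional covariant derivative `y · 𝒟` in the adjoint representation. -/
def covDir (A : Fin 4 → R4 → Matrix g g ℂ) (y : R4) (α : R4 → Matrix g g ℂ) :
    R4 → Matrix g g ℂ :=
  fun x => ∑ μ, ((y μ : ℝ) : ℂ) • covD A μ α x

/-- All symmetrized covariant derivatives `𝒟_{(μ₁} ⋯ 𝒟_{μₙ)} α` of order `n ≥ 2` vanish at `x`:
equivalently, `(y · 𝒟)ⁿ α` vanishes at `x` for all directions `y`. -/
def IsSlowAt (A : Fin 4 → R4 → Matrix g g ℂ) (α : R4 → Matrix g g ℂ) (x : R4) : Prop :=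
  ∀ y : R4, ∀ n : ℕ, 2 ≤ n → ((covDir A y)^[n] α) x = 0

end Gauge

section Operators

variable {s g : Type*} [Fintype s] [DecidableEq s] [Fintype g] [DecidableEq g]

/-- The covariant derivative `D_μ = ∂_μ - i A_μ` on fields in the fundamental representation. -/
def covDFund (A : Fin 4 → R4 → Matrix g g ℂ) (μ : Fin 4) (ψ : R4 → s × g → ℂ) :
    R4 → s × g → ℂ :=
  fun x => fderiv ℝ ψ x (unitVec μ)
    - Complex.I • (((1 : Matrix s s ℂ) ⊗ₖ A μ x) *ᵥ ψ x)

/-- The operator of one letter: `Sum.inl ν` is multiplication by `x^ν`, `Sum.inr μ` is `D_μ`. -/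
def letterOp (A : Fin 4 → R4 → Matrix g g ℂ) :
    Fin 4 ⊕ Fin 4 → (R4 → s × g → ℂ) → (R4 → s × g → ℂ)
  | Sum.inl ν => fun ψ x => ((x ν : ℝ) : ℂ) • ψ x
  | Sum.inr μ => covDFund A μ

/-- The symbol of one letter: `x^ν`, respectively `i p_μ` (that is, `-iD_μ` becomes `p_μ`). -/
def letterSymbol (x p : R4) : Fin 4 ⊕ Fin 4 → ℂ
  | Sum.inl ν => ((x ν : ℝ) : ℂ)
  | Sum.inr μ => Complex.I * ((p μ : ℝ) : ℂ)

/-- The word `x^{ν₁} ⋯ x^{νₙ} D_{μ₁} ⋯ D_{μₘ}`, permuted by `σ`, as a list of letters. -/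
def permWord {n m : ℕ} (ν : Fin n → Fin 4) (μ : Fin m → Fin 4) (σ : Equiv.Perm (Fin (n + m))) :
    List (Fin 4 ⊕ Fin 4) :=
  List.ofFn fun k => Fin.append (fun i => Sum.inl (ν i)) (fun i => Sum.inr (μ i)) (σ k)

/-- The coefficients of a symmetrically ordered polynomial in `x` and `D`: the matrix
`coeff n m ν μ` multiplies the sum over all permutations of
`x^{ν₁} ⋯ x^{νₙ} D_{μ₁} ⋯ D_{μₘ}`, for `n ≤ degX` and `m ≤ degD`. -/
structure SymPoly (s : Type*) where
  degX : ℕ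
  degD : ℕ
  coeff : (n m : ℕ) → (Fin n → Fin 4) → (Fin m → Fin 4) → Matrix s s ℂ

/-- The operator `Q(x, -iD)`. -/
def SymPoly.op (Q : SymPoly s) (A : Fin 4 → R4 → Matrix g g ℂ) (ψ : R4 → s × g → ℂ) :
    R4 → s × g → ℂ :=
  fun x => ∑ n ∈ Finset.range (Q.degX + 1), ∑ m ∈ Finset.range (Q.degD + 1),
    ∑ ν : Fin n → Fin 4, ∑ μ : Fin m → Fin 4,
      (Q.coeff n m ν μ ⊗ₖ (1 : Matrix g g ℂ)) *ᵥ
        ∑ σ : Equiv.Perm (Fin (n + m)), ((permWord ν μ σ).foldr (letterOp A) ψ) x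

/-- The function `Q(x, p)`. -/
def SymPoly.symbol (Q : SymPoly s) (x p : R4) : Matrix s s ℂ :=
  ∑ n ∈ Finset.range (Q.degX + 1), ∑ m ∈ Finset.range (Q.degD + 1),
    ∑ ν : Fin n → Fin 4, ∑ μ : Fin m → Fin 4,
      (∑ σ : Equiv.Perm (Fin (n + m)), ((permWord ν μ σ).map (letterSymbol x p)).prod) •
        Q.coeff n m ν μ

/-- The commutator `[Q(x, p), γ⁵]`. -/
def SymPoly.comm (Q : SymPoly s) (γ5 : Matrix s s ℂ) (x p : R4) : Matrix s s ℂ :=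
  Q.symbol x p * γ5 - γ5 * Q.symbol x p

/-- The generalized Wigner transform of the operator with integral kernel `K`:
`∫ dy e^{ipy} U(x, x - y/2) K(x - y/2, x + y/2) U(x + y/2, x)`. -/
def wigner (A : Fin 4 → R4 → Matrix g g ℂ) (K : R4 → R4 → Matrix (s × g) (s × g) ℂ)
    (x p : R4) : Matrix (s × g) (s × g) ℂ :=
  Matrix.of fun i j => ∫ y : R4, Complex.exp (Complex.I * ((inner ℝ p y : ℝ) : ℂ)) *
    (((1 : Matrix s s ℂ) ⊗ₖ wilson A x (x - (1 / 2 : ℝ) • y)) *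
      K (x - (1 / 2 : ℝ) • y) (x + (1 / 2 : ℝ) • y) *
      ((1 : Matrix s s ℂ) ⊗ₖ wilson A (x + (1 / 2 : ℝ) • y) x)) i j

/-- Smooth compactly supported integral kernels. -/
def IsTestKernel (K : R4 → R4 → Matrix (s × g) (s × g) ℂ) : Prop :=
  ∀ i j, ContDiff ℝ ∞ (fun z : R4 × R4 => K z.1 z.2 i j) ∧
    HasCompactSupport (fun z : R4 × R4 => K z.1 z.2 i j)

/-- The kernel of the product `T K̂`: the operator `T` acts on the first argument of `K`. -/
def applyKernel (T : (R4 → s × g → ℂ) → (R4 → s × g → ℂ))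
    (K : R4 → R4 → Matrix (s × g) (s × g) ℂ) (x y : R4) : Matrix (s × g) (s × g) ℂ :=
  Matrix.of fun i j => T (fun z k => K z y k j) x i

/-- `X` is the generalized Weyl symbol of the operator `T`. The Schwartz kernel of a differential
operator is a distribution, so its Wigner transform is taken in the distributional sense, by
duality with smooth compactly supported kernels:
`Tr (T K̂) = (2π)⁻⁴ ∫ dx dp tr (X(x, p) K_W(x, p))`.
The symbol is a continuous function with at most polynomial growth in `p`. -/
structure IsWeylSymbol (A : Fin 4 → R4 → Matrix g g ℂ)
    (T : (R4 → s × g → ℂ) → (R4 → s × g → ℂ))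
    (X : R4 → R4 → Matrix (s × g) (s × g) ℂ) : Prop where
  continuous : ∀ i j, Continuous (fun z : R4 × R4 => X z.1 z.2 i j)
  growth : ∀ R : ℝ, ∃ C : ℝ, ∃ k : ℕ, ∀ x p : R4, ‖x‖ ≤ R → ∀ i j,
    ‖X x p i j‖ ≤ C * (1 + ‖p‖) ^ k
  pairing : ∀ K : R4 → R4 → Matrix (s × g) (s × g) ℂ, IsTestKernel K →
    ∫ x : R4, (applyKernel T K x x).trace =
      phaseNorm * ∫ x : R4, ∫ p : R4, (X x p * wigner A K x p).trace

open Classical in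
/-- The generalized Weyl symbol `T_W(x, p)` of an operator (zero if there is none). -/
def weylSymbol (A : Fin 4 → R4 → Matrix g g ℂ)
    (T : (R4 → s × g → ℂ) → (R4 → s × g → ℂ)) : R4 → R4 → Matrix (s × g) (s × g) ℂ :=
  if h : ∃ X, IsWeylSymbol A T X then h.choose else 0

/-- `G(x, y) = ⟨ψ(x) ψ̄(y)⟩` is the Green function, the two-point function of the fermionic
Gaussian weight `exp (-∫ ψ̄ Q(x, -iD) ψ)`: the operator `Ĝ` with kernel `G` takes smooth compactly
supported functions to smooth functions, and `Q̂ Ĝ = 1`. -/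
def IsGreenFunction (Q : SymPoly s) (A : Fin 4 → R4 → Matrix g g ℂ)
    (G : R4 → R4 → Matrix (s × g) (s × g) ℂ) : Prop :=
  ∀ φ : R4 → s × g → ℂ, ContDiff ℝ ∞ φ → HasCompactSupport φ →
    (∀ x i j, MeasureTheory.Integrable (fun y => G x y i j * φ y j)) ∧
    ContDiff ℝ ∞ (fun x i => ∫ y : R4, (G x y *ᵥ φ y) i) ∧
    Q.op A (fun x i => ∫ y : R4, (G x y *ᵥ φ y) i) = φ

/-- The matrix `e^{i ε α(x) γ⁵}` of the local axial transformation. -/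
def axialRotation (γ5 : Matrix s s ℂ) (α : R4 → Matrix g g ℂ) (ε : ℝ) (x : R4) :
    Matrix (s × g) (s × g) ℂ :=
  NormedSpace.exp ((Complex.I * (ε : ℂ)) • (γ5 ⊗ₖ α x))

/-- The variation `δQ̂` of the operator in the action `S = -∫ ψ̄ Q̂ ψ` under the infinitesimal
version of `ψ → e^{iαγ⁵} ψ`, `ψ̄ → ψ̄ e^{iαγ⁵}`: the derivative at `ε = 0` of
`e^{iεαγ⁵} Q̂ e^{iεαγ⁵}`. -/
def axialVariation (Q : SymPoly s) (A : Fin 4 → R4 → Matrix g g ℂ) (γ5 : Matrix s s ℂ)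
    (α : R4 → Matrix g g ℂ) (ψ : R4 → s × g → ℂ) : R4 → s × g → ℂ :=
  fun x i => deriv (fun ε : ℝ =>
    (axialRotation γ5 α ε x *ᵥ
      Q.op A (fun z => axialRotation γ5 α ε z *ᵥ ψ z) x) i) 0

/-- The density at `x` of the averaged variation of the action,
`⟨δS⟩ = Tr (δQ̂ Ĝ) = ∫ dx (2π)⁻⁴ ∫ dp tr ((δQ̂)_W(x, p) G_W(x, p))`. -/
def variationDensity (Q : SymPoly s) (A : Fin 4 → R4 → Matrix g g ℂ) (γ5 : Matrix s s ℂ)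
    (G : R4 → R4 → Matrix (s × g) (s × g) ℂ) (α : R4 → Matrix g g ℂ) (x : R4) : ℂ :=
  phaseNorm * ∫ p : R4,
    (weylSymbol A (axialVariation Q A γ5 α) x p * wigner A G x p).trace

/-- `J` is the averaged axial Noether current: in the expansion of the averaged variation of the
action in the (symmetrized) covariant derivatives of the parameter `α`, it is minus the
coefficient of the first derivative,
`⟨δS⟩ = ∫ dx tr_G (α B - 𝒟_μ α J_μ + higher derivatives of α)`,
where `B` is the effect of the explicit breaking of chiral symmetry. -/
def IsAxialNoetherCurrent (Q : SymPoly s) (A : Fin 4 → R4 → Matrix g g ℂ) (γ5 : Matrix s s ℂ)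
    (𝔤 : Submodule ℝ (Matrix g g ℂ)) (G : R4 → R4 → Matrix (s × g) (s × g) ℂ)
    (J : Fin 4 → R4 → Matrix g g ℂ) : Prop :=
  ∃ B : R4 → Matrix g g ℂ, ∀ α : R4 → Matrix g g ℂ, SmoothMat α → (∀ x, α x ∈ 𝔤) →
    ∀ x, IsSlowAt A α x →
      variationDensity Q A γ5 G α x =
        (α x * B x).trace - ∑ μ, (covD A μ α x * J μ x).trace

/-- The integrand `tr_D (G_W ∂_{p_μ} [Q, γ⁵])`. -/
def currentIntegrand (Q : SymPoly s) (A : Fin 4 → R4 → Matrix g g ℂ) (γ5 : Matrix s s ℂ)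
    (G : R4 → R4 → Matrix (s × g) (s × g) ℂ) (μ : Fin 4) (x p : R4) : Matrix g g ℂ :=
  trD (wigner A G x p * (dp μ (Q.comm γ5) x p ⊗ₖ (1 : Matrix g g ℂ)))

/-- `-(1/2) tr_D ∫ d⁴p/(2π)⁴ G_W ∂_{p_μ} [Q, γ⁵]`. -/
def axialCurrent (Q : SymPoly s) (A : Fin 4 → R4 → Matrix g g ℂ) (γ5 : Matrix s s ℂ)
    (G : R4 → R4 → Matrix (s × g) (s × g) ℂ) (μ : Fin 4) (x : R4) : Matrix g g ℂ :=
  Matrix.of fun a b =>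
    -(1 / 2 : ℂ) * (phaseNorm * ∫ p : R4, currentIntegrand Q A γ5 G μ x p a b)

/-- The integrand `tr_D (γ⁵ {Q, G_W})`. -/
def breakingIntegrand (Q : SymPoly s) (A : Fin 4 → R4 → Matrix g g ℂ) (γ5 : Matrix s s ℂ)
    (G : R4 → R4 → Matrix (s × g) (s × g) ℂ) (x p : R4) : Matrix g g ℂ :=
  trD ((γ5 ⊗ₖ (1 : Matrix g g ℂ)) *
    ((Q.symbol x p ⊗ₖ (1 : Matrix g g ℂ)) * wigner A G x p +
      wigner A G x p * (Q.symbol x p ⊗ₖ (1 : Matrix g g ℂ))))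

/-- `i tr_D γ⁵ ∫ d⁴p/(2π)⁴ {Q, G_W}`. -/
def chiralBreaking (Q : SymPoly s) (A : Fin 4 → R4 → Matrix g g ℂ) (γ5 : Matrix s s ℂ)
    (G : R4 → R4 → Matrix (s × g) (s × g) ℂ) (x : R4) : Matrix g g ℂ :=
  Matrix.of fun a b =>
    Complex.I * (phaseNorm * ∫ p : R4, breakingIntegrand Q A γ5 G x p a b)

/-- The integrand `tr_D (γ⁵ {∂_{p_μ} ∂_{p_ν} Q, G_W})`. -/
def secondIntegrand (Q : SymPoly s) (A : Fin 4 → R4 → Matrix g g ℂ) (γ5 : Matrix s s ℂ)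
    (G : R4 → R4 → Matrix (s × g) (s × g) ℂ) (μ ν : Fin 4) (x p : R4) : Matrix g g ℂ :=
  trD ((γ5 ⊗ₖ (1 : Matrix g g ℂ)) *
    ((dp μ (dp ν Q.symbol) x p ⊗ₖ (1 : Matrix g g ℂ)) * wigner A G x p +
      wigner A G x p * (dp μ (dp ν Q.symbol) x p ⊗ₖ (1 : Matrix g g ℂ))))

/-- `-(i/8) tr_D γ⁵ ∫ d⁴p/(2π)⁴ {∂_{p_μ} ∂_{p_ν} Q, G_W}`; it vanishes if `γ⁵` anticommutes
with `∂_{p_μ} ∂_{p_ν} Q`. -/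
def secondBreaking (Q : SymPoly s) (A : Fin 4 → R4 → Matrix g g ℂ) (γ5 : Matrix s s ℂ)
    (G : R4 → R4 → Matrix (s × g) (s × g) ℂ) (μ ν : Fin 4) (x : R4) : Matrix g g ℂ :=
  Matrix.of fun a b =>
    -(Complex.I / 8) * (phaseNorm * ∫ p : R4, secondIntegrand Q A γ5 G μ ν x p a b)

end Operators

/-- `γ⁵ = γ₁ γ₂ γ₃ γ₄`, acting as the identity on the internal indices `r`. -/
def gammaFive {r : Type*} [DecidableEq r] (γ : Fin 4 → Matrix (Fin 4) (Fin 4) ℂ) :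
    Matrix (Fin 4 × r) (Fin 4 × r) ℂ :=
  (γ 0 * γ 1 * γ 2 * γ 3) ⊗ₖ (1 : Matrix r r ℂ)

end WignerWeyl

end

open scoped Matrix Kronecker ContDiff

set_option linter.unusedSectionVars false

noncomputable section

namespace WignerWeyl

/-! Polarization turns a symmetrized product of letters into a combination of powers of the
operators L = a·x + b·D, and Q(x, p) is the same combination of powers of ℓ = a·x + i b·p
(`SymPoly.exists_line_decomposition`). It therefore suffices to find the Weyl symbol of the
variation of M L^N with a constant matrix M.

L^N is the N-th derivative at t = 0 of the flow e^{tL}, which is explicit: a phase times a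
translation along b with its Wilson line. In the trace of the varied flow against a test kernel, the
integration variable is moved to the midpoint of the two kernel arguments. The phase becomes e^{t
a·x}, the Wilson lines become those of the Wigner transform, and α appears as its parallel transport
to x from x ∓ tb/2 (`flowTrace_shift`). The Taylor coefficients of the transported α are the (b·𝒟)^l
α (`iteratedDeriv_transport`), while Fourier inversion turns t-derivatives of the remaining factor
into powers of ℓ (`iteratedDeriv_exp_mul_comp_line`). The Leibniz rule then gives an exact finite
formula for the symbol, ∑_l binom(N, l) ℓ^{N-l} i((-1/2)^l γ⁵M + (1/2)^l Mγ⁵) ⊗ (b·𝒟)^l α.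

Binomial coefficients times components of b are p-derivatives of powers of ℓ. Orders 0, 1, 2 are
thus i{γ⁵, Q} α, (1/2) ∂_p[Q, γ⁵] 𝒟α and -(i/8){γ⁵, ∂_p∂_p Q} 𝒟𝒟α (`axialOrder_zero`,
`axialOrder_one`, `axialOrder_two`). Later orders vanish when the third p-derivatives of Q do;
orders from two on vanish where α is slow. Multiplying by G_W, tracing and integrating gives both
expansions.

Three supports are needed. The Wilson line is smooth in both end points, by a bootstrap on Duhamel's
formula. The symbol, defined by duality, is unique (`IsWeylSymbol.unique`). Finally, the components
of the current along 𝔤 are determined because for each X in 𝔤 there is a slow 𝔤-valued α vanishing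
at x with one prescribed derivative X (`linearProbe`). -/

open MeasureTheory

/-! ### Entrywise calculus of matrix-valued functions. -/

section MatrixCalculus

variable {l m n : Type*} [Fintype m]

/-- Entrywise derivative of a matrix-valued function of a real variable. -/
def MatHasDerivAt (F : ℝ → Matrix l n ℂ) (F' : Matrix l n ℂ) (t : ℝ) : Prop :=
  ∀ i j, HasDerivAt (fun s => F s i j) (F' i j) t

lemma MatHasDerivAt.mul {F : ℝ → Matrix l m ℂ} {G : ℝ → Matrix m n ℂ} {F' : Matrix l m ℂ}
    {G' : Matrix m n ℂ} {t : ℝ} (hF : MatHasDerivAt F F' t) (hG : MatHasDerivAt G G' t) :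
    MatHasDerivAt (fun s => F s * G s) (F' * G t + F t * G') t := by
  intro i j
  simp only [Matrix.mul_apply, Matrix.add_apply, ← Finset.sum_add_distrib]
  exact HasDerivAt.fun_sum fun k _ => (hF i k).mul (hG k j)

lemma matHasDerivAt_const (C : Matrix l n ℂ) (t : ℝ) : MatHasDerivAt (fun _ => C) 0 t :=
  fun _ _ => hasDerivAt_const _ _

lemma MatHasDerivAt.scomp {F : ℝ → Matrix l n ℂ} {F' : Matrix l n ℂ} {t : ℝ} {h : ℝ → ℝ}
    {h' : ℝ} (hF : MatHasDerivAt F F' (h t)) (hh : HasDerivAt h h' t) :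
    MatHasDerivAt (fun s => F (h s)) ((h' : ℂ) • F') t := fun i j => by
  have := (hF i j).scomp t hh
  simpa [Function.comp_def] using this

lemma eq_of_matHasDerivAt_zero {F : ℝ → Matrix l n ℂ} (h : ∀ t, MatHasDerivAt F 0 t) (s t : ℝ) :
    F s = F t := by
  ext i j
  exact is_const_of_deriv_eq_zero (fun u => (h u i j).differentiableAt)
    (fun u => (h u i j).deriv) s t

/-- Entrywise smoothness of order `k` of a matrix-valued function. -/
def MatContDiff {E : Type*} [NormedAddCommGroup E] [NormedSpace ℝ E] (k : WithTop ℕ∞)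
    (F : E → Matrix l n ℂ) : Prop :=
  ∀ i j, ContDiff ℝ k (fun z => F z i j)

variable {E E' : Type*} [NormedAddCommGroup E] [NormedSpace ℝ E]
  [NormedAddCommGroup E'] [NormedSpace ℝ E'] {k : WithTop ℕ∞}

lemma MatContDiff.mul {F : E → Matrix l m ℂ} {G : E → Matrix m n ℂ} (hF : MatContDiff k F)
    (hG : MatContDiff k G) : MatContDiff k (fun z => F z * G z) := fun i j => by
  simp only [Matrix.mul_apply]
  exact ContDiff.sum fun a _ => (hF i a).mul (hG a j)

lemma MatContDiff.add {F G : E → Matrix l n ℂ} (hF : MatContDiff k F)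
    (hG : MatContDiff k G) : MatContDiff k (fun z => F z + G z) := fun i j =>
  (hF i j).add (hG i j)

lemma MatContDiff.sub {F G : E → Matrix l n ℂ} (hF : MatContDiff k F)
    (hG : MatContDiff k G) : MatContDiff k (fun z => F z - G z) := fun i j =>
  (hF i j).sub (hG i j)

lemma matContDiff_const (C : Matrix l n ℂ) : MatContDiff k (fun _ : E => C) := fun _ _ =>
  contDiff_const

lemma MatContDiff.smul {c : E → ℂ} {F : E → Matrix l n ℂ} (hc : ContDiff ℝ k c)
    (hF : MatContDiff k F) : MatContDiff k (fun z => c z • F z) := fun i j =>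
  hc.mul (hF i j)

lemma MatContDiff.const_smul (c : ℂ) {F : E → Matrix l n ℂ}
    (hF : MatContDiff k F) : MatContDiff k (fun z => c • F z) := fun i j =>
  contDiff_const.mul (hF i j)

lemma MatContDiff.sum {ι : Type*} {s : Finset ι} {F : ι → E → Matrix l n ℂ}
    (hF : ∀ i ∈ s, MatContDiff k (F i)) : MatContDiff k (fun z => ∑ i ∈ s, F i z) := fun a b => by
  simp only [Matrix.sum_apply]
  exact ContDiff.sum fun i hi => hF i hi a b

lemma MatContDiff.comp {F : E' → Matrix l n ℂ} (hF : MatContDiff k F) {f : E → E'}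
    (hf : ContDiff ℝ k f) : MatContDiff k (fun z => F (f z)) := fun i j => (hF i j).comp hf

lemma MatContDiff.kronecker {l' n' : Type*} {F : E → Matrix l n ℂ} {G : E → Matrix l' n' ℂ}
    (hF : MatContDiff k F) (hG : MatContDiff k G) : MatContDiff k (fun z => F z ⊗ₖ G z) :=
  fun i j => (hF i.1 j.1).mul (hG i.2 j.2)

lemma MatContDiff.trace {F : E → Matrix m m ℂ} (hF : MatContDiff k F) :
    ContDiff ℝ k (fun z => (F z).trace) := by
  simp only [Matrix.trace, Matrix.diag]
  exact ContDiff.sum fun i _ => hF i i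

end MatrixCalculus

/-! ### The path-ordered exponential series and the linear equation it solves. -/

section Dyson

variable {g : Type*} [Fintype g] [DecidableEq g]

lemma dysonTerm_succ_apply (a : ℝ → Matrix g g ℂ) (n : ℕ) (t : ℝ) (i j : g) :
    dysonTerm a (n + 1) t i j = ∫ s in (0 : ℝ)..t, (a s * dysonTerm a n s) i j := rfl

lemma continuous_dysonTerm_param {Z : Type*} [TopologicalSpace Z] [FirstCountableTopology Z]
    {a : Z → ℝ → Matrix g g ℂ}
    (ha : ∀ i j, Continuous fun p : Z × ℝ => a p.1 p.2 i j) (n : ℕ) :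
    ∀ i j, Continuous fun p : Z × ℝ => dysonTerm (a p.1) n p.2 i j := by
  induction n with
  | zero => intro i j; simp only [dysonTerm]; exact continuous_const
  | succ n ih =>
    intro i j
    simp only [dysonTerm_succ_apply]
    refine intervalIntegral.continuous_parametric_primitive_of_continuous
      (f := fun z s => (a z s * dysonTerm (a z) n s) i j) ?_
    simp only [Function.uncurry_def, Matrix.mul_apply]
    exact continuous_finsetSum _ fun k _ => (ha i k).mul (ih k j)

lemma continuous_dysonTerm {a : ℝ → Matrix g g ℂ} (ha : ∀ i j, Continuous fun t => a t i j)
    (n : ℕ) (i j : g) : Continuous fun t => dysonTerm a n t i j := by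
  have := continuous_dysonTerm_param (Z := Unit) (a := fun _ => a)
    (fun i j => (ha i j).comp continuous_snd) n i j
  exact this.comp (f := fun t : ℝ => ((), t)) (Continuous.prodMk continuous_const continuous_id)

/-- The factorial comes from the iterated integration of powers of |t|; each matrix product of
entrywise bounded factors costs one factor `Fintype.card g`. -/
lemma norm_dysonTerm_le {a : ℝ → Matrix g g ℂ} {C R : ℝ} (hC : 0 ≤ C)
    (hb : ∀ t, |t| ≤ R → ∀ i j, ‖a t i j‖ ≤ C) (n : ℕ) :
    ∀ t, |t| ≤ R → ∀ i j,
      ‖dysonTerm a n t i j‖ ≤ (Fintype.card g * C) ^ n * |t| ^ n / n.factorial := by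
  induction n with
  | zero =>
    intro t _ i j
    by_cases h : i = j <;> simp [dysonTerm, Matrix.one_apply, h]
  | succ n ih =>
    intro t ht i j
    rw [dysonTerm_succ_apply, intervalIntegral.norm_integral_eq_norm_integral_uIoc]
    have hmem : ∀ s ∈ Set.uIoc 0 t, |s| ≤ R := fun s hs => by
      have := Set.abs_sub_left_of_mem_uIcc (Set.uIoc_subset_uIcc hs)
      simp only [sub_zero] at this
      linarith
    have hbd : ∀ s ∈ Set.uIoc 0 t, ‖(a s * dysonTerm a n s) i j‖ ≤
        ((Fintype.card g * C) ^ (n + 1) / n.factorial) * |s - 0| ^ n := by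
      intro s hs
      rw [Matrix.mul_apply]
      refine (norm_sum_le _ _).trans ?_
      have : ∀ k ∈ Finset.univ, ‖a s i k * dysonTerm a n s k j‖ ≤
          C * ((Fintype.card g * C) ^ n * |s| ^ n / n.factorial) := fun k _ => by
        rw [norm_mul]
        exact mul_le_mul (hb s (hmem s hs) i k) (ih s (hmem s hs) k j) (norm_nonneg _) hC
      refine (Finset.sum_le_sum this).trans (le_of_eq ?_)
      simp only [Finset.sum_const, Finset.card_univ, nsmul_eq_mul, sub_zero]
      ring
    have hint : IntegrableOn (fun s : ℝ => ((Fintype.card g * C) ^ (n + 1) / n.factorial) *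
        |s - 0| ^ n) (Set.uIoc 0 t) := by
      have : Continuous fun s : ℝ => ((Fintype.card g * C) ^ (n + 1) / n.factorial) *
        |s - 0| ^ n := by fun_prop
      exact (this.integrableOn_uIcc).mono_set Set.uIoc_subset_uIcc
    refine (norm_integral_le_of_norm_le hint
      ((ae_restrict_iff' measurableSet_uIoc).2 (Filter.Eventually.of_forall hbd))).trans
      (le_of_eq ?_)
    rw [integral_const_mul, integral_pow_abs_sub_uIoc, sub_zero, Nat.factorial_succ]
    push_cast
    field_simp

/-- The path-ordered exponential of a matrix function as a function of the end point. -/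
def dyson (a : ℝ → Matrix g g ℂ) (t : ℝ) : Matrix g g ℂ :=
  Matrix.of fun i j => ∑' n : ℕ, dysonTerm a n t i j

lemma dyson_zero (a : ℝ → Matrix g g ℂ) : dyson a 0 = 1 := by
  ext i j
  simp only [dyson, Matrix.of_apply]
  rw [tsum_eq_single 0]
  · rfl
  · intro n hn
    obtain ⟨n, rfl⟩ := Nat.exists_eq_succ_of_ne_zero hn
    simp [dysonTerm_succ_apply]

lemma exists_entry_bound {a : ℝ → Matrix g g ℂ} (ha : ∀ i j, Continuous fun t => a t i j)
    (R : ℝ) : ∃ C, 0 ≤ C ∧ ∀ t, |t| ≤ R → ∀ i j, ‖a t i j‖ ≤ C := by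
  have h : ∀ p : g × g, ∃ C, ∀ t ∈ Set.Icc (-R) R, ‖a t p.1 p.2‖ ≤ C := fun p =>
    isCompact_Icc.exists_bound_of_continuousOn (ha p.1 p.2).continuousOn
  choose C hC using h
  refine ⟨∑ p, |C p|, Finset.sum_nonneg fun _ _ => abs_nonneg _, fun t ht i j => ?_⟩
  exact ((hC (i, j) t (abs_le.1 ht)).trans (le_abs_self _)).trans
    (Finset.single_le_sum (f := fun p => |C p|) (fun _ _ => abs_nonneg _) (Finset.mem_univ (i, j)))

/-- Termwise differentiation: term n + 1 has derivative a times term n, so the differentiated series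
is the original one shifted by one index and is dominated by an exponential series on a ball
containing both 0 and t. -/
lemma dyson_hasDerivAt {a : ℝ → Matrix g g ℂ} (ha : ∀ i j, Continuous fun t => a t i j) (t : ℝ) :
    MatHasDerivAt (dyson a) (a t * dyson a t) t := by
  intro i j
  set R : ℝ := |t| + 1 with hR
  obtain ⟨C, hC, hb⟩ := exists_entry_bound ha R
  set K : ℝ := Fintype.card g * C with hK
  have hK0 : 0 ≤ K := by positivity
  have hR0 : 0 < R := by positivity
  have hbound : ∀ n, ∀ s ∈ Metric.ball (0 : ℝ) R, ∀ k l,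
      ‖dysonTerm a n s k l‖ ≤ (K * R) ^ n / n.factorial := fun n s hs k l => by
    have hs' : |s| ≤ R := by
      rw [mem_ball_zero_iff, Real.norm_eq_abs] at hs; exact hs.le
    refine (norm_dysonTerm_le hC hb n s hs' k l).trans ?_
    rw [← hK, mul_pow K R]
    gcongr
  have hsum := Real.summable_pow_div_factorial (K * R)
  let g' : ℕ → ℝ → ℂ := fun n s => match n with
    | 0 => 0
    | n + 1 => (a s * dysonTerm a n s) i j
  let u : ℕ → ℝ := fun n => match n with
    | 0 => 0
    | n + 1 => K * ((K * R) ^ n / n.factorial)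
  have hu : Summable u := (summable_nat_add_iff 1).1 (hsum.mul_left K)
  have hmem : t ∈ Metric.ball (0 : ℝ) R := by
    rw [mem_ball_zero_iff, Real.norm_eq_abs, hR]; linarith
  have key := hasDerivAt_tsum_of_isPreconnected (g := fun n s => dysonTerm a n s i j) (g' := g')
    (u := u) (y₀ := 0) (y := t) hu (Metric.isOpen_ball (x := (0 : ℝ)) (ε := R))
    (convex_ball _ _).isPreconnected ?_ ?_ (by simpa using hR0) ?_ hmem
  · have e : (∑' n, g' n t) = (a t * dyson a t) i j := by
      have hg's : Summable fun n => g' n t := by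
        refine (summable_nat_add_iff 1).1 ?_
        simp only [g', Matrix.mul_apply]
        exact summable_sum fun k _ =>
          (Summable.of_norm_bounded hsum fun n => hbound n t hmem k j).mul_left _
      rw [hg's.tsum_eq_zero_add]
      simp only [g', zero_add, Matrix.mul_apply, dyson, Matrix.of_apply]
      rw [Summable.tsum_finsetSum fun k _ =>
        (Summable.of_norm_bounded hsum fun n => hbound n t hmem k j).mul_left _]
      exact Finset.sum_congr rfl fun k _ => tsum_mul_left
    rw [e] at key
    exact key
  · intro n s _
    cases n with
    | zero => simpa [g', dysonTerm] using hasDerivAt_const s ((1 : Matrix g g ℂ) i j)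
    | succ n =>
      have hc : Continuous fun s => (a s * dysonTerm a n s) i j := by
        simp only [Matrix.mul_apply]
        exact continuous_finsetSum _ fun k _ => (ha i k).mul (continuous_dysonTerm ha n k j)
      exact intervalIntegral.integral_hasDerivAt_right (hc.intervalIntegrable _ _)
        (hc.stronglyMeasurableAtFilter _ _) hc.continuousAt
  · intro n s hs
    cases n with
    | zero => simp [g', u]
    | succ n =>
      simp only [g', u, Matrix.mul_apply]
      refine (norm_sum_le _ _).trans ?_
      have hs' : |s| ≤ R := by
        rw [mem_ball_zero_iff, Real.norm_eq_abs] at hs; exact hs.le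
      have : ∀ k ∈ Finset.univ, ‖a s i k * dysonTerm a n s k j‖ ≤
          C * ((K * R) ^ n / n.factorial) := fun k _ => by
        rw [norm_mul]
        exact mul_le_mul (hb s hs' i k) (hbound n s hs k j) (norm_nonneg _) hC
      refine (Finset.sum_le_sum this).trans (le_of_eq ?_)
      simp only [Finset.sum_const, Finset.card_univ, nsmul_eq_mul, hK]
      ring
  · exact Summable.of_norm_bounded hsum fun n =>
      hbound n 0 (by simpa using hR0) i j

/-- The inverse of the path-ordered exponential, as a solution of `R' = -R a`. -/
def dysonInv (a : ℝ → Matrix g g ℂ) (t : ℝ) : Matrix g g ℂ :=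
  -- Transposition turns R' = -R a, with the coefficient on the right, into an equation with the
  -- coefficient on the left.
  (dyson (fun s => -(a s)ᵀ) t)ᵀ

lemma dysonInv_zero (a : ℝ → Matrix g g ℂ) : dysonInv a 0 = 1 := by
  simp [dysonInv, dyson_zero]

lemma dysonInv_hasDerivAt {a : ℝ → Matrix g g ℂ} (ha : ∀ i j, Continuous fun t => a t i j)
    (t : ℝ) : MatHasDerivAt (dysonInv a) (-(dysonInv a t * a t)) t := by
  intro i j
  have := dyson_hasDerivAt (a := fun s => -(a s)ᵀ) (fun i j => (ha j i).neg) t j i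
  have e : -(dysonInv a t * a t) = (-(a t)ᵀ * dyson (fun s => -(a s)ᵀ) t)ᵀ := by
    simp [dysonInv, Matrix.transpose_mul]
  rw [e]; exact this

lemma dysonInv_mul {a : ℝ → Matrix g g ℂ} (ha : ∀ i j, Continuous fun t => a t i j)
    {F : ℝ → Matrix g g ℂ} (hF : ∀ t, MatHasDerivAt F (a t * F t) t) (t : ℝ) :
    dysonInv a t * F t = F 0 := by
  have := eq_of_matHasDerivAt_zero (F := fun s => dysonInv a s * F s) (fun s => by
    have := (dysonInv_hasDerivAt ha s).mul (hF s)
    rwa [Matrix.neg_mul, Matrix.mul_assoc, neg_add_cancel] at this) t 0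
  simpa [dysonInv_zero] using this

lemma dysonInv_mul_dyson {a : ℝ → Matrix g g ℂ} (ha : ∀ i j, Continuous fun t => a t i j)
    (t : ℝ) : dysonInv a t * dyson a t = 1 := by
  rw [dysonInv_mul ha (dyson_hasDerivAt ha), dyson_zero]

lemma dyson_mul_dysonInv {a : ℝ → Matrix g g ℂ} (ha : ∀ i j, Continuous fun t => a t i j)
    (t : ℝ) : dyson a t * dysonInv a t = 1 :=
  mul_eq_one_comm.1 (dysonInv_mul_dyson ha t)

/-- Uniqueness for the linear equation `F' = a F`. -/
lemma eq_dyson_mul {a : ℝ → Matrix g g ℂ} (ha : ∀ i j, Continuous fun t => a t i j)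
    {F : ℝ → Matrix g g ℂ} (hF : ∀ t, MatHasDerivAt F (a t * F t) t) (t : ℝ) :
    F t = dyson a t * F 0 := by
  rw [← dysonInv_mul ha hF t, ← Matrix.mul_assoc, dyson_mul_dysonInv ha, Matrix.one_mul]

lemma continuous_dyson_param {Z : Type*} [TopologicalSpace Z] [FirstCountableTopology Z]
    [LocallyCompactSpace Z] {a : Z → ℝ → Matrix g g ℂ}
    (ha : ∀ i j, Continuous fun p : Z × ℝ => a p.1 p.2 i j) (i j : g) :
    Continuous fun z => dyson (a z) 1 i j := by
  rw [continuous_iff_continuousAt]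
  intro z₀
  obtain ⟨S, hS, hz⟩ := exists_compact_mem_nhds z₀
  have h : ∀ p : g × g, ∃ C, ∀ q ∈ S ×ˢ Set.Icc (-1 : ℝ) 1, ‖a q.1 q.2 p.1 p.2‖ ≤ C := fun p =>
    (hS.prod isCompact_Icc).exists_bound_of_continuousOn (ha p.1 p.2).continuousOn
  choose C hC using h
  let D := ∑ p, |C p|
  have hD : 0 ≤ D := Finset.sum_nonneg fun _ _ => abs_nonneg _
  have hb : ∀ z ∈ S, ∀ t, |t| ≤ 1 → ∀ i j, ‖a z t i j‖ ≤ D := fun z hz t ht i j =>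
    ((hC (i, j) (z, t) ⟨hz, abs_le.1 ht⟩).trans (le_abs_self _)).trans
      (Finset.single_le_sum (f := fun p => |C p|) (fun _ _ => abs_nonneg _)
        (Finset.mem_univ (i, j)))
  refine ContinuousOn.continuousAt ?_ hz
  have hf : ∀ n, ContinuousOn (fun z => dysonTerm (a z) n 1 i j) S := fun n =>
    ((continuous_dysonTerm_param ha n i j).comp (f := fun z : Z => (z, (1 : ℝ)))
      (by fun_prop)).continuousOn
  have hfu : ∀ n z, z ∈ S →
      ‖dysonTerm (a z) n 1 i j‖ ≤ (Fintype.card g * D) ^ n / n.factorial := fun n z hz => by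
    have := norm_dysonTerm_le hD (hb z hz) n 1 (by simp) i j
    rwa [abs_one, one_pow, mul_one] at this
  exact continuousOn_tsum hf (Real.summable_pow_div_factorial _) hfu

end Dyson

/-! ### Differentiation under integrals over compact sets. -/

section ParametricIntegral

variable {E X : Type*} [NormedAddCommGroup E] [NormedSpace ℝ E] [FiniteDimensional ℝ E]
  [NormedAddCommGroup X] [NormedSpace ℝ X] [FiniteDimensional ℝ X] [MeasurableSpace X]
  [BorelSpace X] {μ : Measure X} [IsLocallyFiniteMeasure μ] {S : Set X}

lemma hasFDerivAt_setIntegral (hS : IsCompact S) {F : E × X → ℂ} (hF : ContDiff ℝ 1 F) (z : E) :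
    HasFDerivAt (fun z => ∫ x in S, F (z, x) ∂μ)
      (∫ x in S, (fderiv ℝ F (z, x)).comp (ContinuousLinearMap.inl ℝ E X) ∂μ) z := by
  have hcont : Continuous fun p : E × X =>
      (fderiv ℝ F p).comp (ContinuousLinearMap.inl ℝ E X) :=
    (hF.continuous_fderiv one_ne_zero).clm_comp continuous_const
  obtain ⟨C, hC⟩ := ((isCompact_closedBall z 1).prod hS).exists_bound_of_continuousOn
    hcont.continuousOn
  have hfin : IsFiniteMeasure (μ.restrict S) := ⟨by
    rw [Measure.restrict_apply_univ]; exact hS.measure_lt_top⟩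
  refine hasFDerivAt_integral_of_dominated_of_fderiv_le (bound := fun _ => C)
    (F' := fun z x => (fderiv ℝ F (z, x)).comp (ContinuousLinearMap.inl ℝ E X))
    (Metric.closedBall_mem_nhds z one_pos) ?_ ?_ ?_ ?_ (integrable_const C) ?_
  · exact Filter.Eventually.of_forall fun z =>
      (hF.continuous.comp (f := fun x : X => (z, x)) (by fun_prop)).aestronglyMeasurable
  · exact (hF.continuous.comp (f := fun x : X => (z, x)) (by fun_prop)).continuousOn.integrableOn_compact
      hS
  · exact (hcont.comp (f := fun x : X => (z, x)) (by fun_prop)).aestronglyMeasurable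
  · refine ae_restrict_of_forall_mem hS.measurableSet fun x hx y hy => hC (y, x) ⟨hy, hx⟩
  · refine Filter.Eventually.of_forall fun x y _ => ?_
    have h1 : HasFDerivAt F (fderiv ℝ F (y, x)) (y, x) :=
      (hF.differentiable one_ne_zero _).hasFDerivAt
    exact h1.comp y (hasFDerivAt_prodMk_left y x)

lemma fderiv_setIntegral_apply (hS : IsCompact S) {F : E × X → ℂ} (hF : ContDiff ℝ 1 F) (z v : E) :
    fderiv ℝ (fun z => ∫ x in S, F (z, x) ∂μ) z v = ∫ x in S, fderiv ℝ F (z, x) (v, 0) ∂μ := by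
  rw [(hasFDerivAt_setIntegral hS hF z).fderiv, ContinuousLinearMap.integral_apply]
  · simp
  · have hcont : Continuous fun p : E × X =>
        (fderiv ℝ F p).comp (ContinuousLinearMap.inl ℝ E X) :=
      (hF.continuous_fderiv one_ne_zero).clm_comp continuous_const
    exact (hcont.comp (f := fun x : X => (z, x)) (by fun_prop)).continuousOn.integrableOn_compact
      hS

lemma contDiff_setIntegral (hS : IsCompact S) (k : ℕ) : ∀ {F : E × X → ℂ},
    ContDiff ℝ k F → ContDiff ℝ k (fun z => ∫ x in S, F (z, x) ∂μ) := by
  induction k with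
  | zero =>
    intro F hF
    simp only [Nat.cast_zero, contDiff_zero] at hF ⊢
    exact continuous_parametric_integral_of_continuous (f := fun z x => F (z, x)) hF hS
  | succ k ih =>
    intro F hF
    push_cast at hF ⊢
    have h1 : ContDiff ℝ 1 F := hF.of_le (by simp)
    refine contDiff_succ_iff_fderiv_apply.2
      ⟨fun z => (hasFDerivAt_setIntegral hS h1 z).differentiableAt, by simp, fun v => ?_⟩
    simp only [fderiv_setIntegral_apply hS h1]
    exact ih ((hF.fderiv_right le_rfl).clm_apply contDiff_const)

/-- Differentiation under the integral sign at a zero of a factor; the other factors need only be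
continuous. -/
lemma hasFDerivAt_setIntegral_mul_of_zero (hS : IsCompact S) {L : X → ℂ} (hL : Continuous L)
    {h R : E × X → ℂ} (hh : ContDiff ℝ 1 h) (hR : Continuous R) (z : E)
    (h0 : ∀ x, h (z, x) = 0) :
    HasFDerivAt (fun y => ∫ x in S, L x * h (y, x) * R (y, x) ∂μ)
      (∫ x in S, (L x * R (z, x)) •
        (fderiv ℝ h (z, x)).comp (ContinuousLinearMap.inl ℝ E X) ∂μ) z := by
  have hcont : Continuous fun p : E × X =>
      (fderiv ℝ h p).comp (ContinuousLinearMap.inl ℝ E X) :=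
    (hh.continuous_fderiv one_ne_zero).clm_comp continuous_const
  have hdiff : ∀ y x, HasFDerivAt (fun y => h (y, x))
      ((fderiv ℝ h (y, x)).comp (ContinuousLinearMap.inl ℝ E X)) y := fun y x => by
    have h1 : HasFDerivAt h (fderiv ℝ h (y, x)) (y, x) :=
      (hh.differentiable one_ne_zero _).hasFDerivAt
    exact h1.comp y (hasFDerivAt_prodMk_left y x)
  obtain ⟨C, hC⟩ := ((isCompact_closedBall z 1).prod hS).exists_bound_of_continuousOn
    hcont.continuousOn
  have hLR : Continuous fun p : E × X => L p.2 * R p := by fun_prop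
  obtain ⟨D, hD⟩ := ((isCompact_closedBall z 1).prod hS).exists_bound_of_continuousOn
    hLR.continuousOn
  have hfin : IsFiniteMeasure (μ.restrict S) := ⟨by
    rw [Measure.restrict_apply_univ]; exact hS.measure_lt_top⟩
  have hFc : ∀ y, Continuous fun x => L x * h (y, x) * R (y, x) := fun y => by
    have := hh.continuous; fun_prop
  refine (hasFDerivAt_integral_of_dominated_loc_of_lip' (bound := fun _ => D * C)
    (Metric.closedBall_mem_nhds z one_pos) ?_ ?_ ?_ ?_ (integrable_const (D * C)) ?_).2
  · exact fun y _ => (hFc y).aestronglyMeasurable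
  · exact (hFc z).continuousOn.integrableOn_compact hS
  · refine Continuous.aestronglyMeasurable ?_
    exact (hLR.comp (f := fun x : X => (z, x)) (by fun_prop)).smul
      (hcont.comp (f := fun x : X => (z, x)) (by fun_prop))
  · refine ae_restrict_of_forall_mem hS.measurableSet fun x hx y hy => ?_
    have hlip : ‖h (y, x) - h (z, x)‖ ≤ C * ‖y - z‖ :=
      (convex_closedBall z 1).norm_image_sub_le_of_norm_hasFDerivWithin_le
        (fun y _ => (hdiff y x).hasFDerivWithinAt) (fun y hy => hC (y, x) ⟨hy, hx⟩)
        (Metric.mem_closedBall_self zero_le_one) hy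
    rw [h0, sub_zero] at hlip
    have hD' := hD (y, x) ⟨hy, hx⟩
    have hD0 : 0 ≤ D := (norm_nonneg _).trans hD'
    calc ‖L x * h (y, x) * R (y, x) - L x * h (z, x) * R (z, x)‖
        = ‖L x * R (y, x)‖ * ‖h (y, x)‖ := by rw [h0, ← norm_mul]; congr 1; ring
      _ ≤ D * (C * ‖y - z‖) := mul_le_mul hD' hlip (norm_nonneg _) hD0
      _ = D * C * ‖y - z‖ := by ring
  · refine Filter.Eventually.of_forall fun x => ?_
    have h1 := hdiff z x
    have hRx : Continuous fun y => L x * R (y, x) := by fun_prop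
    -- Since h vanishes at z, h(y) = O(y - z), while continuity alone makes the change of L R an
    -- o(1); their product is o(y - z), and what remains is the linearization of h.
    rw [hasFDerivAt_iff_isLittleO] at h1 ⊢
    have e2 : (fun y => h (y, x)) =O[nhds z] fun y => y - z := by
      have := (hdiff z x).isBigO_sub
      simpa only [h0, sub_zero] using this
    have e3 : (fun y => L x * R (y, x) - L x * R (z, x)) =o[nhds z] fun _ => (1 : ℝ) := by
      rw [Asymptotics.isLittleO_one_iff, tendsto_sub_nhds_zero_iff]
      exact hRx.tendsto z
    have e4 := e3.mul_isBigO e2.norm_right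
    have e5 := h1.const_mul_left (L x * R (z, x))
    have e6 := (e4.congr_right (g₂ := fun y => ‖y - z‖) (fun y => by simp)).of_norm_right
    refine (e5.add e6).congr_left fun y => ?_
    simp only [h0, _root_.smul_apply, smul_eq_mul]
    ring

end ParametricIntegral

/-! ### Wilson lines along straight paths. -/

section Wilson

variable {g : Type*} [Fintype g] [DecidableEq g] {A : Fin 4 → R4 → Matrix g g ℂ}

/-- The matrix `i b · A(x)`. -/
def conn (A : Fin 4 → R4 → Matrix g g ℂ) (b x : R4) : Matrix g g ℂ :=
  Complex.I • ∑ μ, ((b μ : ℝ) : ℂ) • A μ x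

lemma conn_real_smul (s : ℝ) (b x : R4) : conn A (s • b) x = (s : ℂ) • conn A b x := by
  simp only [conn, PiLp.smul_apply, smul_eq_mul, Complex.ofReal_mul, mul_smul, Finset.smul_sum]
  exact Finset.sum_congr rfl fun μ _ => by rw [smul_comm]

lemma matContDiff_conn {E : Type*} [NormedAddCommGroup E] [NormedSpace ℝ E]
    (hA : ∀ μ, SmoothMat (A μ)) {b x : E → R4} (hb : ContDiff ℝ ∞ b) (hx : ContDiff ℝ ∞ x) :
    MatContDiff ∞ (fun z => conn A (b z) (x z)) := by
  refine MatContDiff.const_smul _ (MatContDiff.sum fun μ _ => MatContDiff.smul ?_ ?_)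
  · exact Complex.ofRealCLM.contDiff.comp (contDiff_euclidean.1 hb μ)
  · exact MatContDiff.comp (hA μ) hx

lemma continuous_conn_line (hA : ∀ μ, SmoothMat (A μ)) (b x : R4) (i j : g) :
    Continuous fun t : ℝ => conn A b (x + t • b) i j :=
  (matContDiff_conn hA contDiff_const (by fun_prop) i j).continuous

lemma wilson_self (x : R4) : wilson A x x = 1 := by
  have h : (fun t : ℝ => Complex.I • ∑ μ, (((x - x) μ : ℝ) : ℂ) • A μ (x + t • (x - x))) =
      fun _ => 0 := by
    ext; simp
  have e : wilson A x x = dyson (fun _ => (0 : Matrix g g ℂ)) 1 := by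
    unfold wilson; rw [h]; rfl
  have := eq_dyson_mul (a := fun _ => (0 : Matrix g g ℂ)) (F := fun _ => 1)
    (fun _ _ => continuous_const) (fun t => by
      rw [Matrix.zero_mul]; exact matHasDerivAt_const 1 t) 1
  rw [e]; simpa using this.symm

/-- Reparametrization: t ↦ `dyson` (s t) solves the equation whose coefficient is the connection
rescaled by s. -/
lemma wilson_eq_dyson (hA : ∀ μ, SmoothMat (A μ)) (x b : R4) (s : ℝ) :
    wilson A (x + s • b) x = dyson (fun t => conn A b (x + t • b)) s := by
  have hc := continuous_conn_line hA b x
  have hc' := continuous_conn_line hA (s • b) x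
  have e : wilson A (x + s • b) x = dyson (fun t => conn A (s • b) (x + t • s • b)) 1 := by
    unfold wilson dyson conn; simp only [add_sub_cancel_left]
  have := eq_dyson_mul hc' (F := fun t => dyson (fun t => conn A b (x + t • b)) (s * t))
    (fun t => by
      have h1 := (dyson_hasDerivAt hc (s * t)).scomp (h := fun t => s * t) (t := t)
        (by simpa using (hasDerivAt_id t).const_mul s)
      rwa [← Matrix.smul_mul, ← conn_real_smul, mul_comm s t, mul_smul, mul_comm t s] at h1) 1
  rw [e]
  simpa [dyson_zero] using this.symm

/-- Running the path backwards, t ↦ `dyson` (s (1 - t)) solves the equation of the reversed segment.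
It ends at 1 and starts at `dyson` s, so the reversed Wilson line is the inverse. -/
lemma wilson_eq_dysonInv (hA : ∀ μ, SmoothMat (A μ)) (x b : R4) (s : ℝ) :
    wilson A x (x + s • b) = dysonInv (fun t => conn A b (x + t • b)) s := by
  have hc := continuous_conn_line hA b x
  have hc' := continuous_conn_line hA (-(s • b)) (x + s • b)
  have e := eq_dyson_mul (a := fun t => conn A (-(s • b)) (x + s • b + t • -(s • b)))
    hc' (F := fun t => dyson (fun t => conn A b (x + t • b)) (s * (1 - t)))
    (fun t => by
      have h1 := (dyson_hasDerivAt hc (s * (1 - t))).scomp (h := fun t => s * (1 - t)) (t := t)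
        (h' := -s) (by simpa using ((hasDerivAt_id t).const_sub 1).const_mul s)
      rw [← Matrix.smul_mul, ← conn_real_smul] at h1
      have e1 : x + (s * (1 - t)) • b = x + s • b + t • -(s • b) := by module
      rwa [e1, neg_smul] at h1) 1
  have e' : wilson A x (x + s • b) =
      dyson (fun t => conn A (-(s • b)) (x + s • b + t • -(s • b))) 1 := by
    have : x - (x + s • b) = -(s • b) := by abel
    unfold wilson dyson conn; simp only [this]
  simp only [sub_self, mul_zero, dyson_zero, sub_zero, mul_one] at e
  rw [e', ← mul_one (dyson _ 1), ← dyson_mul_dysonInv hc s, ← mul_assoc, ← e, one_mul]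

lemma wilson_mul_wilson_inv (hA : ∀ μ, SmoothMat (A μ)) (w x : R4) :
    wilson A w x * wilson A x w = 1 := by
  have h1 := wilson_eq_dyson hA x (w - x) 1
  have h2 := wilson_eq_dysonInv hA x (w - x) 1
  rw [one_smul, add_sub_cancel] at h1 h2
  rw [h1, h2, dyson_mul_dysonInv (continuous_conn_line hA _ _)]

lemma wilson_hasDerivAt_left (hA : ∀ μ, SmoothMat (A μ)) (x b : R4) (t : ℝ) :
    MatHasDerivAt (fun t : ℝ => wilson A (x + t • b) x)
      (conn A b (x + t • b) * wilson A (x + t • b) x) t := by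
  simp only [wilson_eq_dyson hA]
  exact dyson_hasDerivAt (continuous_conn_line hA b x) t

lemma wilson_hasDerivAt_right (hA : ∀ μ, SmoothMat (A μ)) (x b : R4) (t : ℝ) :
    MatHasDerivAt (fun t : ℝ => wilson A x (x + t • b))
      (-(wilson A x (x + t • b) * conn A b (x + t • b))) t := by
  simp only [wilson_eq_dysonInv hA]
  exact dysonInv_hasDerivAt (continuous_conn_line hA b x) t

/-- On one line the order of the points is irrelevant, so a detour through x is allowed even when x
is not between the other two: both sides solve the same equation in τ and agree at τ = σ. -/
lemma wilson_mul_wilson_of_collinear (hA : ∀ μ, SmoothMat (A μ)) (x b : R4) (σ τ : ℝ) :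
    wilson A (x + τ • b) x * wilson A x (x + σ • b) = wilson A (x + τ • b) (x + σ • b) := by
  have hc := continuous_conn_line hA b (x + σ • b)
  have e1 := eq_dyson_mul hc (F := fun t => wilson A (x + (σ + t) • b) x) (fun t => by
    have h1 := (wilson_hasDerivAt_left hA x b (σ + t)).scomp (h := fun t => σ + t) (t := t)
      (h' := 1) (by simpa using (hasDerivAt_id t).const_add σ)
    have e1 : x + (σ + t) • b = x + σ • b + t • b := by module
    simp only [Complex.ofReal_one, one_smul] at h1
    rw [e1] at h1
    simpa only [e1] using h1) (τ - σ)
  have e2 := wilson_eq_dyson hA (x + σ • b) b (τ - σ)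
  have e3 : x + σ • b + (τ - σ) • b = x + τ • b := by module
  rw [e3] at e2
  simp only [add_sub_cancel, add_zero] at e1
  rw [e1, e2, mul_assoc, wilson_mul_wilson_inv hA, mul_one]

end Wilson

lemma mul_mul_apply_eq_sum {l m n o : Type*} [Fintype m] [Fintype n] (L : Matrix l m ℂ)
    (M : Matrix m n ℂ) (R : Matrix n o ℂ) (i : l) (j : o) :
    (L * M * R) i j = ∑ k, ∑ a, L i k * M k a * R a j := by
  rw [Matrix.mul_apply, Finset.sum_comm]
  exact Finset.sum_congr rfl fun k _ => by rw [Matrix.mul_apply, Finset.sum_mul]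

/-! ### Joint smoothness of the Wilson line in its two end points. -/

section WilsonSmooth

variable {g : Type*} [Fintype g] [DecidableEq g] {A : Fin 4 → R4 → Matrix g g ℂ}

/-- The straight path from `z.2` to `z.1`. -/
def segPath (z : R4 × R4) (s : ℝ) : R4 := z.2 + s • (z.1 - z.2)

lemma contDiff_segPath {k : WithTop ℕ∞} :
    ContDiff ℝ k fun p : (R4 × R4) × ℝ => segPath p.1 p.2 := by
  unfold segPath; fun_prop

/-- The connection along the straight path from `z.2` to `z.1`. -/
def segConn (A : Fin 4 → R4 → Matrix g g ℂ) (z : R4 × R4) (s : ℝ) : Matrix g g ℂ :=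
  conn A (z.1 - z.2) (segPath z s)

lemma matContDiff_segConn (hA : ∀ μ, SmoothMat (A μ)) :
    MatContDiff ∞ fun p : (R4 × R4) × ℝ => segConn A p.1 p.2 :=
  matContDiff_conn hA (by fun_prop) contDiff_segPath

lemma continuous_wilson (hA : ∀ μ, SmoothMat (A μ)) (i j : g) :
    Continuous fun z : R4 × R4 => wilson A z.1 z.2 i j :=
  continuous_dyson_param (a := segConn A) (fun i j => (matContDiff_segConn hA i j).continuous) i j

lemma continuous_wilson_comp {Z : Type*} [TopologicalSpace Z] (hA : ∀ μ, SmoothMat (A μ))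
    {w x : Z → R4} (hw : Continuous w) (hx : Continuous x) (i j : g) :
    Continuous fun t => wilson A (w t) (x t) i j :=
  (continuous_wilson hA i j).comp (f := fun t => (w t, x t)) (hw.prodMk hx)

lemma continuous_segPath_comp {Z : Type*} [TopologicalSpace Z]
    {z : Z → R4 × R4} {s : Z → ℝ} (hz : Continuous z) (hs : Continuous s) :
    Continuous fun t => segPath (z t) (s t) := by
  unfold segPath; fun_prop

lemma wilson_segPath_left (hA : ∀ μ, SmoothMat (A μ)) (z : R4 × R4) (s : ℝ) :
    wilson A (segPath z s) z.2 = dyson (segConn A z) s :=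
  wilson_eq_dyson hA z.2 (z.1 - z.2) s

lemma wilson_segPath_right (hA : ∀ μ, SmoothMat (A μ)) (z : R4 × R4) (s : ℝ) :
    wilson A z.2 (segPath z s) = dysonInv (segConn A z) s :=
  wilson_eq_dysonInv hA z.2 (z.1 - z.2) s

lemma wilson_segPath_trans (hA : ∀ μ, SmoothMat (A μ)) (z : R4 × R4) (s : ℝ) :
    wilson A z.1 z.2 * wilson A z.2 (segPath z s) = wilson A z.1 (segPath z s) := by
  have := wilson_mul_wilson_of_collinear hA z.2 (z.1 - z.2) s 1
  rwa [one_smul, add_sub_cancel] at this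

lemma segPath_zero (z : R4 × R4) : segPath z 0 = z.2 := by simp [segPath]

lemma segPath_one (z : R4 × R4) : segPath z 1 = z.1 := by simp [segPath]

attribute [local irreducible] wilson dyson dysonInv segConn segPath

/-- Duhamel's formula: integrate over [0, 1] the derivative of the product of the outer part of the
path of z with the inner part of the path of z'. The end values are the two Wilson lines. -/
lemma wilson_duhamel (hA : ∀ μ, SmoothMat (A μ)) (z z' : R4 × R4) (i j : g) :
    wilson A z'.1 z'.2 i j - wilson A z.1 z.2 i j =
      ∑ k, ∑ l, ∫ s in Set.Icc (0 : ℝ) 1, wilson A z.1 (segPath z s) i k *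
        (segConn A z' s k l - segConn A z s k l) * wilson A (segPath z' s) z'.2 l j := by
  have hc : ∀ z : R4 × R4, ∀ i j, Continuous fun t => segConn A z t i j := fun z i j =>
    (matContDiff_segConn hA i j).continuous.comp (f := fun t : ℝ => (z, t)) (by fun_prop)
  have hP := wilson_segPath_left hA
  have hR := wilson_segPath_right hA
  have h1 := segPath_one
  have hL : ∀ s, wilson A z.1 (segPath z s) =
      dyson (segConn A z) 1 * dysonInv (segConn A z) s := fun s => by
    rw [← hP, ← hR, h1, wilson_segPath_trans hA]
  have hd : ∀ s, MatHasDerivAt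
      (fun s => wilson A z.1 (segPath z s) * wilson A (segPath z' s) z'.2)
      (wilson A z.1 (segPath z s) * (segConn A z' s - segConn A z s) *
        wilson A (segPath z' s) z'.2) s := fun s => by
    simp only [hL, hP]
    have := ((matHasDerivAt_const (dyson (segConn A z) 1) s).mul
      (dysonInv_hasDerivAt (hc z) s)).mul (dyson_hasDerivAt (hc z') s)
    convert this using 1
    noncomm_ring
  have hcont : ∀ k l, Continuous fun s => wilson A z.1 (segPath z s) i k *
        (segConn A z' s k l - segConn A z s k l) * wilson A (segPath z' s) z'.2 l j := fun k l => by
    have hs : ∀ z : R4 × R4, Continuous (segPath z) := fun z =>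
      continuous_segPath_comp continuous_const continuous_id
    exact ((continuous_wilson_comp hA continuous_const (hs z) i k).mul
      ((hc z' k l).sub (hc z k l))).mul
      (continuous_wilson_comp hA (hs z') continuous_const l j)
  have hint := intervalIntegral.integral_eq_sub_of_hasDerivAt (a := 0) (b := 1)
    (fun s _ => hd s i j) (by
      refine Continuous.intervalIntegrable ?_ _ _
      simp only [mul_mul_apply_eq_sum, Matrix.sub_apply]
      exact continuous_finsetSum _ fun k _ => continuous_finsetSum _ fun l _ => hcont k l)
  have h0 := segPath_zero
  simp only [h1, h0, wilson_self, one_mul, mul_one] at hint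
  rw [← hint, intervalIntegral.integral_of_le zero_le_one, ← integral_Icc_eq_integral_Ioc]
  simp only [mul_mul_apply_eq_sum, Matrix.sub_apply]
  rw [integral_finsetSum]
  · refine Finset.sum_congr rfl fun k _ => ?_
    rw [integral_finsetSum]
    exact fun l _ => (hcont k l).integrableOn_Icc
  · exact fun k _ => integrable_finsetSum _ fun l _ =>
      (hcont k l).integrableOn_Icc

/-- In Duhamel's formula the difference of connections vanishes at z' = z, so the Wilson factor
depending on z' need only be continuous. No differentiability of the Wilson line is presupposed. -/
lemma hasFDerivAt_wilson (hA : ∀ μ, SmoothMat (A μ)) (z : R4 × R4) (i j : g) :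
    HasFDerivAt (fun z : R4 × R4 => wilson A z.1 z.2 i j)
      (∑ k, ∑ l, ∫ s in Set.Icc (0 : ℝ) 1,
        (wilson A z.1 (segPath z s) i k * wilson A (segPath z s) z.2 l j) •
        (fderiv ℝ (fun p : (R4 × R4) × ℝ => segConn A p.1 p.2 k l) (z, s)).comp
          (ContinuousLinearMap.inl ℝ (R4 × R4) ℝ)) z := by
  have e : (fun z' : R4 × R4 => wilson A z'.1 z'.2 i j) = fun z' => wilson A z.1 z.2 i j +
      ∑ k, ∑ l, ∫ s in Set.Icc (0 : ℝ) 1, wilson A z.1 (segPath z s) i k *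
        (segConn A z' s k l - segConn A z s k l) * wilson A (segPath z' s) z'.2 l j := by
    funext z'
    rw [← wilson_duhamel hA z z' i j]; ring
  rw [e]
  refine HasFDerivAt.const_add _ (HasFDerivAt.fun_sum fun k _ => HasFDerivAt.fun_sum fun l _ => ?_)
  have hf := (matContDiff_segConn hA k l).of_le (m := 1) (by simp)
  have hz : ContDiff ℝ 1 fun p : (R4 × R4) × ℝ => segConn A z p.2 k l :=
    hf.comp (f := fun p : (R4 × R4) × ℝ => (z, p.2)) (by fun_prop)
  have := hasFDerivAt_setIntegral_mul_of_zero (μ := volume) (S := Set.Icc (0 : ℝ) 1) isCompact_Icc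
    (L := fun s => wilson A z.1 (segPath z s) i k)
    (h := fun p : (R4 × R4) × ℝ => segConn A p.1 p.2 k l - segConn A z p.2 k l)
    (R := fun p : (R4 × R4) × ℝ => wilson A (segPath p.1 p.2) p.1.2 l j)
    (continuous_wilson_comp hA continuous_const
      (continuous_segPath_comp continuous_const continuous_id) i k)
    (hf.sub hz)
    (continuous_wilson_comp hA (contDiff_segPath (k := 0)).continuous
      (by fun_prop) l j) z (by simp)
  refine this.congr_fderiv (integral_congr_ae (Filter.Eventually.of_forall fun s => ?_))
  refine ContinuousLinearMap.ext fun v => ?_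
  have h2 : fderiv ℝ (fun p : (R4 × R4) × ℝ => segConn A z p.2 k l) (z, s) (v, 0) = 0 := by
    have hd : DifferentiableAt ℝ (fun s : ℝ => segConn A z s k l) s :=
      ((hf.comp (f := fun s : ℝ => (z, s)) (by fun_prop)).differentiable one_ne_zero) s
    have h3 : HasFDerivAt (fun p : (R4 × R4) × ℝ => segConn A z p.2 k l)
        ((fderiv ℝ (fun s : ℝ => segConn A z s k l) s).comp
          (ContinuousLinearMap.snd ℝ (R4 × R4) ℝ)) (z, s) :=
      HasFDerivAt.comp (g := fun s : ℝ => segConn A z s k l) (z, s) hd.hasFDerivAt hasFDerivAt_snd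
    rw [h3.fderiv]; simp
  have h4 := fderiv_fun_sub (hf.differentiable one_ne_zero (z, s))
    (hz.differentiable one_ne_zero (z, s))
  simp [h4, h2]

lemma fderiv_wilson_apply (hA : ∀ μ, SmoothMat (A μ)) (z v : R4 × R4) (i j : g) :
    fderiv ℝ (fun z : R4 × R4 => wilson A z.1 z.2 i j) z v =
      ∑ k, ∑ l, ∫ s in Set.Icc (0 : ℝ) 1,
        wilson A z.1 (segPath z s) i k * wilson A (segPath z s) z.2 l j *
        fderiv ℝ (fun p : (R4 × R4) × ℝ => segConn A p.1 p.2 k l) (z, s) (v, 0) := by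
  rw [(hasFDerivAt_wilson hA z i j).fderiv]
  simp only [_root_.sum_apply]
  refine Finset.sum_congr rfl fun k _ => Finset.sum_congr rfl fun l _ => ?_
  rw [ContinuousLinearMap.integral_apply]
  · simp
  · have hf := (matContDiff_segConn hA k l).of_le (m := 1) (by simp)
    refine ContinuousOn.integrableOn_compact isCompact_Icc (Continuous.continuousOn ?_)
    have hseg : Continuous (segPath z) := continuous_segPath_comp continuous_const continuous_id
    refine ((continuous_wilson_comp hA continuous_const hseg i k).mul
      (continuous_wilson_comp hA hseg continuous_const l j)).smul ?_
    exact ((hf.continuous_fderiv one_ne_zero).comp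
        (f := fun s : ℝ => (z, s)) (by fun_prop)).clm_comp continuous_const

/-- Bootstrap: the derivative is an integral of Wilson lines and derivatives of the smooth
connection only, so n orders of smoothness yield n + 1. -/
lemma contDiff_wilson_nat (hA : ∀ μ, SmoothMat (A μ)) (n : ℕ) : ∀ i j : g,
    ContDiff ℝ n fun z : R4 × R4 => wilson A z.1 z.2 i j := by
  induction n with
  | zero =>
    intro i j
    simpa using continuous_wilson hA i j
  | succ n ih =>
    intro i j
    push_cast
    refine contDiff_succ_iff_fderiv_apply.2
      ⟨fun z => (hasFDerivAt_wilson hA z i j).differentiableAt, by simp, fun v => ?_⟩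
    simp only [fderiv_wilson_apply hA]
    refine ContDiff.sum fun k _ => ContDiff.sum fun l _ => ?_
    refine contDiff_setIntegral (μ := volume) isCompact_Icc n
      (F := fun p : (R4 × R4) × ℝ => wilson A p.1.1 (segPath p.1 p.2) i k *
        wilson A (segPath p.1 p.2) p.1.2 l j *
        fderiv ℝ (fun p : (R4 × R4) × ℝ => segConn A p.1 p.2 k l) p (v, 0)) ?_
    refine ContDiff.mul (ContDiff.mul ?_ ?_) ?_
    · exact (ih i k).comp (f := fun p : (R4 × R4) × ℝ => (p.1.1, segPath p.1 p.2))
        (ContDiff.prodMk (by fun_prop) contDiff_segPath)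
    · exact (ih l j).comp (f := fun p : (R4 × R4) × ℝ => (segPath p.1 p.2, p.1.2))
        (ContDiff.prodMk contDiff_segPath (by fun_prop))
    · exact ((matContDiff_segConn hA k l).fderiv_right (m := n)
        (by exact_mod_cast le_top)).clm_apply contDiff_const

lemma matContDiff_wilson {E : Type*} [NormedAddCommGroup E] [NormedSpace ℝ E]
    (hA : ∀ μ, SmoothMat (A μ)) {w x : E → R4} (hw : ContDiff ℝ ∞ w) (hx : ContDiff ℝ ∞ x) :
    MatContDiff ∞ fun z => wilson A (w z) (x z) := fun i j =>
  (contDiff_infty.2 fun n => contDiff_wilson_nat hA n i j).comp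
    (f := fun z => (w z, x z)) (hw.prodMk hx)

end WilsonSmooth

/-! ### Derivatives along straight lines and parallel transport. -/

section Directional

variable {m n : Type*}

lemma sum_smul_unitVec (v : R4) : ∑ μ, v μ • unitVec μ = v := by
  ext i
  simp [unitVec, Finset.sum_apply, Pi.single_apply]

lemma sum_partialMat_apply (F : R4 → Matrix m n ℂ) (v x : R4) (i : m) (j : n) :
    (∑ μ, ((v μ : ℝ) : ℂ) • partialMat μ F x) i j = fderiv ℝ (fun z => F z i j) x v := by
  conv_rhs => rw [← sum_smul_unitVec v]
  simp only [Matrix.sum_apply, Matrix.smul_apply, partialMat, Matrix.of_apply, map_sum, map_smul,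
    Complex.real_smul, smul_eq_mul]

lemma hasDerivAt_comp_line {f : R4 → ℂ} (hf : ContDiff ℝ ∞ f) (x v : R4) (t : ℝ) :
    HasDerivAt (fun t : ℝ => f (x + t • v)) (fderiv ℝ f (x + t • v) v) t := by
  have h1 : HasFDerivAt f (fderiv ℝ f (x + t • v)) (x + t • v) :=
    (hf.differentiable (by simp) _).hasFDerivAt
  have h2 : HasDerivAt (fun t : ℝ => x + t • v) v t := by
    simpa using ((hasDerivAt_id t).smul_const v).const_add x
  exact h1.comp_hasDerivAt t h2

lemma matHasDerivAt_line {F : R4 → Matrix m n ℂ} (hF : SmoothMat F) (x v : R4) (t : ℝ) :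
    MatHasDerivAt (fun t : ℝ => F (x + t • v))
      (∑ μ, ((v μ : ℝ) : ℂ) • partialMat μ F (x + t • v)) t := fun i j => by
  rw [sum_partialMat_apply]
  exact hasDerivAt_comp_line (hF i j) x v t

lemma smoothMat_partialMat {F : R4 → Matrix m n ℂ} (hF : SmoothMat F) (μ : Fin 4) :
    SmoothMat (partialMat μ F) := fun i j =>
  ((hF i j).fderiv_right (m := ∞) (by simp)).clm_apply contDiff_const

end Directional

section Transport

variable {g : Type*} [Fintype g] [DecidableEq g] {A : Fin 4 → R4 → Matrix g g ℂ}
  {α : R4 → Matrix g g ℂ}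

lemma covDir_eq (b x : R4) : covDir A b α x =
    ∑ μ, ((b μ : ℝ) : ℂ) • partialMat μ α x - (conn A b x * α x - α x * conn A b x) := by
  simp only [covDir, covD, conn, smul_sub, Finset.sum_sub_distrib, Matrix.smul_mul,
    Matrix.mul_smul, Matrix.sum_mul, Matrix.mul_sum, Finset.smul_sum, smul_comm Complex.I]

lemma smoothMat_covD (hA : ∀ μ, SmoothMat (A μ)) (hα : SmoothMat α) (μ : Fin 4) :
    SmoothMat (covD A μ α) :=
  MatContDiff.sub (smoothMat_partialMat hα μ) (MatContDiff.const_smul _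
    (MatContDiff.sub (MatContDiff.mul (hA μ) hα) (MatContDiff.mul hα (hA μ))))

lemma smoothMat_covDir (hA : ∀ μ, SmoothMat (A μ)) (hα : SmoothMat α) (b : R4) :
    SmoothMat (covDir A b α) :=
  MatContDiff.sum fun μ _ => MatContDiff.const_smul _ (smoothMat_covD hA hα μ)

lemma smoothMat_covDir_iterate (hA : ∀ μ, SmoothMat (A μ)) (hα : SmoothMat α) (b : R4) (n : ℕ) :
    SmoothMat ((covDir A b)^[n] α) := by
  induction n with
  | zero => exact hα
  | succ n ih => rw [Function.iterate_succ_apply']; exact smoothMat_covDir hA ih b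

/-- The value of `α` at `x + v`, parallel transported to `x` along the straight path. -/
def transport (A : Fin 4 → R4 → Matrix g g ℂ) (α : R4 → Matrix g g ℂ) (x v : R4) :
    Matrix g g ℂ :=
  wilson A x (x + v) * α (x + v) * wilson A (x + v) x

lemma transport_zero (x : R4) : transport A α x 0 = α x := by
  simp [transport, wilson_self]

lemma matContDiff_transport {E : Type*} [NormedAddCommGroup E] [NormedSpace ℝ E]
    (hA : ∀ μ, SmoothMat (A μ)) (hα : SmoothMat α) {x v : E → R4} (hx : ContDiff ℝ ∞ x)
    (hv : ContDiff ℝ ∞ v) : MatContDiff ∞ fun z => transport A α (x z) (v z) :=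
  ((matContDiff_wilson hA hx (hx.add hv)).mul (MatContDiff.comp hα (hx.add hv))).mul
    (matContDiff_wilson hA (hx.add hv) hx)

/-- The connection terms produced by the two Wilson lines combine into the commutator that turns the
ordinary derivative of α into the covariant one. Iterated, this identifies the Taylor coefficients
of the transported α with (b·𝒟)^n α. -/
lemma transport_hasDerivAt (hA : ∀ μ, SmoothMat (A μ)) (hα : SmoothMat α) (x b : R4) (t : ℝ) :
    MatHasDerivAt (fun t : ℝ => transport A α x (t • b))
      (transport A (covDir A b α) x (t • b)) t := by
  have h := ((wilson_hasDerivAt_right hA x b t).mul (matHasDerivAt_line hα x b t)).mul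
    (wilson_hasDerivAt_left hA x b t)
  have e : ∀ W W' C D a : Matrix g g ℂ, (-(W * C) * a + W * D) * W' + W * a * (C * W') =
      W * (D - (C * a - a * C)) * W' := fun W W' C D a => by noncomm_ring
  rw [e, ← covDir_eq] at h
  exact h

lemma iteratedDeriv_transport (hA : ∀ μ, SmoothMat (A μ)) (b x : R4) (i j : g) (n : ℕ) :
    ∀ {α : R4 → Matrix g g ℂ}, SmoothMat α → ∀ t : ℝ,
      iteratedDeriv n (fun t : ℝ => transport A α x (t • b) i j) t =
        transport A ((covDir A b)^[n] α) x (t • b) i j := by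
  induction n with
  | zero => intro α _ t; simp
  | succ n ih =>
    intro α hα t
    rw [iteratedDeriv_succ', Function.iterate_succ_apply, ← ih (smoothMat_covDir hA hα b) t]
    congr 1
    funext t
    exact (transport_hasDerivAt hA hα x b t i j).deriv

end Transport

/-! ### Polarization: sums over permutations as combinations of powers. -/

section Polarization

variable {R : Type*} [Ring R]

lemma sum_pow_eq_sum_prod {N : ℕ} (ℓ : Fin N → R) (S : Finset (Fin N)) (k : ℕ) :
    (∑ i ∈ S, ℓ i) ^ k =
      ∑ f : Fin k → Fin N, if (∀ j, f j ∈ S) then (List.ofFn fun j => ℓ (f j)).prod else 0 := by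
  have := (MultilinearMap.mkPiAlgebraFin ℤ k R).map_sum_finset (fun _ i => ℓ i) (fun _ => S)
  simp only [MultilinearMap.mkPiAlgebraFin_apply] at this
  rw [← Finset.sum_filter]
  rw [List.ofFn_const, List.prod_replicate] at this
  rw [this]
  refine Finset.sum_congr ?_ fun _ _ => rfl
  ext f
  simp [Fintype.mem_piFinset]

/-- Passing to complements makes this the alternating sum over the subsets of the complement of T.
-/
lemma sum_neg_one_pow_filter_subset {N : ℕ} (T : Finset (Fin N)) :
    ∑ S : Finset (Fin N), (if T ⊆ S then (-1 : ℤ) ^ (N - S.card) else 0) =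
      if T = Finset.univ then 1 else 0 := by
  have h1 : ∑ S : Finset (Fin N), (if T ⊆ S then (-1 : ℤ) ^ (N - S.card) else 0) =
      ∑ S : Finset (Fin N), (if S ⊆ Tᶜ then (-1 : ℤ) ^ S.card else 0) := by
    refine Fintype.sum_equiv (compl_involutive (α := Finset (Fin N))).toPerm _ _ fun S => ?_
    simp [Function.Involutive.toPerm, Finset.card_compl]
  rw [h1, ← Finset.sum_filter]
  have h2 : (Finset.univ.filter fun S : Finset (Fin N) => S ⊆ Tᶜ) = (Tᶜ).powerset := by
    ext; simp
  rw [h2, Finset.sum_powerset_neg_one_pow_card]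
  simp

/-- The polarization identity in a noncommutative ring. -/
lemma sum_perm_prod_eq {N : ℕ} (ℓ : Fin N → R) :
    ∑ σ : Equiv.Perm (Fin N), (List.ofFn fun k => ℓ (σ k)).prod =
      ∑ S : Finset (Fin N), ((-1 : ℤ) ^ (N - S.card)) • (∑ i ∈ S, ℓ i) ^ N := by
  simp only [sum_pow_eq_sum_prod, Finset.smul_sum]
  rw [Finset.sum_comm]
  -- The word f occurs in the power belonging to S exactly when S contains its image. By
  -- inclusion-exclusion its total coefficient vanishes unless f is onto, hence a permutation.
  have key : ∀ f : Fin N → Fin N, ∑ S : Finset (Fin N), ((-1 : ℤ) ^ (N - S.card)) •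
      (if (∀ j, f j ∈ S) then (List.ofFn fun j => ℓ (f j)).prod else 0) =
      if Function.Bijective f then (List.ofFn fun j => ℓ (f j)).prod else 0 := fun f => by
    have h := sum_neg_one_pow_filter_subset (Finset.univ.image f)
    have e : ∀ S : Finset (Fin N), ((-1 : ℤ) ^ (N - S.card)) •
        (if (∀ j, f j ∈ S) then (List.ofFn fun j => ℓ (f j)).prod else 0) =
        (if Finset.univ.image f ⊆ S then (-1 : ℤ) ^ (N - S.card) else 0) •
          (List.ofFn fun j => ℓ (f j)).prod := fun S => by
      simp only [Finset.image_subset_iff, Finset.mem_univ, true_implies]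
      split_ifs <;> simp
    have hb : Finset.univ.image f = Finset.univ ↔ Function.Bijective f := by
      rw [← Finite.surjective_iff_bijective, Finset.eq_univ_iff_forall]
      simp [Function.Surjective]
    simp only [e, ← Finset.sum_smul, h, hb]
    split_ifs <;> simp
  simp only [key]
  rw [← Finset.sum_filter]
  refine Finset.sum_bij (fun σ _ => (σ : Fin N → Fin N)) ?_ ?_ ?_ ?_
  · intro σ _; exact Finset.mem_filter.2 ⟨Finset.mem_univ _, σ.bijective⟩
  · intro σ _ τ _ h; exact Equiv.ext fun k => congrFun h k
  · intro f hf
    exact ⟨Equiv.ofBijective f (Finset.mem_filter.1 hf).2, Finset.mem_univ _, rfl⟩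
  · intro σ _; rfl

end Polarization

/-! ### The operators a·x + b·D in the ring of endomorphisms of smooth functions, and their flows.
-/

section LineOperators

variable {s g n : Type*} [Fintype s] [DecidableEq s] [Fintype g] [DecidableEq g]
  {A : Fin 4 → R4 → Matrix g g ℂ}

/-- The space of smooth matrix-valued functions. -/
def smoothMats (m n : Type*) : Submodule ℂ (R4 → Matrix m n ℂ) where
  carrier := {F | SmoothMat F}
  add_mem' hF hG := MatContDiff.add hF hG
  zero_mem' := fun _ _ => contDiff_const
  smul_mem' c _ hF := MatContDiff.const_smul c hF

lemma partialMat_add {F G : R4 → Matrix s n ℂ} (hF : SmoothMat F) (hG : SmoothMat G) (μ : Fin 4) :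
    partialMat μ (F + G) = partialMat μ F + partialMat μ G := by
  funext x; ext i j
  have := fderiv_fun_add ((hF i j).differentiable (by simp) x) ((hG i j).differentiable (by simp) x)
  exact congrArg (fun L => L (unitVec μ)) this

lemma partialMat_smul {F : R4 → Matrix s n ℂ} (hF : SmoothMat F) (c : ℂ) (μ : Fin 4) :
    partialMat μ (c • F) = c • partialMat μ F := by
  funext x; ext i j
  have := fderiv_const_mul ((hF i j).differentiable (by simp) x) c
  exact congrArg (fun L => L (unitVec μ)) this

lemma matContDiff_one_kronecker {E : Type*} [NormedAddCommGroup E] [NormedSpace ℝ E]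
    {k : WithTop ℕ∞} {F : E → Matrix g g ℂ} (hF : MatContDiff k F) :
    MatContDiff k fun z => (1 : Matrix s s ℂ) ⊗ₖ F z :=
  (matContDiff_const 1).kronecker hF

lemma contDiff_coord (ν : Fin 4) : ContDiff ℝ ∞ fun x : R4 => ((x ν : ℝ) : ℂ) :=
  Complex.ofRealCLM.contDiff.comp (contDiff_euclidean.1 contDiff_id ν)

/-- The operator of one letter, acting on all columns of smooth matrix-valued functions. -/
def letterEnd (hA : ∀ μ, SmoothMat (A μ)) :
    Fin 4 ⊕ Fin 4 → Module.End ℂ (smoothMats (s × g) n)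
  | Sum.inl ν =>
    { toFun := fun F => ⟨fun x => ((x ν : ℝ) : ℂ) • F.1 x,
        MatContDiff.smul (contDiff_coord ν) F.2⟩
      map_add' := fun F G => Subtype.ext (funext fun x => smul_add _ _ _)
      map_smul' := fun c F => Subtype.ext (funext fun x => by
        change ((x ν : ℝ) : ℂ) • (c • F.1 x) = c • (((x ν : ℝ) : ℂ) • F.1 x)
        rw [smul_comm]) }
  | Sum.inr μ =>
    { toFun := fun F => ⟨fun x => partialMat μ F.1 x -
          Complex.I • (((1 : Matrix s s ℂ) ⊗ₖ A μ x) * F.1 x),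
        MatContDiff.sub (smoothMat_partialMat F.2 μ) (MatContDiff.const_smul _
          (MatContDiff.mul (matContDiff_one_kronecker (hA μ)) F.2))⟩
      map_add' := fun F G => Subtype.ext (funext fun x => by
        change partialMat μ (F.1 + G.1) x - _ • (_ * (F.1 x + G.1 x)) = (_ - _) + (_ - _)
        rw [partialMat_add F.2 G.2, Pi.add_apply, Matrix.mul_add, smul_add]; abel)
      map_smul' := fun c F => Subtype.ext (funext fun x => by
        change partialMat μ (c • F.1) x - _ • (_ * (c • F.1 x)) = c • (_ - _)
        rw [partialMat_smul F.2, Pi.smul_apply, Matrix.mul_smul, smul_sub, smul_comm c]) }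

lemma letterOp_column (hA : ∀ μ, SmoothMat (A μ)) (l : Fin 4 ⊕ Fin 4)
    (F : smoothMats (s × g) n) (j : n) :
    letterOp A l (fun z k => F.1 z k j) = fun z k => (letterEnd hA l F).1 z k j := by
  cases l with
  | inl ν => rfl
  | inr μ =>
    funext x k
    have h : fderiv ℝ (fun (z : R4) k => F.1 z k j) x (unitVec μ) k =
        fderiv ℝ (fun z : R4 => F.1 z k j) x (unitVec μ) := by
      rw [fderiv_pi fun k => (F.2 k j).differentiable (by simp) x]; rfl
    change fderiv ℝ (fun (z : R4) k => F.1 z k j) x (unitVec μ) k - _ = _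
    rw [h]
    rfl

lemma foldr_letterOp_column (hA : ∀ μ, SmoothMat (A μ)) (w : List (Fin 4 ⊕ Fin 4))
    (F : smoothMats (s × g) n) (j : n) :
    w.foldr (letterOp A) (fun z k => F.1 z k j) =
      fun z k => ((w.map (letterEnd hA)).prod F).1 z k j := by
  induction w with
  | nil => rfl
  | cons l w ih =>
    rw [List.foldr_cons, ih, letterOp_column hA]
    rfl

/-- The operator `a · x + b · D` on smooth matrix-valued functions. -/
def lineEnd (hA : ∀ μ, SmoothMat (A μ)) (a b : R4) : Module.End ℂ (smoothMats (s × g) n) :=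
  ∑ ν, ((a ν : ℝ) : ℂ) • letterEnd hA (Sum.inl ν) + ∑ μ, ((b μ : ℝ) : ℂ) • letterEnd hA (Sum.inr μ)

/-- The symbol `a · x + i b · p` of `a · x + b · D`. -/
def lineSymbol (a b x p : R4) : ℂ :=
  ((inner ℝ a x : ℝ) : ℂ) + Complex.I * ((inner ℝ p b : ℝ) : ℂ)

/-- The multiplication part of a letter. -/
def letterX : Fin 4 ⊕ Fin 4 → R4 := Sum.elim unitVec 0

/-- The derivative part of a letter. -/
def letterD : Fin 4 ⊕ Fin 4 → R4 := Sum.elim 0 unitVec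

lemma unitVec_apply (μ ν : Fin 4) : (unitVec μ) ν = if ν = μ then 1 else 0 := by
  simp [unitVec]

lemma inner_unitVec (μ : Fin 4) (x : R4) : (inner ℝ x (unitVec μ) : ℝ) = x μ := by
  simp [unitVec, EuclideanSpace.inner_single_right]

lemma letterEnd_eq_lineEnd (hA : ∀ μ, SmoothMat (A μ)) (l : Fin 4 ⊕ Fin 4) :
    (letterEnd hA l : Module.End ℂ (smoothMats (s × g) n)) =
      lineEnd hA (letterX l) (letterD l) := by
  cases l <;> simp [lineEnd, letterX, letterD, unitVec_apply, ite_smul, apply_ite Complex.ofReal]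

lemma letterSymbol_eq_lineSymbol (l : Fin 4 ⊕ Fin 4) (x p : R4) :
    letterSymbol x p l = lineSymbol (letterX l) (letterD l) x p := by
  cases l with
  | inl ν => simp [lineSymbol, letterX, letterD, letterSymbol, real_inner_comm x, inner_unitVec]
  | inr μ => simp [lineSymbol, letterX, letterD, letterSymbol, inner_unitVec]

lemma sum_lineEnd (hA : ∀ μ, SmoothMat (A μ)) {ι : Type*} (S : Finset ι) (a b : ι → R4) :
    ∑ i ∈ S, (lineEnd hA (a i) (b i) : Module.End ℂ (smoothMats (s × g) n)) =
      lineEnd hA (∑ i ∈ S, a i) (∑ i ∈ S, b i) := by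
  simp only [lineEnd, Finset.sum_add_distrib]
  congr 1 <;>
  · rw [Finset.sum_comm]
    simp [← Finset.sum_smul]

lemma sum_lineSymbol {ι : Type*} (S : Finset ι) (a b : ι → R4) (x p : R4) :
    ∑ i ∈ S, lineSymbol (a i) (b i) x p = lineSymbol (∑ i ∈ S, a i) (∑ i ∈ S, b i) x p := by
  simp only [lineSymbol, Finset.sum_add_distrib, sum_inner, inner_sum, ← Finset.mul_sum,
    Complex.ofReal_sum]

lemma lineEnd_apply (hA : ∀ μ, SmoothMat (A μ)) (a b : R4) (F : smoothMats (s × g) n) (x : R4) :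
    (lineEnd hA a b F).1 x = ((inner ℝ a x : ℝ) : ℂ) • F.1 x +
      (∑ μ, ((b μ : ℝ) : ℂ) • partialMat μ F.1 x - ((1 : Matrix s s ℂ) ⊗ₖ conn A b x) * F.1 x) := by
  have h1 : (lineEnd hA a b F).1 x =
      ∑ ν, ((a ν : ℝ) : ℂ) • ((x ν : ℝ) : ℂ) • F.1 x + ∑ μ, ((b μ : ℝ) : ℂ) • (partialMat μ F.1 x -
          Complex.I • (((1 : Matrix s s ℂ) ⊗ₖ A μ x) * F.1 x)) := by
    simp only [lineEnd, LinearMap.add_apply, LinearMap.sum_apply, LinearMap.smul_apply,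
      Submodule.coe_add, Submodule.coe_sum, Submodule.coe_smul, Pi.add_apply, Finset.sum_apply,
      Pi.smul_apply]
    rfl
  have h2 : (inner ℝ a x : ℝ) = ∑ ν, a ν * x ν := by
    simp [PiLp.inner_apply, mul_comm]
  have h3 : (1 : Matrix s s ℂ) ⊗ₖ conn A b x =
      ∑ μ, (b μ : ℂ) • Complex.I • ((1 : Matrix s s ℂ) ⊗ₖ A μ x) := by
    ext i j
    simp only [conn, Matrix.kroneckerMap_apply, Matrix.smul_apply, Matrix.sum_apply, smul_eq_mul,
      Finset.mul_sum]
    exact Finset.sum_congr rfl fun μ _ => by ring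
  rw [h1, h2, h3]
  simp only [smul_sub, Finset.sum_sub_distrib, Matrix.sum_mul, Matrix.smul_mul, smul_smul,
    ← Finset.sum_smul, Complex.ofReal_sum, Complex.ofReal_mul]

/-- The flow of `a · x + b · D`. -/
def lineFlow (A : Fin 4 → R4 → Matrix g g ℂ) (a b : R4) (F : R4 → Matrix (s × g) n ℂ) (x : R4)
    (t : ℝ) : Matrix (s × g) n ℂ :=
  -- The exponent is the integral of a·(x + s b) over s from 0 to t.
  Complex.exp (((t * inner ℝ a x + t ^ 2 / 2 * inner ℝ a b : ℝ)) : ℂ) •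
    (((1 : Matrix s s ℂ) ⊗ₖ wilson A x (x + t • b)) * F (x + t • b))

lemma lineFlow_zero (a b : R4) (F : R4 → Matrix (s × g) n ℂ) (x : R4) :
    lineFlow A a b F x 0 = F x := by
  simp [lineFlow, wilson_self]

lemma lineFlow_hasDerivAt (hA : ∀ μ, SmoothMat (A μ)) (a b : R4) (F : smoothMats (s × g) n)
    (x : R4) (t : ℝ) : MatHasDerivAt (lineFlow A a b F.1 x)
      (lineFlow A a b (lineEnd hA a b F).1 x t) t := by
  have hW : MatHasDerivAt (fun t : ℝ => (1 : Matrix s s ℂ) ⊗ₖ wilson A x (x + t • b))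
      ((1 : Matrix s s ℂ) ⊗ₖ (-(wilson A x (x + t • b) * conn A b (x + t • b)))) t :=
    fun i j => (wilson_hasDerivAt_right hA x b t i.2 j.2).const_mul _
  have h1 := hW.mul (matHasDerivAt_line F.2 x b t)
  have he : HasDerivAt (fun t : ℝ =>
      Complex.exp (((t * inner ℝ a x + t ^ 2 / 2 * inner ℝ a b : ℝ)) : ℂ))
      (Complex.exp (((t * inner ℝ a x + t ^ 2 / 2 * inner ℝ a b : ℝ)) : ℂ) *
        ((inner ℝ a (x + t • b) : ℝ) : ℂ)) t := by
    refine HasDerivAt.cexp (HasDerivAt.ofReal_comp ?_)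
    have := ((hasDerivAt_id t).mul_const (inner ℝ a x : ℝ)).add
      (((hasDerivAt_pow 2 t).div_const 2).mul_const (inner ℝ a b : ℝ))
    refine this.congr_deriv ?_
    rw [inner_add_right, inner_smul_right]; simp
  intro i j
  have h2 := he.mul (h1 i j)
  have e : ∀ (c d : ℂ) (W C : Matrix g g ℂ) (H D : Matrix (s × g) n ℂ),
      c • (((1 : Matrix s s ℂ) ⊗ₖ W) * (d • H + (D - ((1 : Matrix s s ℂ) ⊗ₖ C) * H))) =
      (c * d) • (((1 : Matrix s s ℂ) ⊗ₖ W) * H) +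
        c • (((1 : Matrix s s ℂ) ⊗ₖ (-(W * C))) * H + ((1 : Matrix s s ℂ) ⊗ₖ W) * D) := by
    intro c d W C H D
    have : (1 : Matrix s s ℂ) ⊗ₖ (-(W * C)) =
        -(((1 : Matrix s s ℂ) ⊗ₖ W) * ((1 : Matrix s s ℂ) ⊗ₖ C)) := by
      rw [← Matrix.mul_kronecker_mul, Matrix.one_mul]
      ext; simp
    rw [this, Matrix.mul_add, Matrix.mul_sub, Matrix.mul_smul, ← Matrix.mul_assoc, Matrix.neg_mul,
      smul_add, smul_smul]
    congr 2
    abel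
  unfold lineFlow
  rw [lineEnd_apply, e]
  exact h2

end LineOperators

/-! ### The operator Q and its symbol as combinations of powers with the same coefficients. -/

section Decomposition

variable {s g n : Type*} [Fintype s] [DecidableEq s] [Fintype g] [DecidableEq g]
  {A : Fin 4 → R4 → Matrix g g ℂ}

/-- A symmetrically ordered polynomial is a linear combination of powers of operators
`a · x + b · D`. -/
lemma SymPoly.exists_line_decomposition (Q : SymPoly s) (hA : ∀ μ, SmoothMat (A μ)) :
    ∃ (ι : Type) (_ : Fintype ι) (M : ι → Matrix s s ℂ) (N : ι → ℕ) (a b : ι → R4),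
      (∀ (F : smoothMats (s × g) n) (j : n) (x : R4) (i : s × g),
        Q.op A (fun z k => F.1 z k j) x i = (∑ q, (M q ⊗ₖ (1 : Matrix g g ℂ)) *
          (((lineEnd hA (a q) (b q)) ^ N q) F).1 x) i j) ∧
      ∀ x p, Q.symbol x p = ∑ q, lineSymbol (a q) (b q) x p ^ N q • M q := by
  classical
  -- An index consists of the two degrees, the indices of the letters and the subset of letters that
  -- polarization sums.
  let ι : Type := Σ (k : Fin (Q.degX + 1)), Σ (l : Fin (Q.degD + 1)), Σ (_ : Fin k → Fin 4),
    Σ (_ : Fin l → Fin 4), Finset (Fin (k + l))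
  let letters : (q : ι) → Fin (q.1 + q.2.1) → Fin 4 ⊕ Fin 4 := fun q =>
    Fin.append (fun i => Sum.inl (q.2.2.1 i)) (fun i => Sum.inr (q.2.2.2.1 i))
  refine ⟨ι, inferInstance,
    fun q => (((-1 : ℤ) ^ ((q.1 : ℕ) + q.2.1 - q.2.2.2.2.card) : ℤ) : ℂ) •
      Q.coeff q.1 q.2.1 q.2.2.1 q.2.2.2.1,
    fun q => q.1 + q.2.1, fun q => ∑ i ∈ q.2.2.2.2, letterX (letters q i),
    fun q => ∑ i ∈ q.2.2.2.2, letterD (letters q i), ?_, ?_⟩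
  · intro F j x i
    have hsum : ∀ (k l : ℕ) (ν : Fin k → Fin 4) (μ : Fin l → Fin 4),
        (∑ σ : Equiv.Perm (Fin (k + l)),
          ((permWord ν μ σ).foldr (letterOp A) (fun z k => F.1 z k j)) x) =
        fun i => (∑ S : Finset (Fin (k + l)), (((-1 : ℤ) ^ (k + l - S.card) : ℤ) : ℂ) •
          (((lineEnd hA
            (∑ i ∈ S, letterX ((Fin.append (fun i => Sum.inl (ν i)) (fun i => Sum.inr (μ i))) i))
            (∑ i ∈ S, letterD ((Fin.append (fun i => Sum.inl (ν i)) (fun i => Sum.inr (μ i))) i)))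
              ^ (k + l)) F).1 x) i j := by
      intro k l ν μ
      simp only [foldr_letterOp_column hA, permWord, List.map_ofFn, Function.comp_def]
      have hpol := sum_perm_prod_eq (R := Module.End ℂ (smoothMats (s × g) n))
        (fun k' => letterEnd hA ((Fin.append (fun i => Sum.inl (ν i)) (fun i => Sum.inr (μ i))) k'))
      simp only [letterEnd_eq_lineEnd, sum_lineEnd] at hpol
      have h2 := congrArg (fun T : Module.End ℂ (smoothMats (s × g) n) => (T F).1 x) hpol
      simp only [LinearMap.sum_apply, LinearMap.smul_apply, Submodule.coe_sum, Finset.sum_apply,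
        ← Int.cast_smul_eq_zsmul ℂ, Submodule.coe_smul, Pi.smul_apply] at h2
      simp only [letterEnd_eq_lineEnd]
      rw [← h2]
      funext i
      simp only [Finset.sum_apply, Matrix.sum_apply]
    have hcol : ∀ (C : Matrix (s × g) (s × g) ℂ) (D : Matrix (s × g) n ℂ),
        (C *ᵥ fun i => D i j) = fun i => (C * D) i j := fun C D => rfl
    simp only [SymPoly.op, hsum, hcol]
    rw [Fintype.sum_sigma, Finset.sum_range]
    simp only [Fintype.sum_sigma, Finset.sum_range, Finset.sum_apply, Matrix.sum_apply]
    refine Finset.sum_congr rfl fun k _ => Finset.sum_congr rfl fun l _ =>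
      Finset.sum_congr rfl fun ν _ => Finset.sum_congr rfl fun μ _ => ?_
    rw [Matrix.mul_sum, Matrix.sum_apply]
    refine Finset.sum_congr rfl fun S _ => ?_
    rw [Matrix.smul_kronecker, Matrix.smul_mul, Matrix.mul_smul]
  · intro x p
    simp only [SymPoly.symbol]
    rw [Fintype.sum_sigma, Finset.sum_range]
    simp only [Fintype.sum_sigma, Finset.sum_range]
    refine Finset.sum_congr rfl fun k _ => Finset.sum_congr rfl fun l _ =>
      Finset.sum_congr rfl fun ν _ => Finset.sum_congr rfl fun μ _ => ?_
    -- The same polarization, now in the commutative ring ℂ, produces the same matrices and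
    -- exponents as for the operator.
    have hpol := sum_perm_prod_eq (fun k' : Fin (k + l) => letterSymbol x p
      ((Fin.append (fun i => Sum.inl (ν i)) (fun i => Sum.inr (μ i))) k'))
    simp only [letterSymbol_eq_lineSymbol, sum_lineSymbol] at hpol
    simp only [permWord, List.map_ofFn, Function.comp_def, letterSymbol_eq_lineSymbol]
    rw [hpol, Finset.sum_smul]
    refine Finset.sum_congr rfl fun S _ => ?_
    rw [← Int.cast_smul_eq_zsmul ℂ, smul_eq_mul, smul_smul, mul_comm]

end Decomposition

/-! ### Fourier transforms of test functions in the normalization e^{ipy}. -/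

section Fourier

open scoped FourierTransform SchwartzMap

/-- The Fourier transform `∫ e^{ipy} h(y) dy`. -/
def fourierInt (h : R4 → ℂ) (p : R4) : ℂ :=
  ∫ y : R4, Complex.exp (Complex.I * ((inner ℝ p y : ℝ) : ℂ)) * h y

lemma fourierInt_eq_fourierInv (h : R4 → ℂ) (p : R4) :
    fourierInt h p = 𝓕⁻ h ((2 * Real.pi)⁻¹ • p) := by
  rw [Real.fourierInv_eq', fourierInt]
  congr 1
  funext y
  rw [smul_eq_mul, inner_smul_right, ← mul_assoc (2 * Real.pi), mul_inv_cancel₀ (by positivity),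
    one_mul, mul_comm Complex.I, real_inner_comm]

variable {h : R4 → ℂ}

lemma integrable_one_add_norm_pow_mul_schwartz (f : 𝓢(R4, ℂ)) (k : ℕ) :
    Integrable fun x : R4 => (1 + ‖x‖) ^ k * ‖f x‖ := by
  simp only [add_comm (1 : ℝ), add_pow, one_pow, mul_one, Finset.sum_mul]
  refine integrable_finsetSum _ fun i _ => ?_
  refine ((f.integrable_pow_mul volume i).mul_const
    ((k.choose i : ℕ) : ℝ)).congr (Filter.Eventually.of_forall fun x => ?_)
  ring

lemma exists_schwartz_fourierInt (hs : ContDiff ℝ ∞ h) (hc : HasCompactSupport h) :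
    ∃ f : 𝓢(R4, ℂ), ∀ p, fourierInt h p = f ((2 * Real.pi)⁻¹ • p) := by
  refine ⟨𝓕⁻ (hc.toSchwartzMap hs), fun p => ?_⟩
  rw [fourierInt_eq_fourierInv, SchwartzMap.fourierInv_coe]
  rfl

lemma continuous_fourierInt (hs : ContDiff ℝ ∞ h) (hc : HasCompactSupport h) :
    Continuous (fourierInt h) := by
  obtain ⟨f, hf⟩ := exists_schwartz_fourierInt hs hc
  rw [funext hf]
  exact f.continuous.comp (continuous_const_smul _)

lemma integrable_one_add_norm_pow_mul_fourierInt (hs : ContDiff ℝ ∞ h) (hc : HasCompactSupport h)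
    (k : ℕ) : Integrable fun p : R4 => (1 + ‖p‖) ^ k * ‖fourierInt h p‖ := by
  obtain ⟨f, hf⟩ := exists_schwartz_fourierInt hs hc
  have h2π : (2 * Real.pi)⁻¹ ≠ 0 := by positivity
  have h1 := ((integrable_one_add_norm_pow_mul_schwartz f k).comp_smul h2π).const_mul
    ((1 + 2 * Real.pi) ^ k)
  refine h1.mono' ?_ (Filter.Eventually.of_forall fun p => ?_)
  · have := continuous_fourierInt hs hc
    exact Continuous.aestronglyMeasurable (by fun_prop)
  · rw [Real.norm_of_nonneg (by positivity), hf, ← mul_assoc, ← mul_pow]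
    gcongr
    rw [norm_smul, Real.norm_of_nonneg (by positivity)]
    have hpos : 0 < 2 * Real.pi := by positivity
    have : ‖p‖ = 2 * Real.pi * ((2 * Real.pi)⁻¹ * ‖p‖) := by field_simp
    have h3 : 0 ≤ (2 * Real.pi)⁻¹ * ‖p‖ := by positivity
    nlinarith

lemma integrable_mul_fourierInt (hs : ContDiff ℝ ∞ h) (hc : HasCompactSupport h) {D : R4 → ℂ}
    (hD : Continuous D) {C : ℝ} {k : ℕ} (hb : ∀ p, ‖D p‖ ≤ C * (1 + ‖p‖) ^ k) :
    Integrable fun p => D p * fourierInt h p := by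
  refine ((integrable_one_add_norm_pow_mul_fourierInt hs hc k).const_mul C).mono'
    (hD.mul (continuous_fourierInt hs hc)).aestronglyMeasurable
    (Filter.Eventually.of_forall fun p => ?_)
  rw [norm_mul, ← mul_assoc]
  gcongr
  exact hb p

lemma fourierInt_inversion (hs : ContDiff ℝ ∞ h) (hc : HasCompactSupport h) (y : R4) :
    phaseNorm * ∫ p : R4, Complex.exp (-(Complex.I * ((inner ℝ p y : ℝ) : ℂ))) * fourierInt h p =
      h y := by
  have h1 : (𝓕 (𝓕⁻ (hc.toSchwartzMap hs))) y = h y := by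
    rw [FourierTransform.fourier_fourierInv_eq]; rfl
  rw [SchwartzMap.fourier_coe, SchwartzMap.fourierInv_coe, Real.fourier_eq'] at h1
  have h2 : ∀ v : R4, 𝓕⁻ (hc.toSchwartzMap hs : R4 → ℂ) v =
      fourierInt h ((2 * Real.pi) • v) := fun v => by
    rw [fourierInt_eq_fourierInv, smul_smul, inv_mul_cancel₀ (by positivity), one_smul]
    rfl
  have h3 := Measure.integral_comp_smul (volume : Measure R4) (fun p : R4 =>
    Complex.exp (-(Complex.I * ((inner ℝ p y : ℝ) : ℂ))) * fourierInt h p) (2 * Real.pi)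
  rw [← h1]
  simp only [h2]
  have h4 : ∀ v : R4, Complex.exp (((-2 * Real.pi * inner ℝ v y : ℝ) : ℂ) * Complex.I) •
      fourierInt h ((2 * Real.pi) • v) =
      Complex.exp (-(Complex.I * ((inner ℝ ((2 * Real.pi) • v) y : ℝ) : ℂ))) *
        fourierInt h ((2 * Real.pi) • v) := fun v => by
    rw [smul_eq_mul, inner_smul_left]
    congr 2
    simp only [conj_trivial]
    push_cast
    ring
  simp only [h4]
  rw [h3, finrank_euclideanSpace_fin, abs_of_pos (by positivity), phaseNorm, Complex.real_smul]
  push_cast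
  rfl

lemma continuous_lineSymbol (a b : R4) :
    Continuous fun z : R4 × R4 => lineSymbol a b z.1 z.2 := by
  unfold lineSymbol; fun_prop

lemma norm_lineSymbol_le (a b x p : R4) :
    ‖lineSymbol a b x p‖ ≤ (|inner ℝ a x| + ‖b‖) * (1 + ‖p‖) := by
  have h1 : ‖lineSymbol a b x p‖ ≤ |inner ℝ a x| + |inner ℝ p b| := by
    refine (norm_add_le _ _).trans ?_
    simp
  have h2 := abs_real_inner_le_norm p b
  nlinarith [abs_nonneg (inner ℝ a x : ℝ), norm_nonneg p, norm_nonneg b]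

lemma hasDerivAt_integral_exp_lineSymbol (hs : ContDiff ℝ ∞ h) (hc : HasCompactSupport h)
    (a b x : R4) (m : ℕ) (t₀ : ℝ) :
    HasDerivAt (fun t : ℝ => ∫ p : R4, Complex.exp ((t : ℂ) * lineSymbol a b x p) *
        lineSymbol a b x p ^ m * fourierInt h p)
      (∫ p : R4, Complex.exp ((t₀ : ℂ) * lineSymbol a b x p) *
        lineSymbol a b x p ^ (m + 1) * fourierInt h p) t₀ := by
  set c : R4 → ℂ := lineSymbol a b x with hcdef
  have hcc : Continuous c := (continuous_lineSymbol a b).comp (f := fun p : R4 => (x, p))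
    (by fun_prop)
  have hhc := continuous_fourierInt hs hc
  set L : ℝ := |inner ℝ a x| + ‖b‖ with hL
  -- The p-dependent part of the exponent is imaginary, so the exponential is bounded uniformly in p
  -- for t near t₀.
  set E : ℝ := Real.exp ((|t₀| + 1) * |inner ℝ a x|) with hE
  have hexp : ∀ t ∈ Metric.ball t₀ 1, ∀ p, ‖Complex.exp ((t : ℂ) * c p)‖ ≤ E := fun t ht p => by
    rw [Complex.norm_exp]
    have : ((t : ℂ) * c p).re = t * inner ℝ a x := by
      simp [hcdef, lineSymbol]
    rw [this, hE, Real.exp_le_exp]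
    refine (le_abs_self _).trans ?_
    rw [abs_mul]
    gcongr
    rw [Metric.mem_ball, Real.dist_eq] at ht
    have := abs_sub_abs_le_abs_sub t t₀
    linarith
  have hbd : ∀ (k : ℕ), ∀ t ∈ Metric.ball t₀ 1, ∀ p,
      ‖Complex.exp ((t : ℂ) * c p) * c p ^ k * fourierInt h p‖ ≤
        E * L ^ k * ((1 + ‖p‖) ^ k * ‖fourierInt h p‖) := fun k t ht p => by
    rw [norm_mul, norm_mul, norm_pow]
    have h1 := norm_lineSymbol_le a b x p
    calc ‖Complex.exp ((t : ℂ) * c p)‖ * ‖c p‖ ^ k * ‖fourierInt h p‖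
        ≤ E * (L * (1 + ‖p‖)) ^ k * ‖fourierInt h p‖ := by
          gcongr
          exact hexp t ht p
      _ = _ := by rw [mul_pow]; ring
  have hcont : ∀ (k : ℕ) (t : ℝ), Continuous fun p =>
      Complex.exp ((t : ℂ) * c p) * c p ^ k * fourierInt h p := fun k t => by fun_prop
  refine (hasDerivAt_integral_of_dominated_loc_of_deriv_le
    (F := fun (t : ℝ) p => Complex.exp ((t : ℂ) * c p) * c p ^ m * fourierInt h p)
    (F' := fun (t : ℝ) p => Complex.exp ((t : ℂ) * c p) * c p ^ (m + 1) * fourierInt h p)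
    (bound := fun p => E * L ^ (m + 1) * ((1 + ‖p‖) ^ (m + 1) * ‖fourierInt h p‖))
    (Metric.ball_mem_nhds t₀ one_pos) ?_ ?_ ?_ ?_ ?_ ?_).2
  · exact Filter.Eventually.of_forall fun t => (hcont m t).aestronglyMeasurable
  · exact ((integrable_one_add_norm_pow_mul_fourierInt hs hc m).const_mul (E * L ^ m)).mono'
      (hcont m t₀).aestronglyMeasurable
      (Filter.Eventually.of_forall (hbd m t₀ (Metric.mem_ball_self one_pos)))
  · exact (hcont (m + 1) t₀).aestronglyMeasurable
  · exact Filter.Eventually.of_forall fun p t ht => hbd (m + 1) t ht p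
  · exact (integrable_one_add_norm_pow_mul_fourierInt hs hc (m + 1)).const_mul _
  · refine Filter.Eventually.of_forall fun p t _ => ?_
    have h1 : HasDerivAt (fun t : ℝ => (t : ℂ) * c p) (c p) t := by
      simpa using (Complex.ofRealCLM.hasDerivAt (x := t)).mul_const (c p)
    have h2 := (h1.cexp.mul_const (c p ^ m)).mul_const (fourierInt h p)
    refine h2.congr_deriv ?_
    ring

/-- By Fourier inversion at y = -tb, the differentiated function is the integral of e^{tℓ} against
the transform of h; every t-derivative brings down one factor ℓ. This is how powers of the symbol
arise. -/
lemma iteratedDeriv_exp_mul_comp_line (hs : ContDiff ℝ ∞ h) (hc : HasCompactSupport h)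
    (a b x : R4) (m : ℕ) (t : ℝ) :
    iteratedDeriv m (fun t : ℝ =>
        Complex.exp ((t : ℂ) * ((inner ℝ a x : ℝ) : ℂ)) * h (-(t • b))) t =
      phaseNorm * ∫ p : R4, Complex.exp ((t : ℂ) * lineSymbol a b x p) * lineSymbol a b x p ^ m *
        fourierInt h p := by
  induction m generalizing t with
  | zero =>
    rw [iteratedDeriv_zero, ← fourierInt_inversion hs hc (-(t • b)), mul_left_comm,
      ← integral_const_mul]
    congr 2
    funext p
    rw [← mul_assoc, ← Complex.exp_add, pow_zero, mul_one]
    congr 2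
    rw [lineSymbol, inner_neg_right, inner_smul_right]
    push_cast
    ring
  | succ m ih =>
    rw [iteratedDeriv_succ, funext ih, deriv_const_mul_field,
      (hasDerivAt_integral_exp_lineSymbol hs hc a b x m t).deriv]

/-- A continuous function of polynomial growth that annihilates the Fourier transforms of all
test functions vanishes. -/
lemma eq_zero_of_integral_mul_fourierInt_eq_zero {D : R4 → ℂ} (hD : Continuous D) {C : ℝ} {k : ℕ}
    (hb : ∀ p, ‖D p‖ ≤ C * (1 + ‖p‖) ^ k)
    (h0 : ∀ h : R4 → ℂ, ContDiff ℝ ∞ h → HasCompactSupport h → ∫ p, D p * fourierInt h p = 0)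
    (p₀ : R4) : D p₀ = 0 := by
  obtain ⟨χ, hχs, hχc, hχ0⟩ : ∃ χ : R4 → ℂ, ContDiff ℝ ∞ χ ∧ HasCompactSupport χ ∧ χ 0 = 1 := by
    let f : ContDiffBump (0 : R4) := ⟨1, 2, one_pos, one_lt_two⟩
    refine ⟨fun y => ((f y : ℝ) : ℂ), Complex.ofRealCLM.contDiff.comp f.contDiff,
      f.hasCompactSupport.comp_left (g := fun r : ℝ => (r : ℂ)) Complex.ofReal_zero, ?_⟩
    have : f 0 = 1 := f.one_of_mem_closedBall (Metric.mem_closedBall_self zero_le_one)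
    simp [this]
  have hC : 0 ≤ C := by
    have := (norm_nonneg _).trans (hb 0)
    simpa using this
  have hε : ∀ n : ℕ, (1 : ℝ) / (n + 1) ≠ 0 := fun n => by positivity
  have hzero : ∀ n : ℕ, ∫ q, D (p₀ + (1 / (n + 1 : ℝ)) • q) * fourierInt χ q = 0 := by
    intro n
    set ε : ℝ := 1 / (n + 1)
    have hεn := hε n
    -- Modulation by p₀ and dilation by ε: the transform of h is a bump of width ε about p₀, so
    -- testing against it in the limit ε → 0 recovers the value at p₀.
    let h : R4 → ℂ := fun y => Complex.exp (-(Complex.I * ((inner ℝ p₀ y : ℝ) : ℂ))) * χ (ε • y)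
    have hhs : ContDiff ℝ ∞ h := by
      refine ContDiff.mul ?_ (hχs.comp (contDiff_const_smul ε))
      refine ContDiff.cexp (ContDiff.neg (contDiff_const.mul ?_))
      exact Complex.ofRealCLM.contDiff.comp (contDiff_const.inner ℝ contDiff_id)
    have hhc : HasCompactSupport h := (hχc.comp_smul hεn).mul_left
    have hF : ∀ q, fourierInt χ q = ((|ε ^ 4| : ℝ) : ℂ) * fourierInt h (p₀ + ε • q) := fun q => by
      have := Measure.integral_comp_smul (volume : Measure R4)
        (fun y : R4 => Complex.exp (Complex.I * ((inner ℝ q y : ℝ) : ℂ)) * χ y) ε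
      rw [finrank_euclideanSpace_fin] at this
      have h1 : fourierInt h (p₀ + ε • q) = ∫ y : R4,
          Complex.exp (Complex.I * ((inner ℝ q (ε • y) : ℝ) : ℂ)) * χ (ε • y) := by
        unfold fourierInt
        congr 1
        funext y
        simp only [h]
        rw [← mul_assoc, ← Complex.exp_add]
        congr 2
        rw [inner_add_left, inner_smul_left, inner_smul_right]
        simp only [conj_trivial]
        push_cast
        ring
      rw [h1, this, Complex.real_smul, ← mul_assoc, ← Complex.ofReal_mul, abs_inv,
        mul_inv_cancel₀ (by positivity), Complex.ofReal_one, one_mul]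
      rfl
    have e : ∀ q, D (p₀ + ε • q) * fourierInt χ q =
        ((|ε ^ 4| : ℝ) : ℂ) * (D (p₀ + ε • q) * fourierInt h (p₀ + ε • q)) := fun q => by
      rw [hF]; ring
    simp only [e]
    rw [integral_const_mul, Measure.integral_comp_smul (volume : Measure R4)
      (fun q => D (p₀ + q) * fourierInt h (p₀ + q)) ε,
      integral_add_left_eq_self (μ := (volume : Measure R4)) (fun q => D q * fourierInt h q) p₀,
      h0 h hhs hhc]
    simp
  have hlim : Filter.Tendsto (fun n : ℕ => ∫ q, D (p₀ + (1 / (n + 1 : ℝ)) • q) * fourierInt χ q)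
      Filter.atTop (nhds (∫ q, D p₀ * fourierInt χ q)) := by
    refine tendsto_integral_of_dominated_convergence
      (fun q => C * (1 + ‖p₀‖) ^ k * ((1 + ‖q‖) ^ k * ‖fourierInt χ q‖)) (fun n => ?_)
      ((integrable_one_add_norm_pow_mul_fourierInt hχs hχc k).const_mul _) (fun n => ?_) ?_
    · have := continuous_fourierInt hχs hχc
      exact Continuous.aestronglyMeasurable (by fun_prop)
    · refine Filter.Eventually.of_forall fun q => ?_
      rw [norm_mul, ← mul_assoc]
      gcongr
      refine (hb _).trans ?_
      rw [mul_assoc, ← mul_pow]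
      gcongr
      have h1 : ‖(1 / (n + 1 : ℝ)) • q‖ ≤ ‖q‖ := by
        rw [norm_smul, Real.norm_of_nonneg (by positivity)]
        refine mul_le_of_le_one_left (norm_nonneg _) ?_
        rw [div_le_one (by positivity)]
        linarith [(Nat.cast_nonneg n : (0 : ℝ) ≤ n)]
      have h2 := norm_add_le p₀ ((1 / (n + 1 : ℝ)) • q)
      nlinarith [norm_nonneg p₀, norm_nonneg q]
    · refine Filter.Eventually.of_forall fun q => ?_
      refine Filter.Tendsto.mul_const _ ?_
      have h1 : Filter.Tendsto (fun n : ℕ => p₀ + (1 / (n + 1 : ℝ)) • q) Filter.atTop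
          (nhds (p₀ + (0 : ℝ) • q)) :=
        (tendsto_one_div_add_atTop_nhds_zero_nat.smul_const q).const_add p₀
      rw [zero_smul, add_zero] at h1
      exact (hD.tendsto p₀).comp h1
  simp only [hzero] at hlim
  have h1 := tendsto_nhds_unique hlim tendsto_const_nhds
  -- The limit is D(p₀) times the integral of the transform of χ, which is nonzero by inversion at 0
  -- because χ(0) = 1.
  rw [integral_const_mul] at h1
  have h2 := fourierInt_inversion hχs hχc 0
  rw [hχ0] at h2
  simp only [inner_zero_right, Complex.ofReal_zero, mul_zero, neg_zero, Complex.exp_zero,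
    one_mul] at h2
  rcases mul_eq_zero.1 h1 with h3 | h3
  · exact h3
  · rw [h3, mul_zero] at h2; exact absurd h2 zero_ne_one

end Fourier

/-! ### Uniqueness of the generalized Weyl symbol. -/

section SymbolUnique

variable {s g : Type*} [Fintype s] [DecidableEq s] [Fintype g] [DecidableEq g]
  {A : Fin 4 → R4 → Matrix g g ℂ}

/-- `U(x, x - y/2) K(x - y/2, x + y/2) U(x + y/2, x)`. -/
def dressed (A : Fin 4 → R4 → Matrix g g ℂ) (K : R4 → R4 → Matrix (s × g) (s × g) ℂ)
    (x y : R4) : Matrix (s × g) (s × g) ℂ :=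
  ((1 : Matrix s s ℂ) ⊗ₖ wilson A x (x - (1 / 2 : ℝ) • y)) *
    K (x - (1 / 2 : ℝ) • y) (x + (1 / 2 : ℝ) • y) *
    ((1 : Matrix s s ℂ) ⊗ₖ wilson A (x + (1 / 2 : ℝ) • y) x)

lemma wigner_apply (K : R4 → R4 → Matrix (s × g) (s × g) ℂ) (x p : R4) (i j : s × g) :
    wigner A K x p i j = fourierInt (fun y => dressed A K x y i j) p := rfl

lemma one_kronecker_wilson_mul_inv (hA : ∀ μ, SmoothMat (A μ)) (w x : R4) :
    ((1 : Matrix s s ℂ) ⊗ₖ wilson A w x) * ((1 : Matrix s s ℂ) ⊗ₖ wilson A x w) = 1 := by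
  rw [← Matrix.mul_kronecker_mul, wilson_mul_wilson_inv hA, Matrix.one_mul,
    Matrix.one_kronecker_one]

/-- A test kernel whose Wigner transform is a product. -/
def productKernel (A : Fin 4 → R4 → Matrix g g ℂ) (f h : R4 → ℂ) (i j : s × g) (z w : R4) :
    Matrix (s × g) (s × g) ℂ :=
  (f ((1 / 2 : ℝ) • (z + w)) * h (w - z)) •
    (((1 : Matrix s s ℂ) ⊗ₖ wilson A z ((1 / 2 : ℝ) • (z + w))) * Matrix.single i j 1 *
      ((1 : Matrix s s ℂ) ⊗ₖ wilson A ((1 / 2 : ℝ) • (z + w)) w))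

lemma isTestKernel_productKernel (hA : ∀ μ, SmoothMat (A μ)) {f h : R4 → ℂ}
    (hf : ContDiff ℝ ∞ f) (hfc : HasCompactSupport f) (hh : ContDiff ℝ ∞ h)
    (hhc : HasCompactSupport h) (i j : s × g) : IsTestKernel (productKernel A f h i j) := by
  intro k l
  constructor
  · have : MatContDiff ∞ fun z : R4 × R4 => productKernel A f h i j z.1 z.2 := by
      refine MatContDiff.smul ?_ (((matContDiff_one_kronecker ?_).mul (matContDiff_const _)).mul
        (matContDiff_one_kronecker ?_))
      · exact (hf.comp (f := fun z : R4 × R4 => (1 / 2 : ℝ) • (z.1 + z.2)) (by fun_prop)).mul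
          (hh.comp (f := fun z : R4 × R4 => z.2 - z.1) (by fun_prop))
      · exact matContDiff_wilson hA (by fun_prop) (by fun_prop)
      · exact matContDiff_wilson hA (by fun_prop) (by fun_prop)
    exact this k l
  · refine HasCompactSupport.intro (K := (fun q : R4 × R4 =>
      (q.1 - (1 / 2 : ℝ) • q.2, q.1 + (1 / 2 : ℝ) • q.2)) '' (tsupport f ×ˢ tsupport h))
      ((hfc.prod hhc).image (by fun_prop)) fun z hz => ?_
    have hz' : f ((1 / 2 : ℝ) • (z.1 + z.2)) * h (z.2 - z.1) = 0 := by
      by_contra hne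
      refine hz ⟨((1 / 2 : ℝ) • (z.1 + z.2), z.2 - z.1),
        ⟨subset_tsupport _ (left_ne_zero_of_mul hne),
          subset_tsupport _ (right_ne_zero_of_mul hne)⟩, ?_⟩
      refine Prod.ext ?_ ?_
      · change (1 / 2 : ℝ) • (z.1 + z.2) - (1 / 2 : ℝ) • (z.2 - z.1) = z.1
        module
      · change (1 / 2 : ℝ) • (z.1 + z.2) + (1 / 2 : ℝ) • (z.2 - z.1) = z.2
        module
    rw [productKernel, hz', zero_smul, Matrix.zero_apply]

/-- The Wilson lines built into the kernel meet at the midpoint x and cancel those of the Wigner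
transform. The matrix unit left over isolates one entry of a symbol under the trace. -/
lemma dressed_productKernel (hA : ∀ μ, SmoothMat (A μ)) (f h : R4 → ℂ) (i j : s × g) (x y : R4) :
    dressed A (productKernel A f h i j) x y = (f x * h y) • Matrix.single i j 1 := by
  have h1 : (1 / 2 : ℝ) • (x - (1 / 2 : ℝ) • y + (x + (1 / 2 : ℝ) • y)) = x := by module
  have h2 : x + (1 / 2 : ℝ) • y - (x - (1 / 2 : ℝ) • y) = y := by module
  simp only [dressed, productKernel, h1, h2, Matrix.mul_smul, Matrix.smul_mul]
  congr 1
  have e : ∀ a b c d E : Matrix (s × g) (s × g) ℂ, a * (b * E * c) * d = (a * b) * E * (c * d) :=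
    fun a b c d E => by noncomm_ring
  rw [e, one_kronecker_wilson_mul_inv hA, one_kronecker_wilson_mul_inv hA, one_mul, mul_one]

lemma wigner_productKernel (hA : ∀ μ, SmoothMat (A μ)) (f h : R4 → ℂ) (i j : s × g) (x p : R4) :
    wigner A (productKernel A f h i j) x p = (f x * fourierInt h p) • Matrix.single i j 1 := by
  ext k l
  rw [wigner_apply, Matrix.smul_apply, smul_eq_mul]
  simp only [fourierInt, dressed_productKernel hA, Matrix.smul_apply, smul_eq_mul]
  rw [← integral_const_mul, ← integral_mul_const]
  congr 1
  funext y
  ring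

lemma continuous_integral_symbol_mul_fourierInt {X : R4 × R4 → ℂ} (hX : Continuous X)
    (hg : ∀ R : ℝ, ∃ C : ℝ, ∃ k : ℕ, ∀ x p : R4, ‖x‖ ≤ R → ‖X (x, p)‖ ≤ C * (1 + ‖p‖) ^ k)
    {h : R4 → ℂ} (hh : ContDiff ℝ ∞ h) (hhc : HasCompactSupport h) :
    Continuous fun x => ∫ p, X (x, p) * fourierInt h p := by
  rw [continuous_iff_continuousAt]
  intro x₀
  obtain ⟨C, k, hC⟩ := hg (‖x₀‖ + 1)
  have hc := continuous_fourierInt hh hhc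
  refine continuousAt_of_dominated (bound := fun p => C * ((1 + ‖p‖) ^ k * ‖fourierInt h p‖))
    (Filter.Eventually.of_forall fun x => Continuous.aestronglyMeasurable (by fun_prop)) ?_
    ((integrable_one_add_norm_pow_mul_fourierInt hh hhc k).const_mul C)
    (Filter.Eventually.of_forall fun p => Continuous.continuousAt (by fun_prop))
  filter_upwards [Metric.ball_mem_nhds x₀ one_pos] with x hx
  refine Filter.Eventually.of_forall fun p => ?_
  rw [norm_mul, ← mul_assoc]
  refine mul_le_mul_of_nonneg_right (hC x p ?_) (norm_nonneg _)
  rw [Metric.mem_ball, dist_eq_norm] at hx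
  have := norm_sub_norm_le x x₀
  linarith

/-- The generalized Weyl symbol of an operator is unique. -/
lemma IsWeylSymbol.unique (hA : ∀ μ, SmoothMat (A μ))
    {T : (R4 → s × g → ℂ) → (R4 → s × g → ℂ)} {X Y : R4 → R4 → Matrix (s × g) (s × g) ℂ}
    (hX : IsWeylSymbol A T X) (hY : IsWeylSymbol A T Y) : X = Y := by
  have hne : phaseNorm ≠ 0 := by
    unfold phaseNorm
    exact inv_ne_zero (by exact_mod_cast (by positivity : (2 * Real.pi) ^ 4 ≠ 0))
  funext x p
  ext j i
  have hgX : ∀ R : ℝ, ∃ C : ℝ, ∃ k : ℕ, ∀ x p : R4, ‖x‖ ≤ R → ‖X x p j i‖ ≤ C * (1 + ‖p‖) ^ k :=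
    fun R => by
      obtain ⟨C, k, h⟩ := hX.growth R
      exact ⟨C, k, fun x p hx => h x p hx j i⟩
  have hgY : ∀ R : ℝ, ∃ C : ℝ, ∃ k : ℕ, ∀ x p : R4, ‖x‖ ≤ R → ‖Y x p j i‖ ≤ C * (1 + ‖p‖) ^ k :=
    fun R => by
      obtain ⟨C, k, h⟩ := hY.growth R
      exact ⟨C, k, fun x p hx => h x p hx j i⟩
  -- The variables are separated: arbitrary f gives equality at every x of the integrals over p, by
  -- continuity in x; arbitrary h then gives equality at every p.
  have key : ∀ h : R4 → ℂ, ContDiff ℝ ∞ h → HasCompactSupport h →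
      (fun x => ∫ p, X x p j i * fourierInt h p) = fun x => ∫ p, Y x p j i * fourierInt h p := by
    intro h hh hhc
    have hcX := continuous_integral_symbol_mul_fourierInt (hX.continuous j i) hgX hh hhc
    have hcY := continuous_integral_symbol_mul_fourierInt (hY.continuous j i) hgY hh hhc
    refine (Continuous.ae_eq_iff_eq volume hcX hcY).1 ?_
    refine ae_eq_of_integral_contDiff_smul_eq hcX.locallyIntegrable hcY.locallyIntegrable
      fun f hf hfc => ?_
    have hf' : ContDiff ℝ ∞ fun x => ((f x : ℝ) : ℂ) := Complex.ofRealCLM.contDiff.comp hf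
    have hfc' : HasCompactSupport fun x => ((f x : ℝ) : ℂ) :=
      hfc.comp_left (g := fun r : ℝ => (r : ℂ)) Complex.ofReal_zero
    have hK := isTestKernel_productKernel hA hf' hfc' hh hhc i j
    have e := (hX.pairing _ hK).symm.trans (hY.pairing _ hK)
    have e2 : ∀ Z : R4 → R4 → Matrix (s × g) (s × g) ℂ,
        ∫ x : R4, ∫ p : R4,
          (Z x p * wigner A (productKernel A (fun x => ((f x : ℝ) : ℂ)) h i j) x p).trace =
        ∫ x, f x • ∫ p, Z x p j i * fourierInt h p := fun Z => by
      congr 1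
      funext x
      rw [Complex.real_smul, ← integral_const_mul]
      congr 1
      funext p
      rw [wigner_productKernel hA, Matrix.mul_smul, Matrix.trace_smul, Matrix.trace_mul_single,
        smul_eq_mul, MulOpposite.op_one, one_smul]
      ring
    rw [e2, e2] at e
    exact mul_left_cancel₀ hne e
  obtain ⟨C, k, hC⟩ := hgX ‖x‖
  obtain ⟨C', k', hC'⟩ := hgY ‖x‖
  have hXc : Continuous fun p => X x p j i :=
    (hX.continuous j i).comp (f := fun p : R4 => (x, p)) (by fun_prop)
  have hYc : Continuous fun p => Y x p j i :=
    (hY.continuous j i).comp (f := fun p : R4 => (x, p)) (by fun_prop)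
  refine sub_eq_zero.1 (eq_zero_of_integral_mul_fourierInt_eq_zero
    (D := fun p => X x p j i - Y x p j i) (C := |C| + |C'|) (k := k + k')
    (hXc.sub hYc) (fun p => ?_) (fun h hh hhc => ?_) p)
  · have h1 : (1 : ℝ) ≤ 1 + ‖p‖ := by linarith [norm_nonneg p]
    have h2 : (1 + ‖p‖) ^ k ≤ (1 + ‖p‖) ^ (k + k') := pow_le_pow_right₀ h1 (by omega)
    have h3 : (1 + ‖p‖) ^ k' ≤ (1 + ‖p‖) ^ (k + k') := pow_le_pow_right₀ h1 (by omega)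
    calc ‖X x p j i - Y x p j i‖ ≤ ‖X x p j i‖ + ‖Y x p j i‖ := norm_sub_le _ _
      _ ≤ |C| * (1 + ‖p‖) ^ k + |C'| * (1 + ‖p‖) ^ k' := by
          refine add_le_add ((hC x p le_rfl).trans ?_) ((hC' x p le_rfl).trans ?_) <;>
          · gcongr; exact le_abs_self _
      _ ≤ _ := by rw [add_mul]; gcongr
  · simp only [sub_mul]
    rw [integral_sub (integrable_mul_fourierInt hh hhc hXc fun p => hC x p le_rfl)
      (integrable_mul_fourierInt hh hhc hYc fun p => hC' x p le_rfl), sub_eq_zero]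
    exact congrFun (key h hh hhc) x

/-- Uniqueness makes the choice in `weylSymbol` harmless: any verified candidate is the symbol. -/
lemma IsWeylSymbol.weylSymbol_eq (hA : ∀ μ, SmoothMat (A μ))
    {T : (R4 → s × g → ℂ) → (R4 → s × g → ℂ)} {X : R4 → R4 → Matrix (s × g) (s × g) ℂ}
    (hX : IsWeylSymbol A T X) : weylSymbol A T = X := by
  have h : ∃ X, IsWeylSymbol A T X := ⟨X, hX⟩
  rw [weylSymbol, dif_pos h]
  exact h.choose_spec.unique hA hX

end SymbolUnique

/-! ### Smoothness and derivative at zero of the matrix exponential. -/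

section MatrixExp

variable {m : Type*} [Fintype m] [DecidableEq m]

section

open scoped Matrix.Norms.Operator

lemma contDiff_norm_exp_entry {E : Type*} [NormedAddCommGroup E] [NormedSpace ℝ E]
    {F : E → Matrix m m ℂ} (hF : MatContDiff ∞ F) (i j : m) :
    ContDiff ℝ ∞ fun z => (LinearMap.toContinuousLinearMap (Matrix.entryLinearMap ℝ ℂ i j))
      (NormedSpace.exp (F z)) := by
  have hF' : ContDiff ℝ ∞ F := by
    have : F = fun z => ∑ i, ∑ j, F z i j • Matrix.single i j (1 : ℂ) := by
      funext z
      conv_lhs => rw [Matrix.matrix_eq_sum_single (F z)]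
      simp [Matrix.smul_single]
    rw [this]
    exact ContDiff.sum fun i _ => ContDiff.sum fun j _ => (hF i j).smul contDiff_const
  have hexp : ContDiff ℝ ∞ (fun M : Matrix m m ℂ => NormedSpace.exp M) :=
    contDiff_iff_contDiffAt.2 fun M => (NormedSpace.exp_analytic (𝕂 := ℝ) M).contDiffAt
  exact (LinearMap.toContinuousLinearMap (Matrix.entryLinearMap ℝ ℂ i j)).contDiff.comp
    (hexp.comp hF')

lemma hasDerivAt_norm_exp_entry (M : Matrix m m ℂ) (i j : m) :
    HasDerivAt (fun ε : ℝ => (LinearMap.toContinuousLinearMap (Matrix.entryLinearMap ℝ ℂ i j))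
      (NormedSpace.exp (ε • M))) (M i j) 0 := by
  have h1 := hasDerivAt_exp_smul_const (𝕂 := ℝ) (𝔸 := Matrix m m ℂ) M (0 : ℝ)
  have h2 := (LinearMap.toContinuousLinearMap
    (Matrix.entryLinearMap ℝ ℂ i j)).hasFDerivAt.comp_hasDerivAt (0 : ℝ) h1
  rw [zero_smul, NormedSpace.exp_zero, one_mul] at h2
  exact h2

end

lemma MatContDiff.exp {E : Type*} [NormedAddCommGroup E] [NormedSpace ℝ E]
    {F : E → Matrix m m ℂ} (hF : MatContDiff ∞ F) :
    MatContDiff ∞ fun z => NormedSpace.exp (F z) :=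
  contDiff_norm_exp_entry hF

lemma matHasDerivAt_exp_zero (M : Matrix m m ℂ) :
    MatHasDerivAt (fun ε : ℝ => NormedSpace.exp (ε • M)) M 0 :=
  hasDerivAt_norm_exp_entry M

end MatrixExp

/-! ### Differentiating powers of a·x + b·D along one-parameter families. -/

section JointOperators

variable {s g n : Type*} [Fintype s] [DecidableEq s] [Fintype g] [DecidableEq g]
  {A : Fin 4 → R4 → Matrix g g ℂ}

/-- The member at `ε` of a smooth one-parameter family of smooth functions. -/
def famSlice {m n : Type*} {P : ℝ × R4 → Matrix m n ℂ} (hP : MatContDiff ∞ P) (ε : ℝ) :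
    smoothMats m n :=
  ⟨fun x => P (ε, x), MatContDiff.comp hP (f := fun x : R4 => (ε, x)) (by fun_prop)⟩

/-- The derivative of a one-parameter family with respect to the parameter. -/
def famDeriv {m n : Type*} (P : ℝ × R4 → Matrix m n ℂ) (z : ℝ × R4) : Matrix m n ℂ :=
  Matrix.of fun i j => fderiv ℝ (fun z => P z i j) z (1, 0)

lemma matContDiff_famDeriv {m n : Type*} {P : ℝ × R4 → Matrix m n ℂ} (hP : MatContDiff ∞ P) :
    MatContDiff ∞ (famDeriv P) := fun i j =>
  ((hP i j).fderiv_right (m := ∞) (by simp)).clm_apply contDiff_const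

lemma famDeriv_matHasDerivAt {m n : Type*} {P : ℝ × R4 → Matrix m n ℂ} (hP : MatContDiff ∞ P)
    (ε : ℝ) (x : R4) : MatHasDerivAt (fun ε => P (ε, x)) (famDeriv P (ε, x)) ε := fun i j => by
  have h1 : HasFDerivAt (fun z => P z i j) (fderiv ℝ (fun z => P z i j) (ε, x)) (ε, x) :=
    ((hP i j).differentiable (by simp) _).hasFDerivAt
  have h2 : HasDerivAt (fun ε : ℝ => (ε, x)) ((1 : ℝ), (0 : R4)) ε :=
    (hasDerivAt_id ε).prodMk (hasDerivAt_const ε x)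
  exact h1.comp_hasDerivAt ε h2

lemma fderiv_famSlice {m n : Type*} {P : ℝ × R4 → Matrix m n ℂ} (hP : MatContDiff ∞ P)
    (z : ℝ × R4) (b : R4) (i : m) (j : n) :
    fderiv ℝ (fun x => P (z.1, x) i j) z.2 b = fderiv ℝ (fun z => P z i j) z (0, b) := by
  have h1 : HasFDerivAt (fun z => P z i j) (fderiv ℝ (fun z => P z i j) (z.1, z.2)) (z.1, z.2) :=
    ((hP i j).differentiable (by simp) _).hasFDerivAt
  have h2 : HasFDerivAt (fun x => P (z.1, x) i j) ((fderiv ℝ (fun z => P z i j) z).comp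
      (ContinuousLinearMap.inr ℝ ℝ R4)) z.2 := h1.comp z.2 (hasFDerivAt_prodMk_right z.1 z.2)
  rw [h2.fderiv]
  simp

/-- The operator `a · x + b · D` on one-parameter families. -/
def famLine (A : Fin 4 → R4 → Matrix g g ℂ) (a b : R4) (P : ℝ × R4 → Matrix (s × g) n ℂ)
    (z : ℝ × R4) : Matrix (s × g) n ℂ :=
  ((inner ℝ a z.2 : ℝ) : ℂ) • P z + (Matrix.of fun i j => fderiv ℝ (fun z => P z i j) z (0, b)) -
    ((1 : Matrix s s ℂ) ⊗ₖ conn A b z.2) * P z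

lemma matContDiff_famLine (hA : ∀ μ, SmoothMat (A μ)) (a b : R4)
    {P : ℝ × R4 → Matrix (s × g) n ℂ} (hP : MatContDiff ∞ P) :
    MatContDiff ∞ (famLine A a b P) := by
  refine MatContDiff.sub (MatContDiff.add (MatContDiff.smul ?_ hP) ?_) (MatContDiff.mul
    (matContDiff_one_kronecker (matContDiff_conn hA contDiff_const (by fun_prop))) hP)
  · exact Complex.ofRealCLM.contDiff.comp (contDiff_const.inner ℝ contDiff_snd)
  · exact fun i j => ((hP i j).fderiv_right (m := ∞) (by simp)).clm_apply contDiff_const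

lemma lineEnd_famSlice (hA : ∀ μ, SmoothMat (A μ)) (a b : R4)
    {P : ℝ × R4 → Matrix (s × g) n ℂ} (hP : MatContDiff ∞ P) (ε : ℝ) :
    lineEnd hA a b (famSlice hP ε) = famSlice (matContDiff_famLine hA a b hP) ε := by
  refine Subtype.ext (funext fun x => ?_)
  rw [lineEnd_apply, ← add_sub_assoc]
  have e : ∑ μ, ((b μ : ℝ) : ℂ) • partialMat μ (famSlice hP ε).1 x =
      Matrix.of fun i j => fderiv ℝ (fun z => P z i j) (ε, x) (0, b) := by
    ext i j
    rw [sum_partialMat_apply]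
    exact fderiv_famSlice hP (ε, x) b i j
  rw [e]
  rfl

/-- Mixed second derivatives are symmetric, and the multiplication and connection terms do not
depend on the parameter. -/
lemma famDeriv_famLine (hA : ∀ μ, SmoothMat (A μ)) (a b : R4)
    {P : ℝ × R4 → Matrix (s × g) n ℂ} (hP : MatContDiff ∞ P) :
    famDeriv (famLine A a b P) = famLine A a b (famDeriv P) := by
  funext z
  have h0 := famDeriv_matHasDerivAt hP z.1 z.2
  have h1 := famDeriv_matHasDerivAt (matContDiff_famLine hA a b hP) z.1 z.2
  have hd : MatContDiff ∞ fun z => Matrix.of fun i j => fderiv ℝ (fun z => P z i j) z (0, b) :=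
    fun i j => ((hP i j).fderiv_right (m := ∞) (by simp)).clm_apply contDiff_const
  have h2 := famDeriv_matHasDerivAt hd z.1 z.2
  have h3 := (matHasDerivAt_const ((1 : Matrix s s ℂ) ⊗ₖ conn A b z.2) z.1).mul h0
  ext i j
  have h4 := (((h0 i j).const_mul ((inner ℝ a z.2 : ℝ) : ℂ)).add (h2 i j)).sub (h3 i j)
  have h5 := (h1 i j).unique h4
  rw [h5, Matrix.zero_mul, zero_add]
  have hsymm : famDeriv (fun z => Matrix.of fun i j => fderiv ℝ (fun z => P z i j) z (0, b))
      z i j = fderiv ℝ (fun z => famDeriv P z i j) z (0, b) := by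
    have hdd : DifferentiableAt ℝ (fderiv ℝ fun z => P z i j) z :=
      ((hP i j).fderiv_right (m := ∞) (by simp)).differentiable (by simp) z
    have hs : IsSymmSndFDerivAt ℝ (fun z => P z i j) z :=
      (hP i j).contDiffAt.isSymmSndFDerivAt (by
        simpa using (WithTop.coe_le_coe.2 le_top : ((2 : ℕ∞) : WithTop ℕ∞) ≤ ∞))
    change fderiv ℝ (fun z => fderiv ℝ (fun z => P z i j) z (0, b)) z (1, 0) =
      fderiv ℝ (fun z => fderiv ℝ (fun z => P z i j) z (1, 0)) z (0, b)
    rw [fderiv_clm_apply hdd (by fun_prop), fderiv_clm_apply hdd (by fun_prop)]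
    simpa using hs (1, 0) (0, b)
  change _ * famDeriv P z i j + famDeriv _ z i j - _ = _
  rw [hsymm]
  rfl

/-- The induction replaces the family P by its image under one line operator, so the parameter
derivative passes through the operators one at a time. -/
lemma lineEnd_pow_famSlice_matHasDerivAt (hA : ∀ μ, SmoothMat (A μ)) (a b : R4) (N : ℕ) :
    ∀ {P : ℝ × R4 → Matrix (s × g) n ℂ} (hP : MatContDiff ∞ P) (ε : ℝ) (x : R4),
      MatHasDerivAt (fun ε => ((lineEnd hA a b ^ N) (famSlice hP ε)).1 x)
        (((lineEnd hA a b ^ N) (famSlice (matContDiff_famDeriv hP) ε)).1 x) ε := by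
  induction N with
  | zero =>
    intro P hP ε x
    exact famDeriv_matHasDerivAt hP ε x
  | succ N ih =>
    intro P hP ε x
    have h := ih (matContDiff_famLine hA a b hP) ε x
    simp only [pow_succ, Module.End.mul_apply, lineEnd_famSlice]
    have e : famSlice (matContDiff_famDeriv (matContDiff_famLine hA a b hP)) ε =
        famSlice (matContDiff_famLine hA a b (matContDiff_famDeriv hP)) ε :=
      Subtype.ext (funext fun x => congrFun (famDeriv_famLine hA a b hP) (ε, x))
    rw [e] at h
    exact h

end JointOperators

/-! ### The infinitesimal axial variation of Q. -/

section AxialVariation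

variable {s g n : Type*} [Fintype s] [DecidableEq s] [Fintype g] [DecidableEq g]
  {A : Fin 4 → R4 → Matrix g g ℂ}

/-- The generator `i γ⁵ α` of the axial transformation. -/
def axialGen (γ5 : Matrix s s ℂ) (α : R4 → Matrix g g ℂ) (x : R4) : Matrix (s × g) (s × g) ℂ :=
  Complex.I • (γ5 ⊗ₖ α x)

lemma smoothMat_axialGen (γ5 : Matrix s s ℂ) {α : R4 → Matrix g g ℂ} (hα : SmoothMat α) :
    SmoothMat (axialGen γ5 α) :=
  MatContDiff.const_smul _ (MatContDiff.kronecker (matContDiff_const γ5) hα)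

lemma axialRotation_eq (γ5 : Matrix s s ℂ) (α : R4 → Matrix g g ℂ) (ε : ℝ) (x : R4) :
    axialRotation γ5 α ε x = NormedSpace.exp (ε • axialGen γ5 α x) := by
  unfold axialRotation axialGen
  congr 1
  ext i j
  simp only [Matrix.smul_apply, smul_eq_mul, Complex.real_smul]
  ring

/-- Left multiplication of a smooth matrix function by a smooth matrix function. -/
def smoothMul {m : Type*} [Fintype m] {C : R4 → Matrix m m ℂ} (hC : SmoothMat C)
    (F : smoothMats m n) : smoothMats m n :=
  ⟨fun x => C x * F.1 x, MatContDiff.mul hC F.2⟩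

/-- The product rule at ε = 0, where both rotations are the identity: one term differentiates the
outer rotation, the other the inner one. This is δQ = {Q, iαγ⁵} on columns of a kernel. -/
lemma axialVariation_column (hA : ∀ μ, SmoothMat (A μ)) (Q : SymPoly s) (γ5 : Matrix s s ℂ)
    {α : R4 → Matrix g g ℂ} (hα : SmoothMat α) {ι : Type} [Fintype ι] {M : ι → Matrix s s ℂ}
    {N : ι → ℕ} {a b : ι → R4}
    (hQ : ∀ (F : smoothMats (s × g) n) (j : n) (x : R4) (i : s × g),
        Q.op A (fun z k => F.1 z k j) x i = (∑ q, (M q ⊗ₖ (1 : Matrix g g ℂ)) *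
          (((lineEnd hA (a q) (b q)) ^ N q) F).1 x) i j)
    (F : smoothMats (s × g) n) (j : n) (x : R4) (i : s × g) :
    axialVariation Q A γ5 α (fun z k => F.1 z k j) x i =
      (axialGen γ5 α x * (∑ q, (M q ⊗ₖ (1 : Matrix g g ℂ)) *
          (((lineEnd hA (a q) (b q)) ^ N q) F).1 x) +
        ∑ q, (M q ⊗ₖ (1 : Matrix g g ℂ)) *
          (((lineEnd hA (a q) (b q)) ^ N q) (smoothMul (smoothMat_axialGen γ5 hα) F)).1 x) i j := by
  let P : ℝ × R4 → Matrix (s × g) n ℂ := fun z =>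
    NormedSpace.exp (z.1 • axialGen γ5 α z.2) * F.1 z.2
  have hP : MatContDiff ∞ P := by
    refine MatContDiff.mul (MatContDiff.exp ?_) (MatContDiff.comp F.2 contDiff_snd)
    exact fun i j => contDiff_fst.smul ((smoothMat_axialGen γ5 hα i j).comp contDiff_snd)
  have hP0 : famSlice hP 0 = F := Subtype.ext (funext fun x => by
    change NormedSpace.exp ((0 : ℝ) • axialGen γ5 α x) * F.1 x = F.1 x
    rw [zero_smul, NormedSpace.exp_zero, Matrix.one_mul])
  have hP1 : famSlice (matContDiff_famDeriv hP) 0 = smoothMul (smoothMat_axialGen γ5 hα) F := by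
    refine Subtype.ext (funext fun x => ?_)
    have h1 := famDeriv_matHasDerivAt hP 0 x
    have h2 := (matHasDerivAt_exp_zero (axialGen γ5 α x)).mul (matHasDerivAt_const (F.1 x) 0)
    rw [Matrix.mul_zero, add_zero] at h2
    ext k l
    exact (h1 k l).unique (h2 k l)
  have hR := matHasDerivAt_exp_zero (axialGen γ5 α x)
  have hsum : MatHasDerivAt (fun ε => ∑ q, (M q ⊗ₖ (1 : Matrix g g ℂ)) *
      (((lineEnd hA (a q) (b q)) ^ N q) (famSlice hP ε)).1 x)
      (∑ q, (M q ⊗ₖ (1 : Matrix g g ℂ)) *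
          (((lineEnd hA (a q) (b q)) ^ N q) (smoothMul (smoothMat_axialGen γ5 hα) F)).1 x) 0 := by
    intro k l
    simp only [Matrix.sum_apply]
    refine HasDerivAt.fun_sum fun q _ => ?_
    have := (matHasDerivAt_const (M q ⊗ₖ (1 : Matrix g g ℂ)) 0).mul
      (lineEnd_pow_famSlice_matHasDerivAt hA (a q) (b q) (N q) hP 0 x)
    rw [Matrix.zero_mul, zero_add, hP1] at this
    exact this k l
  have hprod := hR.mul hsum
  rw [hP0, zero_smul, NormedSpace.exp_zero, Matrix.one_mul] at hprod
  rw [← (hprod i j).deriv]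
  unfold axialVariation
  congr 1
  funext ε
  have hcol : (fun z => axialRotation γ5 α ε z *ᵥ fun k => F.1 z k j) =
      fun z k => (famSlice hP ε).1 z k j := by
    funext z k
    rw [axialRotation_eq]
    rfl
  have hop : Q.op A (fun z k => (famSlice hP ε).1 z k j) x = fun i =>
      (∑ q, (M q ⊗ₖ (1 : Matrix g g ℂ)) *
        (((lineEnd hA (a q) (b q)) ^ N q) (famSlice hP ε)).1 x) i j := funext fun i => hQ _ j x i
  rw [hcol, axialRotation_eq, hop]
  rfl

end AxialVariation

/-! ### Parameter derivatives of integrals with uniformly bounded support. -/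

section ParameterDerivatives

/-- Repeated differentiation under the integral sign for smooth families of functions that are
supported in a fixed ball. -/
lemma exists_iteratedDeriv_integral (N : ℕ) : ∀ {Ψ : ℝ × R4 → ℂ}, ContDiff ℝ ∞ Ψ → ∀ {R : ℝ},
    (∀ t x, R < ‖x‖ → Ψ (t, x) = 0) → ∃ Φ : ℝ × R4 → ℂ, ContDiff ℝ ∞ Φ ∧
      (∀ t x, R < ‖x‖ → Φ (t, x) = 0) ∧
      (∀ t x, iteratedDeriv N (fun t => Ψ (t, x)) t = Φ (t, x)) ∧
      ∀ t, iteratedDeriv N (fun t => ∫ x, Ψ (t, x)) t = ∫ x, Φ (t, x) := by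
  induction N with
  | zero => intro Ψ hΨ R h0; exact ⟨Ψ, hΨ, h0, fun _ _ => by simp, fun _ => by simp⟩
  | succ N ih =>
    intro Ψ hΨ R h0
    have hd : ∀ t x, HasDerivAt (fun t => Ψ (t, x)) (fderiv ℝ Ψ (t, x) (1, 0)) t := fun t x => by
      have h1 : HasFDerivAt Ψ (fderiv ℝ Ψ (t, x)) (t, x) :=
        (hΨ.differentiable (by simp) _).hasFDerivAt
      exact h1.comp_hasDerivAt t ((hasDerivAt_id t).prodMk (hasDerivAt_const t x))
    have h0' : ∀ t x, R < ‖x‖ → fderiv ℝ Ψ (t, x) (1, 0) = 0 := fun t x hx => by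
      have := hd t x
      rw [show (fun t => Ψ (t, x)) = fun _ => 0 from funext fun t => h0 t x hx] at this
      exact this.unique (hasDerivAt_const t 0)
    have hset : ∀ {f : R4 → ℂ}, (∀ x, R < ‖x‖ → f x = 0) →
        ∫ x, f x = ∫ x in Metric.closedBall 0 R, f x := fun {f} hf =>
      (setIntegral_eq_integral_of_forall_compl_eq_zero fun x hx => hf x (by
        simpa using hx)).symm
    obtain ⟨Φ, h1, h2, h3, h4⟩ := ih (Ψ := fun z => fderiv ℝ Ψ z (1, 0))
      ((hΨ.fderiv_right (m := ∞) (by simp)).clm_apply contDiff_const) h0'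
    refine ⟨Φ, h1, h2, fun t x => ?_, fun t => ?_⟩
    · rw [iteratedDeriv_succ', ← h3]
      congr 1
      funext t
      exact (hd t x).deriv
    · rw [iteratedDeriv_succ', ← h4]
      congr 1
      funext t
      rw [funext fun t => hset (h0 t), hset (h0' t), ← fderiv_apply_one_eq_deriv]
      exact fderiv_setIntegral_apply (isCompact_closedBall (0 : R4) R) (hΨ.of_le (by simp)) t 1

lemma integrable_of_continuous_of_norm_lt {f : R4 → ℂ} (hf : Continuous f) {R : ℝ}
    (h0 : ∀ x, R < ‖x‖ → f x = 0) : Integrable f :=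
  hf.integrable_of_hasCompactSupport
    (HasCompactSupport.intro (isCompact_closedBall 0 R) fun x hx => h0 x (by simpa using hx))

end ParameterDerivatives

/-! ### Closure properties of polynomial growth. -/

section Growth

/-- Polynomial growth in `p`, locally uniformly in `x`. -/
def HasPolyGrowth (f : R4 → R4 → ℂ) : Prop :=
  ∀ R : ℝ, ∃ C : ℝ, ∃ k : ℕ, ∀ x p : R4, ‖x‖ ≤ R → ‖f x p‖ ≤ C * (1 + ‖p‖) ^ k

lemma HasPolyGrowth.add {f f' : R4 → R4 → ℂ} (hf : HasPolyGrowth f) (hf' : HasPolyGrowth f') :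
    HasPolyGrowth fun x p => f x p + f' x p := fun R => by
  obtain ⟨C, k, h⟩ := hf R
  obtain ⟨C', k', h'⟩ := hf' R
  refine ⟨|C| + |C'|, k + k', fun x p hx => ?_⟩
  have h1 : (1 : ℝ) ≤ 1 + ‖p‖ := by linarith [norm_nonneg p]
  have h2 : (1 + ‖p‖) ^ k ≤ (1 + ‖p‖) ^ (k + k') := pow_le_pow_right₀ h1 (by omega)
  have h3 : (1 + ‖p‖) ^ k' ≤ (1 + ‖p‖) ^ (k + k') := pow_le_pow_right₀ h1 (by omega)
  calc ‖f x p + f' x p‖ ≤ ‖f x p‖ + ‖f' x p‖ := norm_add_le _ _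
    _ ≤ |C| * (1 + ‖p‖) ^ k + |C'| * (1 + ‖p‖) ^ k' := by
        refine add_le_add ((h x p hx).trans ?_) ((h' x p hx).trans ?_) <;>
        · gcongr; exact le_abs_self _
    _ ≤ _ := by rw [add_mul]; gcongr

lemma HasPolyGrowth.mul {f f' : R4 → R4 → ℂ} (hf : HasPolyGrowth f) (hf' : HasPolyGrowth f') :
    HasPolyGrowth fun x p => f x p * f' x p := fun R => by
  obtain ⟨C, k, h⟩ := hf R
  obtain ⟨C', k', h'⟩ := hf' R
  refine ⟨C * C', k + k', fun x p hx => ?_⟩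
  rw [norm_mul, pow_add, mul_mul_mul_comm]
  exact mul_le_mul (h x p hx) (h' x p hx) (norm_nonneg _) ((norm_nonneg _).trans (h x p hx))

lemma HasPolyGrowth.of_continuous {f : R4 → ℂ} (hf : Continuous f) :
    HasPolyGrowth fun x _ => f x := fun R => by
  obtain ⟨C, hC⟩ := (isCompact_closedBall (0 : R4) R).exists_bound_of_continuousOn hf.continuousOn
  exact ⟨C, 0, fun x p hx => by simpa using hC x (by simpa using hx)⟩

lemma HasPolyGrowth.sum {ι : Type*} {S : Finset ι} {f : ι → R4 → R4 → ℂ}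
    (hf : ∀ i ∈ S, HasPolyGrowth (f i)) : HasPolyGrowth fun x p => ∑ i ∈ S, f i x p := by
  classical
  induction S using Finset.induction_on with
  | empty => simpa using HasPolyGrowth.of_continuous continuous_const
  | insert i S hi ih =>
    simp only [Finset.sum_insert hi]
    exact (hf i (Finset.mem_insert_self _ _)).add
      (ih fun j hj => hf j (Finset.mem_insert_of_mem hj))

lemma HasPolyGrowth.pow {f : R4 → R4 → ℂ} (hf : HasPolyGrowth f) (n : ℕ) :
    HasPolyGrowth fun x p => f x p ^ n := by
  induction n with
  | zero => simpa using HasPolyGrowth.of_continuous continuous_const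
  | succ n ih => simp only [pow_succ]; exact ih.mul hf

lemma hasPolyGrowth_lineSymbol (a b : R4) : HasPolyGrowth (lineSymbol a b) := fun R => by
  refine ⟨‖a‖ * R + ‖b‖, 1, fun x p hx => (norm_lineSymbol_le a b x p).trans ?_⟩
  rw [pow_one]
  have h := (abs_real_inner_le_norm a x).trans (mul_le_mul_of_nonneg_left hx (norm_nonneg a))
  gcongr

end Growth

/-! ### Powers of a·x + b·D as derivatives of the flow under a trace. -/

section LineTrace

variable {s g n : Type*} [Fintype s] [DecidableEq s] [Fintype g] [DecidableEq g] [Fintype n]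
  {A : Fin 4 → R4 → Matrix g g ℂ}

lemma MatHasDerivAt.trace {F : ℝ → Matrix n n ℂ} {F' : Matrix n n ℂ} {t : ℝ}
    (hF : MatHasDerivAt F F' t) : HasDerivAt (fun t => (F t).trace) F'.trace t :=
  HasDerivAt.fun_sum fun i _ => hF i i

lemma iteratedDeriv_trace_mul_lineFlow (hA : ∀ μ, SmoothMat (A μ)) (a b x : R4)
    (B : Matrix n (s × g) ℂ) (N : ℕ) : ∀ (F : smoothMats (s × g) n) (t : ℝ),
      iteratedDeriv N (fun t : ℝ => (B * lineFlow A a b F.1 x t).trace) t =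
        (B * lineFlow A a b (((lineEnd hA a b) ^ N) F).1 x t).trace := by
  induction N with
  | zero => intro F t; simp
  | succ N ih =>
    intro F t
    rw [iteratedDeriv_succ', pow_succ, Module.End.mul_apply, ← ih (lineEnd hA a b F) t]
    congr 1
    funext t
    have := ((matHasDerivAt_const B t).mul (lineFlow_hasDerivAt hA a b F x t)).trace
    rw [Matrix.zero_mul, zero_add] at this
    exact this.deriv

end LineTrace

/-! ### Supports and smoothness of dressed test kernels. -/

section Kernels

variable {s g : Type*} [Fintype s] [DecidableEq s] [Fintype g] [DecidableEq g]
  {A : Fin 4 → R4 → Matrix g g ℂ} {K : R4 → R4 → Matrix (s × g) (s × g) ℂ}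

lemma IsTestKernel.matContDiff (hK : IsTestKernel K) :
    MatContDiff ∞ fun z : R4 × R4 => K z.1 z.2 := fun i j => (hK i j).1

lemma IsTestKernel.exists_radius (hK : IsTestKernel K) :
    ∃ R : ℝ, ∀ z w, R < ‖z‖ ∨ R < ‖w‖ → K z w = 0 := by
  have h : ∀ q : (s × g) × (s × g), ∃ R : ℝ, ∀ z : R4 × R4, K z.1 z.2 q.1 q.2 ≠ 0 → ‖z‖ ≤ R :=
    fun q => by
      obtain ⟨R, hR⟩ := (hK q.1 q.2).2.isBounded.exists_norm_le
      exact ⟨R, fun z hz => hR z (subset_tsupport _ hz)⟩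
  choose R hR using h
  refine ⟨∑ q, |R q|, fun z w hzw => ?_⟩
  ext i j
  by_contra hne
  have h1 := (hR (i, j) (z, w) hne).trans ((le_abs_self _).trans
    (Finset.single_le_sum (f := fun q => |R q|) (fun _ _ => abs_nonneg _)
      (Finset.mem_univ (i, j))))
  have h2 := norm_fst_le (z, w)
  have h3 := norm_snd_le (z, w)
  rcases hzw with h | h
  · exact absurd (h2.trans h1) (not_le.2 h)
  · exact absurd (h3.trans h1) (not_le.2 h)

lemma matContDiff_dressed (hA : ∀ μ, SmoothMat (A μ)) (hK : IsTestKernel K) {E : Type*}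
    [NormedAddCommGroup E] [NormedSpace ℝ E] {x y : E → R4} (hx : ContDiff ℝ ∞ x)
    (hy : ContDiff ℝ ∞ y) : MatContDiff ∞ fun z => dressed A K (x z) (y z) :=
  ((matContDiff_one_kronecker (matContDiff_wilson hA (by fun_prop) (by fun_prop))).mul
    (MatContDiff.comp hK.matContDiff (f := fun z =>
      (x z - (1 / 2 : ℝ) • y z, x z + (1 / 2 : ℝ) • y z)) (by fun_prop))).mul
    (matContDiff_one_kronecker (matContDiff_wilson hA (by fun_prop) (by fun_prop)))

lemma hasCompactSupport_dressed (hK : IsTestKernel K) (x : R4) (i j : s × g) :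
    HasCompactSupport fun y => dressed A K x y i j := by
  obtain ⟨R, hR⟩ := hK.exists_radius
  refine HasCompactSupport.intro (isCompact_closedBall 0 (2 * R)) fun y hy => ?_
  have hy' : 2 * R < ‖y‖ := by simpa using hy
  have h1 : y = (x + (1 / 2 : ℝ) • y) - (x - (1 / 2 : ℝ) • y) := by module
  have h2 := norm_sub_le (x + (1 / 2 : ℝ) • y) (x - (1 / 2 : ℝ) • y)
  rw [← h1] at h2
  have h3 : K (x - (1 / 2 : ℝ) • y) (x + (1 / 2 : ℝ) • y) = 0 := by
    refine hR _ _ ?_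
    by_contra hcon
    push Not at hcon
    linarith
  change dressed A K x y i j = 0
  rw [dressed, h3, Matrix.mul_zero, Matrix.zero_mul, Matrix.zero_apply]

end Kernels

/-! ### The varied flow trace about the midpoint. -/

section ShiftedTrace

variable {s g : Type*} [Fintype s] [DecidableEq s] [Fintype g] [DecidableEq g]
  {A : Fin 4 → R4 → Matrix g g ℂ} {α : R4 → Matrix g g ℂ}
  {K : R4 → R4 → Matrix (s × g) (s × g) ℂ}

/-- The trace, with the flow of `a · x + b · D` in place of its power, in the variation of
`Tr ((M ⊗ 1) (a · x + b · D)^N K̂)`. -/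
def flowTrace (A : Fin 4 → R4 → Matrix g g ℂ) (γ5 M : Matrix s s ℂ) (a b : R4)
    (α : R4 → Matrix g g ℂ) (K : R4 → R4 → Matrix (s × g) (s × g) ℂ) (z : ℝ × R4) : ℂ :=
  (axialGen γ5 α z.2 * (M ⊗ₖ (1 : Matrix g g ℂ)) *
    lineFlow A a b (fun w => K w z.2) z.2 z.1).trace +
  ((M ⊗ₖ (1 : Matrix g g ℂ)) *
    lineFlow A a b (fun w => axialGen γ5 α w * K w z.2) z.2 z.1).trace

/-- The matrix multiplying the dressed kernel in the trace of the flow about the midpoint. -/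
def midGen (A : Fin 4 → R4 → Matrix g g ℂ) (γ5 M : Matrix s s ℂ) (b : R4)
    (α : R4 → Matrix g g ℂ) (x : R4) (t : ℝ) : Matrix (s × g) (s × g) ℂ :=
  Complex.I • ((γ5 * M) ⊗ₖ transport A α x ((-(1 / 2) * t) • b) +
    (M * γ5) ⊗ₖ transport A α x ((1 / 2 * t) • b))

lemma contDiff_flowTrace (hA : ∀ μ, SmoothMat (A μ)) (γ5 M : Matrix s s ℂ) (a b : R4)
    (hα : SmoothMat α) (hK : IsTestKernel K) : ContDiff ℝ ∞ (flowTrace A γ5 M a b α K) := by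
  have hexp : ContDiff ℝ ∞ fun z : ℝ × R4 =>
      Complex.exp (((z.1 * inner ℝ a z.2 + z.1 ^ 2 / 2 * inner ℝ a b : ℝ)) : ℂ) := by
    refine ContDiff.cexp (Complex.ofRealCLM.contDiff.comp ?_)
    exact (contDiff_fst.mul (contDiff_const.inner ℝ contDiff_snd)).add
      (((contDiff_fst.pow 2).div_const 2).mul contDiff_const)
  have hW : MatContDiff ∞ fun z : ℝ × R4 =>
      (1 : Matrix s s ℂ) ⊗ₖ wilson A z.2 (z.2 + z.1 • b) :=
    matContDiff_one_kronecker (matContDiff_wilson hA (by fun_prop) (by fun_prop))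
  have hK' : MatContDiff ∞ fun z : ℝ × R4 => K (z.2 + z.1 • b) z.2 :=
    MatContDiff.comp hK.matContDiff (f := fun z : ℝ × R4 => (z.2 + z.1 • b, z.2)) (by fun_prop)
  refine ContDiff.add (MatContDiff.trace ?_) (MatContDiff.trace ?_)
  · exact (MatContDiff.mul (MatContDiff.comp (smoothMat_axialGen γ5 hα) contDiff_snd)
      (matContDiff_const _)).mul (MatContDiff.smul hexp (hW.mul hK'))
  · exact (matContDiff_const _).mul (MatContDiff.smul hexp (hW.mul (MatContDiff.mul
      (MatContDiff.comp (smoothMat_axialGen γ5 hα)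
        (f := fun z : ℝ × R4 => z.2 + z.1 • b) (by fun_prop)) hK')))

lemma flowTrace_eq_zero (γ5 M : Matrix s s ℂ) (a b : R4) {t : ℝ} {x : R4}
    (h : K (x + t • b) x = 0) : flowTrace A γ5 M a b α K (t, x) = 0 := by
  simp only [flowTrace, lineFlow, h, Matrix.mul_zero, smul_zero, Matrix.trace_zero, add_zero]

/-- With x as midpoint the kernel arguments are x ± tb/2, that is y = -tb. The shift cancels the
quadratic term of the phase, which is what Weyl ordering requires. The Wilson line between the end
points splits at x, so that by cyclicity α at either end becomes its transport to x. -/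
lemma flowTrace_shift (hA : ∀ μ, SmoothMat (A μ)) (γ5 M : Matrix s s ℂ) (a b x : R4) (t : ℝ) :
    flowTrace A γ5 M a b α K (t, x - (t / 2) • b) =
      Complex.exp ((t : ℂ) * ((inner ℝ a x : ℝ) : ℂ)) *
        (midGen A γ5 M b α x t * dressed A K x (-(t • b))).trace := by
  set xm : R4 := x + (-(1 / 2) * t) • b with hxm
  set xp : R4 := x + (1 / 2 * t) • b with hxp
  have e1 : x - (t / 2) • b = xm := by rw [hxm]; module
  have e2 : xm + t • b = xp := by rw [hxm, hxp]; module
  have e3 : x - (1 / 2 : ℝ) • -(t • b) = xp := by rw [hxp]; module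
  have e4 : x + (1 / 2 : ℝ) • -(t • b) = xm := by rw [hxm]; module
  have e5 : t * inner ℝ a xm + t ^ 2 / 2 * inner ℝ a b = t * inner ℝ a x := by
    rw [hxm, inner_add_right, inner_smul_right]; ring
  have e6 : wilson A xm xp = wilson A xm x * wilson A x xp :=
    (wilson_mul_wilson_of_collinear hA x b (1 / 2 * t) (-(1 / 2) * t)).symm
  have i1 := wilson_mul_wilson_inv hA xp x
  have i2 := wilson_mul_wilson_inv hA x xm
  have i3 := wilson_mul_wilson_inv hA x xp
  rw [e1]
  simp only [flowTrace, midGen, lineFlow, dressed, transport, e2, e3, e4, e5, ← hxm, ← hxp]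
  rw [Complex.ofReal_mul, Matrix.mul_smul, Matrix.mul_smul, Matrix.trace_smul, Matrix.trace_smul,
    smul_eq_mul, smul_eq_mul, ← mul_add, Matrix.smul_mul, Matrix.trace_smul, Matrix.add_mul,
    Matrix.trace_add]
  congr 1
  have hk : ∀ (M₁ M₂ : Matrix s s ℂ) (W₁ W₂ : Matrix g g ℂ),
      (M₁ ⊗ₖ W₁) * (M₂ ⊗ₖ W₂) = (M₁ * M₂) ⊗ₖ (W₁ * W₂) := fun M₁ M₂ W₁ W₂ =>
    (Matrix.mul_kronecker_mul M₁ M₂ W₁ W₂).symm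
  have c1 : ∀ C : Matrix (s × g) (s × g) ℂ, ∀ W₁ W₂ W₃ : Matrix g g ℂ, ∀ L : Matrix s s ℂ,
      ((L ⊗ₖ W₁) * (((1 : Matrix s s ℂ) ⊗ₖ W₂) * C * ((1 : Matrix s s ℂ) ⊗ₖ W₃))).trace =
      ((L ⊗ₖ (W₃ * W₁ * W₂)) * C).trace := fun C W₁ W₂ W₃ L => by
    rw [← Matrix.mul_assoc, Matrix.trace_mul_comm, ← Matrix.mul_assoc, ← Matrix.mul_assoc, hk, hk,
      Matrix.one_mul, Matrix.mul_one]
  rw [c1, c1, smul_add, smul_eq_mul, smul_eq_mul]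
  -- α at xm stands to the left of the Wilson line and goes with γ⁵M; α at xp stands to its right
  -- and goes with Mγ⁵.
  have j1 : wilson A xm x * (wilson A x xm * α xm * wilson A xm x) * wilson A x xp =
      α xm * wilson A xm xp := by
    rw [e6, ← Matrix.mul_assoc, ← Matrix.mul_assoc, wilson_mul_wilson_inv hA, Matrix.one_mul,
      Matrix.mul_assoc]
  have j2 : wilson A xm x * (wilson A x xp * α xp * wilson A xp x) * wilson A x xp =
      wilson A xm xp * α xp := by
    rw [e6, Matrix.mul_assoc, Matrix.mul_assoc, i1, Matrix.mul_one, Matrix.mul_assoc]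
  rw [j1, j2]
  simp only [axialGen, Matrix.smul_mul, Matrix.mul_smul, Matrix.trace_smul, smul_eq_mul,
    ← Matrix.mul_assoc, hk, Matrix.mul_one, Matrix.one_mul]

end ShiftedTrace

/-! ### The Leibniz rule for a scalar times a trace. -/

section Leibniz

variable {m : Type*} [Fintype m]

lemma iteratedDeriv_mul_trace {c : ℝ → ℂ} {Y D : ℝ → Matrix m m ℂ} (hc : ContDiff ℝ ∞ c)
    (hY : MatContDiff ∞ Y) (hD : MatContDiff ∞ D) (N : ℕ) (t : ℝ) :
    iteratedDeriv N (fun t => c t * (Y t * D t).trace) t =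
      ∑ l ∈ Finset.range (N + 1), (N.choose l : ℂ) * ∑ i, ∑ j,
        iteratedDeriv l (fun t => Y t i j) t *
          iteratedDeriv (N - l) (fun t => c t * D t j i) t := by
  have e : (fun t => c t * (Y t * D t).trace) =
      fun t => ∑ i, ∑ j, Y t i j * (c t * D t j i) := by
    funext t
    simp only [Matrix.trace, Matrix.diag, Matrix.mul_apply, Finset.mul_sum]
    exact Finset.sum_congr rfl fun i _ => Finset.sum_congr rfl fun j _ => by ring
  have hs : ∀ {f : ℝ → ℂ}, ContDiff ℝ ∞ f → ContDiffAt ℝ N f t := fun hf =>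
    (hf.of_le (by exact_mod_cast le_top)).contDiffAt
  have hp : ∀ i j, ContDiff ℝ ∞ fun t => Y t i j * (c t * D t j i) := fun i j =>
    (hY i j).mul (hc.mul (hD j i))
  rw [e, iteratedDeriv_fun_sum fun i _ => hs (ContDiff.sum fun j _ => hp i j)]
  simp only [Finset.mul_sum]
  rw [Finset.sum_comm]
  refine Finset.sum_congr rfl fun i _ => ?_
  rw [iteratedDeriv_fun_sum fun j _ => hs (hp i j), Finset.sum_comm]
  refine Finset.sum_congr rfl fun j _ => ?_
  rw [iteratedDeriv_fun_mul (hs (hY i j)) (hs (hc.mul (hD j i)))]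
  exact Finset.sum_congr rfl fun l _ => by ring

end Leibniz

/-! ### The Weyl symbol of the axial variation. -/

section AxialSymbol

variable {s g : Type*} [Fintype s] [DecidableEq s] [Fintype g] [DecidableEq g]
  {A : Fin 4 → R4 → Matrix g g ℂ} {α : R4 → Matrix g g ℂ}
  {K : R4 → R4 → Matrix (s × g) (s × g) ℂ}

/-- The matrix coefficient of the `l`-th covariant derivative of `α` in the symbol of the
variation of `(M ⊗ 1) (a · x + b · D)^N`. -/
def axialTerm (A : Fin 4 → R4 → Matrix g g ℂ) (γ5 M : Matrix s s ℂ) (b : R4)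
    (α : R4 → Matrix g g ℂ) (l : ℕ) (x : R4) : Matrix (s × g) (s × g) ℂ :=
  (Complex.I • ((-(1 / 2) : ℂ) ^ l • (γ5 * M) + (1 / 2 : ℂ) ^ l • (M * γ5))) ⊗ₖ
    ((covDir A b)^[l] α x)

/-- The Weyl symbol of the variation of `(M ⊗ 1) (a · x + b · D)^N`. -/
def axialLineSymbol (A : Fin 4 → R4 → Matrix g g ℂ) (γ5 M : Matrix s s ℂ) (N : ℕ) (a b : R4)
    (α : R4 → Matrix g g ℂ) (x p : R4) : Matrix (s × g) (s × g) ℂ :=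
  ∑ l ∈ Finset.range (N + 1),
    ((N.choose l : ℂ) * lineSymbol a b x p ^ (N - l)) • axialTerm A γ5 M b α l x

lemma smoothMat_axialTerm (hA : ∀ μ, SmoothMat (A μ)) (γ5 M : Matrix s s ℂ) (b : R4)
    (hα : SmoothMat α) (l : ℕ) : SmoothMat (axialTerm A γ5 M b α l) :=
  MatContDiff.kronecker (matContDiff_const _) (smoothMat_covDir_iterate hA hα b l)

lemma continuous_axialLineSymbol (hA : ∀ μ, SmoothMat (A μ)) (γ5 M : Matrix s s ℂ) (N : ℕ)
    (a b : R4) (hα : SmoothMat α) (i j : s × g) :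
    Continuous fun z : R4 × R4 => axialLineSymbol A γ5 M N a b α z.1 z.2 i j := by
  have h : Continuous fun z : R4 × R4 => lineSymbol a b z.1 z.2 := by
    unfold lineSymbol; fun_prop
  simp only [axialLineSymbol, Matrix.sum_apply, Matrix.smul_apply, smul_eq_mul]
  refine continuous_finsetSum _ fun l _ => ?_
  have h2 := (smoothMat_axialTerm hA γ5 M b hα l i j).continuous.comp
    (continuous_fst (X := R4) (Y := R4))
  exact (continuous_const.mul (h.pow _)).mul h2

lemma hasPolyGrowth_axialLineSymbol (hA : ∀ μ, SmoothMat (A μ)) (γ5 M : Matrix s s ℂ) (N : ℕ)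
    (a b : R4) (hα : SmoothMat α) (i j : s × g) :
    HasPolyGrowth fun x p => axialLineSymbol A γ5 M N a b α x p i j := by
  simp only [axialLineSymbol, Matrix.sum_apply, Matrix.smul_apply, smul_eq_mul]
  exact HasPolyGrowth.sum fun l _ => ((HasPolyGrowth.of_continuous continuous_const).mul
    ((hasPolyGrowth_lineSymbol a b).pow _)).mul
      (HasPolyGrowth.of_continuous (smoothMat_axialTerm hA γ5 M b hα l i j).continuous)

lemma matContDiff_midGen (hA : ∀ μ, SmoothMat (A μ)) (γ5 M : Matrix s s ℂ) (b : R4)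
    (hα : SmoothMat α) {E : Type*} [NormedAddCommGroup E] [NormedSpace ℝ E] {x : E → R4}
    {t : E → ℝ} (hx : ContDiff ℝ ∞ x) (ht : ContDiff ℝ ∞ t) :
    MatContDiff ∞ fun z => midGen A γ5 M b α (x z) (t z) :=
  MatContDiff.const_smul _ (MatContDiff.add
    ((matContDiff_const _).kronecker (matContDiff_transport hA hα hx (by fun_prop)))
    ((matContDiff_const _).kronecker (matContDiff_transport hA hα hx (by fun_prop))))

/-- The factors (∓1/2)^l come from the half steps ∓t/2 by the chain rule. -/
lemma iteratedDeriv_midGen (hA : ∀ μ, SmoothMat (A μ)) (γ5 M : Matrix s s ℂ) (b x : R4)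
    (hα : SmoothMat α) (l : ℕ) (i j : s × g) :
    iteratedDeriv l (fun t => midGen A γ5 M b α x t i j) 0 = axialTerm A γ5 M b α l x i j := by
  have hs : ∀ c : ℝ, ContDiff ℝ l fun t : ℝ => transport A α x ((c * t) • b) i.2 j.2 := fun c =>
    (matContDiff_transport hA hα contDiff_const (v := fun t : ℝ => (c * t) • b)
      (by fun_prop) i.2 j.2).of_le (by exact_mod_cast le_top)
  have hd : ∀ c : ℝ, iteratedDeriv l (fun t : ℝ => transport A α x ((c * t) • b) i.2 j.2) 0 =
      (c : ℂ) ^ l * ((covDir A b)^[l] α x) i.2 j.2 := fun c => by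
    have h0 : ContDiff ℝ l fun t : ℝ => transport A α x (t • b) i.2 j.2 := by
      simpa using hs 1
    have h1 := congrFun (iteratedDeriv_comp_const_smul h0 c) 0
    rw [mul_zero, iteratedDeriv_transport hA b x i.2 j.2 l hα, zero_smul, transport_zero,
      Complex.real_smul, Complex.ofReal_pow] at h1
    exact h1
  have e : (fun t => midGen A γ5 M b α x t i j) = fun t =>
      Complex.I * (γ5 * M) i.1 j.1 * transport A α x ((-(1 / 2) * t) • b) i.2 j.2 +
      Complex.I * (M * γ5) i.1 j.1 * transport A α x ((1 / 2 * t) • b) i.2 j.2 := by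
    funext t
    simp only [midGen, Matrix.smul_apply, Matrix.add_apply, Matrix.kroneckerMap_apply, smul_eq_mul]
    ring
  rw [e, iteratedDeriv_fun_add ((contDiff_const.mul (hs _)).contDiffAt)
    ((contDiff_const.mul (hs _)).contDiffAt), iteratedDeriv_const_mul _ (hs _).contDiffAt,
    iteratedDeriv_const_mul _ (hs _).contDiffAt, hd, hd]
  simp only [axialTerm, Matrix.smul_apply, Matrix.add_apply, Matrix.kroneckerMap_apply, smul_eq_mul]
  push_cast
  ring

lemma integrable_polyGrowth_mul_wigner (hA : ∀ μ, SmoothMat (A μ)) (hK : IsTestKernel K)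
    {f : R4 → R4 → ℂ} (hf : HasPolyGrowth f) (x : R4) (hc : Continuous (f x)) (i j : s × g) :
    Integrable fun p => f x p * wigner A K x p i j := by
  obtain ⟨C, k, hC⟩ := hf ‖x‖
  exact integrable_mul_fourierInt (matContDiff_dressed hA hK contDiff_const contDiff_id i j)
    (hasCompactSupport_dressed hK x i j) hc fun p => hC x p le_rfl

lemma continuous_axialLineSymbol_right (hA : ∀ μ, SmoothMat (A μ)) (γ5 M : Matrix s s ℂ) (N : ℕ)
    (a b : R4) (hα : SmoothMat α) (x : R4) (i j : s × g) :
    Continuous fun p => axialLineSymbol A γ5 M N a b α x p i j :=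
  (continuous_axialLineSymbol hA γ5 M N a b hα i j).comp
    (f := fun p : R4 => (x, p)) (by fun_prop)

lemma integrable_trace_axialLineSymbol_mul_wigner (hA : ∀ μ, SmoothMat (A μ))
    (hK : IsTestKernel K) (γ5 M : Matrix s s ℂ) (N : ℕ) (a b : R4) (hα : SmoothMat α) (x : R4) :
    Integrable fun p => (axialLineSymbol A γ5 M N a b α x p * wigner A K x p).trace := by
  simp only [Matrix.trace, Matrix.diag, Matrix.mul_apply]
  exact integrable_finsetSum _ fun i _ => integrable_finsetSum _ fun j _ =>
    integrable_polyGrowth_mul_wigner hA hK (hasPolyGrowth_axialLineSymbol hA γ5 M N a b hα i j) x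
      (continuous_axialLineSymbol_right hA γ5 M N a b hα x i j) j i

/-- In the Leibniz rule, l derivatives of `midGen` give (b·𝒟)^l α, and the other N - l, acting on
the phase times the dressed kernel, give ℓ^{N-l} by Fourier inversion. -/
lemma iteratedDeriv_flowTrace_shift (hA : ∀ μ, SmoothMat (A μ)) (hK : IsTestKernel K)
    (γ5 M : Matrix s s ℂ) (N : ℕ) (a b : R4) (hα : SmoothMat α) (x : R4) :
    iteratedDeriv N (fun t => flowTrace A γ5 M a b α K (t, x - (t / 2) • b)) 0 =
      phaseNorm * ∫ p, (axialLineSymbol A γ5 M N a b α x p * wigner A K x p).trace := by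
  have hc : ContDiff ℝ ∞ fun t : ℝ => Complex.exp ((t : ℂ) * ((inner ℝ a x : ℝ) : ℂ)) :=
    (Complex.ofRealCLM.contDiff.mul contDiff_const).cexp
  have hY := matContDiff_midGen hA γ5 M b hα (x := fun _ : ℝ => x) (t := fun t => t)
    contDiff_const contDiff_id
  have hD := matContDiff_dressed hA hK (x := fun _ : ℝ => x) (y := fun t => -(t • b))
    contDiff_const (by fun_prop)
  simp only [flowTrace_shift hA]
  rw [iteratedDeriv_mul_trace hc hY hD]
  have hterm : ∀ (l : ℕ) (i j : s × g), iteratedDeriv (N - l) (fun t : ℝ =>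
      Complex.exp ((t : ℂ) * ((inner ℝ a x : ℝ) : ℂ)) * dressed A K x (-(t • b)) j i) 0 =
      phaseNorm * ∫ p, lineSymbol a b x p ^ (N - l) * wigner A K x p j i := fun l i j => by
    have := iteratedDeriv_exp_mul_comp_line
      (matContDiff_dressed hA hK (x := fun _ => x) contDiff_const contDiff_id j i)
      (hasCompactSupport_dressed hK x j i) a b x (N - l) 0
    simp only [Complex.ofReal_zero, zero_mul, Complex.exp_zero, one_mul] at this
    exact this
  have hint : ∀ (l : ℕ) (i j : s × g),
      Integrable fun p => lineSymbol a b x p ^ (N - l) * wigner A K x p j i := fun l i j =>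
    integrable_polyGrowth_mul_wigner hA hK ((hasPolyGrowth_lineSymbol a b).pow (N - l)) x
      ((by unfold lineSymbol; fun_prop : Continuous (lineSymbol a b x)).pow _) j i
  have e : ∀ p, (axialLineSymbol A γ5 M N a b α x p * wigner A K x p).trace =
      ∑ l ∈ Finset.range (N + 1), ∑ i, ∑ j, ((N.choose l : ℂ) * axialTerm A γ5 M b α l x i j) *
        (lineSymbol a b x p ^ (N - l) * wigner A K x p j i) := fun p => by
    rw [axialLineSymbol, Matrix.sum_mul, Matrix.trace_sum]
    refine Finset.sum_congr rfl fun l _ => ?_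
    rw [Matrix.smul_mul, Matrix.trace_smul, smul_eq_mul]
    simp only [Matrix.trace, Matrix.diag, Matrix.mul_apply, Finset.mul_sum]
    exact Finset.sum_congr rfl fun i _ => Finset.sum_congr rfl fun j _ => by ring
  simp only [e, hterm, iteratedDeriv_midGen hA γ5 M b x hα]
  rw [integral_finsetSum _ fun l _ => integrable_finsetSum _ fun i _ =>
    integrable_finsetSum _ fun j _ => (hint l i j).const_mul _, Finset.mul_sum]
  refine Finset.sum_congr rfl fun l _ => ?_
  rw [integral_finsetSum _ fun i _ => integrable_finsetSum _ fun j _ => (hint l i j).const_mul _,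
    Finset.mul_sum, Finset.mul_sum]
  refine Finset.sum_congr rfl fun i _ => ?_
  rw [integral_finsetSum _ fun j _ => (hint l i j).const_mul _, Finset.mul_sum, Finset.mul_sum]
  refine Finset.sum_congr rfl fun j _ => ?_
  rw [integral_const_mul]
  ring

/-- Translating the integration variable by an amount depending on the parameter. -/
lemma integral_iteratedDeriv_shift {Ψ : ℝ × R4 → ℂ} (hΨ : ContDiff ℝ ∞ Ψ) (b : R4) {R : ℝ}
    (h0 : ∀ t x, R < ‖x‖ → Ψ (t, x) = 0)
    (h1 : ∀ t x, R < ‖x‖ → Ψ (t, x - (t / 2) • b) = 0) (N : ℕ) :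
    Integrable (fun x => iteratedDeriv N (fun t => Ψ (t, x)) 0) ∧
    Integrable (fun x => iteratedDeriv N (fun t => Ψ (t, x - (t / 2) • b)) 0) ∧
    ∫ x, iteratedDeriv N (fun t => Ψ (t, x)) 0 =
      ∫ x, iteratedDeriv N (fun t => Ψ (t, x - (t / 2) • b)) 0 := by
  obtain ⟨Φ, a1, a2, a3, a4⟩ := exists_iteratedDeriv_integral N hΨ h0
  obtain ⟨Φ', b1, b2, b3, b4⟩ := exists_iteratedDeriv_integral N
    (Ψ := fun z : ℝ × R4 => Ψ (z.1, z.2 - (z.1 / 2) • b))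
    (hΨ.comp (f := fun z : ℝ × R4 => (z.1, z.2 - (z.1 / 2) • b)) (by fun_prop)) h1
  simp only [a3]
  have b3' : ∀ x, iteratedDeriv N (fun t => Ψ (t, x - (t / 2) • b)) 0 = Φ' (0, x) :=
    fun x => b3 0 x
  simp only [b3']
  refine ⟨integrable_of_continuous_of_norm_lt (a1.continuous.comp (by fun_prop)) (a2 0),
    integrable_of_continuous_of_norm_lt (b1.continuous.comp (by fun_prop)) (b2 0), ?_⟩
  -- The two integrands need not agree pointwise. The derivatives are moved outside, where
  -- translation invariance equates the integrals for each t.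
  rw [← a4, ← b4]
  congr 1
  funext t
  exact (integral_sub_right_eq_self (fun x => Ψ (t, x)) ((t / 2) • b)).symm

/-- The generalized Weyl symbol of the variation of the operator in the action. -/
lemma isWeylSymbol_axialVariation (hA : ∀ μ, SmoothMat (A μ)) (Q : SymPoly s) (γ5 : Matrix s s ℂ)
    (hα : SmoothMat α) {ι : Type} [Fintype ι] {M : ι → Matrix s s ℂ} {N : ι → ℕ} {a b : ι → R4}
    (hQ : ∀ (F : smoothMats (s × g) (s × g)) (j : s × g) (x : R4) (i : s × g),
        Q.op A (fun z k => F.1 z k j) x i = (∑ q, (M q ⊗ₖ (1 : Matrix g g ℂ)) *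
          (((lineEnd hA (a q) (b q)) ^ N q) F).1 x) i j) :
    IsWeylSymbol A (axialVariation Q A γ5 α)
      (fun x p => ∑ q, axialLineSymbol A γ5 (M q) (N q) (a q) (b q) α x p) where
  continuous i j := by
    simp only [Matrix.sum_apply]
    exact continuous_finsetSum _ fun q _ => continuous_axialLineSymbol hA γ5 _ _ _ _ hα i j
  growth R := by
    have h : ∀ i j : s × g, HasPolyGrowth fun x p =>
        (∑ q, axialLineSymbol A γ5 (M q) (N q) (a q) (b q) α x p) i j := fun i j => by
      simp only [Matrix.sum_apply]
      exact HasPolyGrowth.sum fun q _ => hasPolyGrowth_axialLineSymbol hA γ5 _ _ _ _ hα i j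
    choose C k hC using fun q : (s × g) × (s × g) => h q.1 q.2 R
    refine ⟨∑ q, |C q|, ∑ q, k q, fun x p hx i j => (hC (i, j) x p hx).trans ?_⟩
    have h1 : (1 : ℝ) ≤ 1 + ‖p‖ := by linarith [norm_nonneg p]
    have h2 : C (i, j) ≤ ∑ q, |C q| := (le_abs_self _).trans
      (Finset.single_le_sum (f := fun q => |C q|) (fun _ _ => abs_nonneg _) (Finset.mem_univ _))
    have h3 : k (i, j) ≤ ∑ q, k q :=
      Finset.single_le_sum (f := k) (fun _ _ => Nat.zero_le _) (Finset.mem_univ _)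
    exact mul_le_mul h2 (pow_le_pow_right₀ h1 h3) (by positivity)
      (Finset.sum_nonneg fun _ _ => abs_nonneg _)
  pairing K hK := by
    obtain ⟨R, hR⟩ := hK.exists_radius
    have hcol : ∀ x, SmoothMat fun w => K w x := fun x =>
      MatContDiff.comp hK.matContDiff (f := fun w : R4 => (w, x)) (by fun_prop)
    have h0 : ∀ q t x, R < ‖x‖ → flowTrace A γ5 (M q) (a q) (b q) α K (t, x) = 0 :=
      fun q t x hx => flowTrace_eq_zero γ5 _ _ _ (hR _ _ (Or.inr hx))
    have h1 : ∀ q t x, R < ‖x‖ →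
        flowTrace A γ5 (M q) (a q) (b q) α K (t, x - (t / 2) • b q) = 0 := fun q t x hx => by
      refine flowTrace_eq_zero γ5 _ _ _ (hR _ _ ?_)
      by_contra hcon
      push Not at hcon
      -- x is the midpoint of the two kernel arguments, so if both lie in the ball of radius R then
      -- so does x.
      have e : (2 : ℝ) • x = (x - (t / 2) • b q + t • b q) + (x - (t / 2) • b q) := by module
      have e2 := norm_add_le (x - (t / 2) • b q + t • b q) (x - (t / 2) • b q)
      rw [← e, norm_smul, Real.norm_ofNat] at e2
      linarith
    have hs := fun q => integral_iteratedDeriv_shift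
      (contDiff_flowTrace hA γ5 (M q) (a q) (b q) hα hK) (b q) (h0 q) (h1 q) (N q)
    -- Each column of K in its first argument is a smooth function, and the power of the line
    -- operator on it is the N-th derivative of its flow at t = 0.
    have hL : ∀ x, (applyKernel (axialVariation Q A γ5 α) K x x).trace =
        ∑ q, iteratedDeriv (N q)
          (fun t => flowTrace A γ5 (M q) (a q) (b q) α K (t, x)) 0 := fun x => by
      let F : smoothMats (s × g) (s × g) := ⟨fun w => K w x, hcol x⟩
      have e1 : applyKernel (axialVariation Q A γ5 α) K x x =
          axialGen γ5 α x * (∑ q, (M q ⊗ₖ (1 : Matrix g g ℂ)) *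
            (((lineEnd hA (a q) (b q)) ^ N q) F).1 x) +
          ∑ q, (M q ⊗ₖ (1 : Matrix g g ℂ)) *
            (((lineEnd hA (a q) (b q)) ^ N q) (smoothMul (smoothMat_axialGen γ5 hα) F)).1 x := by
        ext i j
        exact axialVariation_column hA Q γ5 hα hQ F j x i
      rw [e1, Matrix.mul_sum, Matrix.trace_add, Matrix.trace_sum, Matrix.trace_sum,
        ← Finset.sum_add_distrib]
      refine Finset.sum_congr rfl fun q _ => ?_
      have d1 := iteratedDeriv_trace_mul_lineFlow hA (a q) (b q) x
        (axialGen γ5 α x * (M q ⊗ₖ (1 : Matrix g g ℂ))) (N q) F 0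
      have d2 := iteratedDeriv_trace_mul_lineFlow hA (a q) (b q) x
        (M q ⊗ₖ (1 : Matrix g g ℂ)) (N q) (smoothMul (smoothMat_axialGen γ5 hα) F) 0
      rw [lineFlow_zero] at d1 d2
      rw [← Matrix.mul_assoc, ← d1, ← d2]
      have c : ∀ (B : Matrix (s × g) (s × g) ℂ) (F : smoothMats (s × g) (s × g)),
          ContDiff ℝ ∞ fun t => (B * lineFlow A (a q) (b q) F.1 x t).trace := fun B F => by
        refine MatContDiff.trace ((matContDiff_const B).mul (MatContDiff.smul ?_
          ((matContDiff_one_kronecker (matContDiff_wilson hA contDiff_const (by fun_prop))).mul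
            (MatContDiff.comp F.2 (f := fun t : ℝ => x + t • b q) (by fun_prop)))))
        exact ContDiff.cexp (Complex.ofRealCLM.contDiff.comp ((contDiff_id.mul contDiff_const).add
          (((contDiff_id.pow 2).div_const 2).mul contDiff_const)))
      rw [← iteratedDeriv_fun_add ((c _ _).of_le (by exact_mod_cast le_top)).contDiffAt
        ((c _ _).of_le (by exact_mod_cast le_top)).contDiffAt]
      rfl
    simp only [hL, Matrix.sum_mul, Matrix.trace_sum]
    rw [integral_finsetSum _ fun q _ => (hs q).1]
    -- Integrability in x of the momentum integral is inherited from the t-derivative of the shifted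
    -- trace, which is continuous and compactly supported in x.
    have hI : ∀ q, Integrable fun x => ∫ p,
        (axialLineSymbol A γ5 (M q) (N q) (a q) (b q) α x p * wigner A K x p).trace := fun q => by
      have := (hs q).2.1
      simp only [iteratedDeriv_flowTrace_shift hA hK γ5 _ _ _ _ hα] at this
      have hne : phaseNorm ≠ 0 := by
        unfold phaseNorm
        exact inv_ne_zero (by exact_mod_cast (by positivity : (2 * Real.pi) ^ 4 ≠ 0))
      simpa [hne] using this.const_mul phaseNorm⁻¹
    have e3 : ∀ x, ∫ p, ∑ q,
        (axialLineSymbol A γ5 (M q) (N q) (a q) (b q) α x p * wigner A K x p).trace =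
        ∑ q, ∫ p, (axialLineSymbol A γ5 (M q) (N q) (a q) (b q) α x p * wigner A K x p).trace :=
      fun x => integral_finsetSum _ fun q _ =>
        integrable_trace_axialLineSymbol_mul_wigner hA hK γ5 _ _ _ _ hα x
    simp only [e3]
    rw [integral_finsetSum _ fun q _ => hI q, Finset.mul_sum]
    refine Finset.sum_congr rfl fun q _ => ?_
    rw [(hs q).2.2, ← integral_const_mul]
    simp only [iteratedDeriv_flowTrace_shift hA hK γ5 _ _ _ _ hα]

end AxialSymbol

/-! ### Momentum derivatives of sums of powers. -/

section SymbolDerivatives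

variable {s : Type*} {ι : Type*} [Fintype ι]

/-- The truncated exponent `n q - 1` is harmless: for `n q = 0` the factor `n q` is zero. -/
lemma dp_sum_pow (c : ι → ℂ) (n : ι → ℕ) (a b : ι → R4) (M : ι → Matrix s s ℂ) (μ : Fin 4) :
    dp μ (fun x p => ∑ q, (c q * lineSymbol (a q) (b q) x p ^ n q) • M q) =
      fun x p => ∑ q, (c q * (n q * (Complex.I * (b q μ : ℂ))) *
        lineSymbol (a q) (b q) x p ^ (n q - 1)) • M q := by
  funext x p
  ext i j
  have hl : ∀ q, ContDiff ℝ ∞ fun p => lineSymbol (a q) (b q) x p := fun q =>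
    contDiff_const.add (contDiff_const.mul
      (Complex.ofRealCLM.contDiff.comp (contDiff_id.inner ℝ contDiff_const)))
  have hs : ContDiff ℝ ∞ fun p => (∑ q, (c q * lineSymbol (a q) (b q) x p ^ n q) • M q) i j := by
    simp only [Matrix.sum_apply, Matrix.smul_apply, smul_eq_mul]
    exact ContDiff.sum fun q _ => (contDiff_const.mul ((hl q).pow _)).mul contDiff_const
  have h1 := hasDerivAt_comp_line hs p (unitVec μ) 0
  rw [zero_smul, add_zero] at h1
  refine h1.unique ?_
  simp only [Matrix.sum_apply, Matrix.smul_apply, smul_eq_mul]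
  refine HasDerivAt.fun_sum fun q _ => HasDerivAt.mul_const ?_ _
  have h2 : HasDerivAt (fun t : ℝ => lineSymbol (a q) (b q) x (p + t • unitVec μ))
      (Complex.I * (b q μ : ℂ)) 0 := by
    have e : (fun t : ℝ => lineSymbol (a q) (b q) x (p + t • unitVec μ)) =
        fun t : ℝ => lineSymbol (a q) (b q) x p + (t : ℂ) * (Complex.I * (b q μ : ℂ)) := by
      funext t
      simp only [lineSymbol, inner_add_left, inner_smul_left, real_inner_comm _ (unitVec μ),
        inner_unitVec]
      push_cast
      simp
      ring
    rw [e]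
    simpa using (((hasDerivAt_id (0 : ℝ)).ofReal_comp).mul_const
      (Complex.I * (b q μ : ℂ))).const_add (lineSymbol (a q) (b q) x p)
  have h3 := (h2.fun_pow (n q)).const_mul (c q)
  rw [zero_smul, add_zero] at h3
  exact h3.congr_deriv (by ring)

/-- The descending factorial vanishes as soon as there are more derivatives than powers, so the
truncated subtraction again does no harm. -/
lemma foldl_dp_sum_pow (a b : ι → R4) (M : ι → Matrix s s ℂ) (w : List (Fin 4)) :
    ∀ (c : ι → ℂ) (n : ι → ℕ),
      w.foldl (fun F μ => dp μ F) (fun x p => ∑ q, (c q * lineSymbol (a q) (b q) x p ^ n q) • M q) =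
      fun x p => ∑ q, (c q * ((n q).descFactorial w.length *
          (w.map fun μ => Complex.I * (b q μ : ℂ)).prod) *
        lineSymbol (a q) (b q) x p ^ (n q - w.length)) • M q := by
  induction w with
  | nil => intro c n; simp
  | cons μ w ih =>
    intro c n
    rw [List.foldl_cons, dp_sum_pow, ih]
    funext x p
    refine Finset.sum_congr rfl fun q _ => ?_
    congr 2
    · have h : ((n q : ℂ)) * ((n q - 1).descFactorial w.length : ℂ) =
          ((n q).descFactorial (w.length + 1) : ℂ) := by
        cases n q with
        | zero => simp
        | succ k => rw [Nat.succ_descFactorial_succ]; push_cast; simp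
      rw [List.length_cons, ← h, List.map_cons, List.prod_cons]
      ring
    · rw [List.length_cons]
      congr 1
      omega

lemma dp_zero (μ : Fin 4) : dp μ (fun _ _ => (0 : Matrix s s ℂ)) = fun _ _ => 0 := by
  funext x p
  ext i j
  simp [dp, partialMat]

lemma foldl_dp_zero (w : List (Fin 4)) :
    w.foldl (fun F μ => dp μ F) (fun _ _ => (0 : Matrix s s ℂ)) = fun _ _ => 0 := by
  induction w with
  | nil => rfl
  | cons μ w ih => rw [List.foldl_cons, dp_zero, ih]

end SymbolDerivatives

/-! ### Iterated directional covariant derivatives as polynomials in the direction. -/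

section CovariantExpansion

variable {s g : Type*} [Fintype s] [DecidableEq s] [Fintype g] [DecidableEq g]
  {A : Fin 4 → R4 → Matrix g g ℂ} {ι : Type*} [Fintype ι]

lemma covDir_iterate_eq_iteratedDeriv (hA : ∀ μ, SmoothMat (A μ)) {α : R4 → Matrix g g ℂ}
    (hα : SmoothMat α) (b x : R4) (l : ℕ) (i j : g) : ((covDir A b)^[l] α) x i j =
      iteratedDeriv l (fun t : ℝ => transport A α x (t • b) i j) 0 := by
  rw [iteratedDeriv_transport hA b x i j l hα, zero_smul, transport_zero]

/-- Peels off the innermost derivative. Linearity of the remaining iterates is read off from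
iterated derivatives of transports. -/
lemma covDir_iterate_succ (hA : ∀ μ, SmoothMat (A μ)) {α : R4 → Matrix g g ℂ}
    (hα : SmoothMat α) (b x : R4) (l : ℕ) : ((covDir A b)^[l + 1] α) x =
      ∑ μ, (b μ : ℂ) • ((covDir A b)^[l] (covD A μ α)) x := by
  ext i j
  rw [Function.iterate_succ_apply, covDir_iterate_eq_iteratedDeriv hA (smoothMat_covDir hA hα b)]
  have e : (fun t : ℝ => transport A (covDir A b α) x (t • b) i j) =
      fun t : ℝ => ∑ μ, (b μ : ℂ) * transport A (covD A μ α) x (t • b) i j := by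
    funext t
    simp only [transport, covDir, Matrix.mul_sum, Matrix.sum_mul, Matrix.mul_smul,
      Matrix.smul_mul, Matrix.sum_apply, Matrix.smul_apply, smul_eq_mul]
  have hs : ∀ μ, ContDiffAt ℝ l (fun t : ℝ => transport A (covD A μ α) x (t • b) i j) 0 :=
    fun μ => ((matContDiff_transport hA (smoothMat_covD hA hα μ) contDiff_const
      (v := fun t : ℝ => t • b) (by fun_prop) i j).of_le (by exact_mod_cast le_top)).contDiffAt
  rw [e, iteratedDeriv_fun_sum fun μ _ => contDiffAt_const.mul (hs μ), Matrix.sum_apply]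
  refine Finset.sum_congr rfl fun μ _ => ?_
  rw [iteratedDeriv_const_mul _ (hs μ), Matrix.smul_apply, smul_eq_mul,
    covDir_iterate_eq_iteratedDeriv hA (smoothMat_covD hA hα μ)]

lemma sum_kronecker_covDir_succ (hA : ∀ μ, SmoothMat (A μ)) {α : R4 → Matrix g g ℂ}
    (hα : SmoothMat α) (b : ι → R4) (C : ι → Matrix s s ℂ) (x : R4) (l : ℕ) :
    ∑ q, C q ⊗ₖ ((covDir A (b q))^[l + 1] α) x =
      ∑ μ, ∑ q, ((b q μ : ℂ) • C q) ⊗ₖ ((covDir A (b q))^[l] (covD A μ α)) x := by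
  rw [Finset.sum_comm]
  refine Finset.sum_congr rfl fun q _ => ?_
  rw [covDir_iterate_succ hA hα]
  ext i j
  simp only [Matrix.kroneckerMap_apply, Matrix.sum_apply, Matrix.smul_apply, smul_eq_mul,
    Finset.mul_sum]
  exact Finset.sum_congr rfl fun μ _ => by ring

/-- (b·𝒟)^l α is homogeneous of degree l in the components of b, so a weighted sum over directions
sees only the moments of order l of its weights. -/
lemma sum_kronecker_covDir_eq_zero (hA : ∀ μ, SmoothMat (A μ)) (b : ι → R4) (x : R4) (l : ℕ) :
    ∀ {α : R4 → Matrix g g ℂ}, SmoothMat α → ∀ C : ι → Matrix s s ℂ,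
      (∀ w : List (Fin 4), w.length = l → ∑ q, (w.map fun μ => (b q μ : ℂ)).prod • C q = 0) →
      ∑ q, C q ⊗ₖ ((covDir A (b q))^[l] α) x = 0 := by
  induction l with
  | zero =>
    intro α hα C h
    have h0 := h [] rfl
    simp only [List.map_nil, List.prod_nil, one_smul] at h0
    ext i j
    have h1 := congrFun (congrFun h0 i.1) j.1
    simp only [Matrix.sum_apply, Matrix.kroneckerMap_apply, Function.iterate_zero, id,
      ← Finset.sum_mul] at h1 ⊢
    rw [h1]
    simp
  | succ l ih =>
    intro α hα C h
    rw [sum_kronecker_covDir_succ hA hα]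
    refine Finset.sum_eq_zero fun μ _ => ih (smoothMat_covD hA hα μ) _ fun w hw => ?_
    have := h (μ :: w) (by simp [hw])
    simp only [List.map_cons, List.prod_cons] at this
    rw [← this]
    exact Finset.sum_congr rfl fun q _ => by rw [smul_smul, mul_comm]

end CovariantExpansion

/-! ### The symbol of the variation, order by order in covariant derivatives of α. -/

section AxialExpansion

variable {s g : Type*} [Fintype s] [DecidableEq s] [Fintype g] [DecidableEq g]
  {A : Fin 4 → R4 → Matrix g g ℂ} {α : R4 → Matrix g g ℂ} {ι : Type*} [Fintype ι]

/-- The part of the symbol of the variation with `l` covariant derivatives of `α`. -/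
def axialOrder (A : Fin 4 → R4 → Matrix g g ℂ) (γ5 : Matrix s s ℂ) (M : ι → Matrix s s ℂ)
    (N : ι → ℕ) (a b : ι → R4) (α : R4 → Matrix g g ℂ) (l : ℕ) (x p : R4) :
    Matrix (s × g) (s × g) ℂ :=
  ∑ q, (((N q).choose l : ℂ) * lineSymbol (a q) (b q) x p ^ (N q - l)) •
    axialTerm A γ5 (M q) (b q) α l x

/-- The binomial coefficients vanish past `N q`, so one common range serves all q. The extra 3 lets
orders 0, 1 and 2 be split off whatever the exponents are. -/
lemma sum_axialLineSymbol_eq (γ5 : Matrix s s ℂ) (M : ι → Matrix s s ℂ)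
    (N : ι → ℕ) (a b : ι → R4) (x p : R4) :
    ∑ q, axialLineSymbol A γ5 (M q) (N q) (a q) (b q) α x p =
      ∑ l ∈ Finset.range (∑ q, N q + 3), axialOrder A γ5 M N a b α l x p := by
  simp only [axialOrder, axialLineSymbol]
  rw [Finset.sum_comm]
  refine Finset.sum_congr rfl fun q _ => Finset.sum_subset (fun l hl => ?_) fun l _ hl => ?_
  · have h3 : N q ≤ ∑ q, N q :=
      Finset.single_le_sum (f := N) (fun _ _ => Nat.zero_le _) (Finset.mem_univ _)
    rw [Finset.mem_range] at hl ⊢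
    omega
  · rw [Finset.mem_range, not_lt] at hl
    rw [Nat.choose_eq_zero_of_lt (by omega), Nat.cast_zero, zero_mul, zero_smul]

lemma axialOrder_eq (γ5 : Matrix s s ℂ) (M : ι → Matrix s s ℂ)
    (N : ι → ℕ) (a b : ι → R4) (l : ℕ) (x p : R4) : axialOrder A γ5 M N a b α l x p =
      ∑ q, ((((N q).choose l : ℂ) * lineSymbol (a q) (b q) x p ^ (N q - l) * Complex.I) •
        ((-(1 / 2) : ℂ) ^ l • (γ5 * M q) + (1 / 2 : ℂ) ^ l • (M q * γ5))) ⊗ₖ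
          ((covDir A (b q))^[l] α) x := by
  simp only [axialOrder, axialTerm, Matrix.smul_kronecker, smul_smul]

lemma sum_kronecker_right (C : ι → Matrix s s ℂ) (β : Matrix g g ℂ) :
    ∑ q, C q ⊗ₖ β = (∑ q, C q) ⊗ₖ β := by
  ext i j
  simp only [Matrix.sum_apply, Matrix.kroneckerMap_apply, Finset.sum_mul]

variable {Q : SymPoly s} {M : ι → Matrix s s ℂ} {N : ι → ℕ} {a b : ι → R4}

lemma axialOrder_zero (hQ : ∀ x p, Q.symbol x p = ∑ q, lineSymbol (a q) (b q) x p ^ N q • M q)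
    (γ5 : Matrix s s ℂ) (x p : R4) : axialOrder A γ5 M N a b α 0 x p =
      (Complex.I • (γ5 * Q.symbol x p + Q.symbol x p * γ5)) ⊗ₖ α x := by
  rw [axialOrder_eq, hQ, Matrix.mul_sum, Matrix.sum_mul, ← Finset.sum_add_distrib,
    Finset.smul_sum]
  simp only [Function.iterate_zero, id]
  rw [sum_kronecker_right]
  congr 1
  refine Finset.sum_congr rfl fun q _ => ?_
  simp only [Matrix.mul_smul, Matrix.smul_mul, ← smul_add, smul_smul, pow_zero, one_smul,
    Nat.choose_zero_right, Nat.cast_one, one_mul, Nat.sub_zero]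
  rw [mul_comm]

/-- ∂_{p_μ} ℓ^N = i N b_μ ℓ^{N-1}, and the opposite signs of the two half steps produce the
commutator with weight 1/2. -/
lemma axialOrder_one (hA : ∀ μ, SmoothMat (A μ)) (hα : SmoothMat α)
    (hQ : ∀ x p, Q.symbol x p = ∑ q, lineSymbol (a q) (b q) x p ^ N q • M q)
    (γ5 : Matrix s s ℂ) (x p : R4) : axialOrder A γ5 M N a b α 1 x p =
      ∑ μ, ((1 / 2 : ℂ) • dp μ (Q.comm γ5) x p) ⊗ₖ covD A μ α x := by
  have hc : Q.comm γ5 = fun x p =>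
      ∑ q, ((1 : ℂ) * lineSymbol (a q) (b q) x p ^ N q) • (M q * γ5 - γ5 * M q) := by
    funext x p
    simp only [SymPoly.comm, hQ, Matrix.sum_mul, Matrix.mul_sum, Matrix.smul_mul, Matrix.mul_smul,
      smul_sub, Finset.sum_sub_distrib, one_mul]
  rw [axialOrder_eq, sum_kronecker_covDir_succ hA hα]
  refine Finset.sum_congr rfl fun μ _ => ?_
  simp only [Function.iterate_zero, id]
  rw [sum_kronecker_right, hc, dp_sum_pow, Finset.smul_sum]
  congr 1
  refine Finset.sum_congr rfl fun q _ => ?_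
  simp only [Nat.choose_one_right, pow_one]
  module

/-- Here both half steps contribute 1/4, hence an anticommutator. Two momentum derivatives of ℓ^N
give i² N(N-1) = -2 binom(N, 2), and i · (1/4) · (-1/2) = -i/8. -/
lemma axialOrder_two (hA : ∀ μ, SmoothMat (A μ)) (hα : SmoothMat α)
    (hQ : ∀ x p, Q.symbol x p = ∑ q, lineSymbol (a q) (b q) x p ^ N q • M q)
    (γ5 : Matrix s s ℂ) (x p : R4) : axialOrder A γ5 M N a b α 2 x p =
      ∑ μ, ∑ ν, (-(Complex.I / 8) • (γ5 * dp μ (dp ν Q.symbol) x p +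
        dp μ (dp ν Q.symbol) x p * γ5)) ⊗ₖ covD A μ (covD A ν α) x := by
  have hc : Q.symbol = fun x p => ∑ q, ((1 : ℂ) * lineSymbol (a q) (b q) x p ^ N q) • M q := by
    funext x p
    simp only [hQ, one_mul]
  rw [axialOrder_eq, sum_kronecker_covDir_succ hA hα]
  conv_rhs => rw [Finset.sum_comm]
  refine Finset.sum_congr rfl fun ν _ => ?_
  rw [sum_kronecker_covDir_succ hA (smoothMat_covD hA hα ν)]
  refine Finset.sum_congr rfl fun μ _ => ?_
  simp only [Function.iterate_zero, id]
  rw [sum_kronecker_right, hc, dp_sum_pow, dp_sum_pow, Matrix.mul_sum, Matrix.sum_mul,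
    ← Finset.sum_add_distrib, Finset.smul_sum]
  congr 1
  refine Finset.sum_congr rfl fun q _ => ?_
  have h : (N q : ℂ) * ((N q - 1 : ℕ) : ℂ) = 2 * ((N q).choose 2 : ℂ) := by
    have h1 := (N q).descFactorial_eq_factorial_mul_choose 2
    have h2 : (N q).descFactorial 2 = N q * (N q - 1) := by
      simp [Nat.descFactorial_succ, mul_comm]
    rw [← Nat.cast_mul, ← h2, h1]
    simp
  have e : ∀ z : ℂ, (1 : ℂ) * (N q * (Complex.I * (b q ν : ℂ))) *
      (((N q - 1 : ℕ) : ℂ) * (Complex.I * (b q μ : ℂ))) * z =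
      -2 * ((N q).choose 2 : ℂ) * (b q ν : ℂ) * (b q μ : ℂ) * z := fun z => by
    linear_combination (Complex.I ^ 2 * (b q ν : ℂ) * (b q μ : ℂ) * z) * h +
      (2 * ((N q).choose 2 : ℂ) * (b q ν : ℂ) * (b q μ : ℂ) * z) * Complex.I_sq
  rw [e, Nat.sub_sub, Matrix.mul_smul, Matrix.smul_mul]
  module

/-- The moments that `sum_kronecker_covDir_eq_zero` asks for are, up to a nonzero constant, momentum
derivatives of Q of order l + 3, multiplied by γ⁵ on either side. -/
lemma axialOrder_eq_zero_of_dp (hA : ∀ μ, SmoothMat (A μ)) (hα : SmoothMat α)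
    (hQ : ∀ x p, Q.symbol x p = ∑ q, lineSymbol (a q) (b q) x p ^ N q • M q)
    (h3 : ∀ κ μ ν x p, dp κ (dp μ (dp ν Q.symbol)) x p = 0)
    (γ5 : Matrix s s ℂ) (l : ℕ) (x p : R4) : axialOrder A γ5 M N a b α (l + 3) x p = 0 := by
  have hc : Q.symbol = fun x p => ∑ q, ((1 : ℂ) * lineSymbol (a q) (b q) x p ^ N q) • M q := by
    funext x p
    simp only [hQ, one_mul]
  rw [axialOrder_eq]
  refine sum_kronecker_covDir_eq_zero hA b x _ hα _ fun w hw => ?_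
  have hw0 : w.foldl (fun F μ => dp μ F) Q.symbol = fun _ _ => 0 := by
    match w, hw with
    | ν :: μ :: κ :: w, _ =>
      have : dp κ (dp μ (dp ν Q.symbol)) = fun _ _ => 0 := funext fun x => funext fun p =>
        h3 κ μ ν x p
      simp only [List.foldl_cons, this, foldl_dp_zero]
  rw [hc, foldl_dp_sum_pow] at hw0
  have h0 := congrFun (congrFun hw0 x) p
  rw [hw] at h0
  have hprod : ∀ q, (w.map fun μ => Complex.I * (b q μ : ℂ)).prod =
      Complex.I ^ (l + 3) * (w.map fun μ => (b q μ : ℂ)).prod := fun q => by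
    rw [List.prod_map_mul, List.map_const', List.prod_replicate, hw]
  -- The order-(l + 3) momentum derivative divided by (l + 3)! i^{l+3}.
  have hS : ∑ q, (((N q).choose (l + 3) : ℂ) * lineSymbol (a q) (b q) x p ^ (N q - (l + 3)) *
      (w.map fun μ => (b q μ : ℂ)).prod) • M q = 0 := by
    have hne : ((l + 3).factorial : ℂ) * Complex.I ^ (l + 3) ≠ 0 :=
      mul_ne_zero (by exact_mod_cast (l + 3).factorial_ne_zero) (pow_ne_zero _ Complex.I_ne_zero)
    refine (smul_eq_zero_iff_right hne).1 ?_
    rw [← h0, Finset.smul_sum]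
    refine Finset.sum_congr rfl fun q _ => ?_
    rw [smul_smul, hprod, Nat.descFactorial_eq_factorial_mul_choose]
    congr 1
    push_cast
    ring
  have e : ∀ q, (w.map fun μ => (b q μ : ℂ)).prod •
      ((((N q).choose (l + 3) : ℂ) * lineSymbol (a q) (b q) x p ^ (N q - (l + 3)) * Complex.I) •
        ((-(1 / 2) : ℂ) ^ (l + 3) • (γ5 * M q) + (1 / 2 : ℂ) ^ (l + 3) • (M q * γ5))) =
      (Complex.I * (-(1 / 2) : ℂ) ^ (l + 3)) •
        (γ5 * ((((N q).choose (l + 3) : ℂ) * lineSymbol (a q) (b q) x p ^ (N q - (l + 3)) *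
          (w.map fun μ => (b q μ : ℂ)).prod) • M q)) +
      (Complex.I * (1 / 2 : ℂ) ^ (l + 3)) •
        (((((N q).choose (l + 3) : ℂ) * lineSymbol (a q) (b q) x p ^ (N q - (l + 3)) *
          (w.map fun μ => (b q μ : ℂ)).prod) • M q) * γ5) := fun q => by
    rw [Matrix.mul_smul, Matrix.smul_mul]
    module
  simp only [e]
  rw [Finset.sum_add_distrib, ← Finset.smul_sum, ← Finset.smul_sum, ← Matrix.mul_sum,
    ← Matrix.sum_mul, hS, Matrix.mul_zero, Matrix.zero_mul, smul_zero, smul_zero, add_zero]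

lemma axialOrder_eq_zero_of_isSlowAt {x : R4} (hx : IsSlowAt A α x) (γ5 : Matrix s s ℂ)
    (l : ℕ) (p : R4) : axialOrder A γ5 M N a b α (l + 2) x p = 0 := by
  rw [axialOrder_eq]
  refine Finset.sum_eq_zero fun q _ => ?_
  rw [hx (b q) (l + 2) (by omega), Matrix.kronecker_zero]

end AxialExpansion

/-! ### The partial trace over the non-gauge indices. -/

section InternalTrace

variable {s g : Type*} [Fintype s] [DecidableEq s] [Fintype g] [DecidableEq g]

lemma trace_kronecker_mul (C : Matrix s s ℂ) (β : Matrix g g ℂ) (W : Matrix (s × g) (s × g) ℂ) :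
    ((C ⊗ₖ β) * W).trace = (β * trD ((C ⊗ₖ (1 : Matrix g g ℂ)) * W)).trace := by
  have h : ∀ V : Matrix (s × g) (s × g) ℂ,
      (((1 : Matrix s s ℂ) ⊗ₖ β) * V).trace = (β * trD V).trace := fun V => by
    simp only [Matrix.trace, Matrix.diag, Matrix.mul_apply, trD, Matrix.of_apply,
      Matrix.kroneckerMap_apply, Fintype.sum_prod_type, Matrix.one_apply, one_mul,
      ite_mul, zero_mul, Finset.sum_ite_irrel, Finset.sum_const_zero, Finset.sum_ite_eq,
      Finset.mem_univ, if_true, Finset.mul_sum]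
    rw [Finset.sum_comm]
    exact Finset.sum_congr rfl fun c _ => Finset.sum_comm
  rw [← h, ← Matrix.mul_assoc, ← Matrix.mul_kronecker_mul, Matrix.one_mul, Matrix.mul_one]

/-- A partial trace is not cyclic in general; it is for a factor acting only on the traced indices.
-/
lemma trD_mul_comm_kronecker_one (C : Matrix s s ℂ) (W : Matrix (s × g) (s × g) ℂ) :
    trD (W * (C ⊗ₖ (1 : Matrix g g ℂ))) = trD ((C ⊗ₖ (1 : Matrix g g ℂ)) * W) := by
  ext c d
  simp only [Matrix.mul_apply, trD, Matrix.of_apply,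
    Matrix.kroneckerMap_apply, Fintype.sum_prod_type, Matrix.one_apply, mul_ite, mul_one, mul_zero,
    ite_mul, zero_mul, Finset.sum_ite_eq, Finset.sum_ite_eq', Finset.mem_univ, if_true]
  rw [Finset.sum_comm]
  exact Finset.sum_congr rfl fun i _ => Finset.sum_congr rfl fun j _ => mul_comm _ _

lemma trD_anticommutator (γ5 C : Matrix s s ℂ) (W : Matrix (s × g) (s × g) ℂ) :
    trD ((γ5 ⊗ₖ (1 : Matrix g g ℂ)) * ((C ⊗ₖ (1 : Matrix g g ℂ)) * W +
      W * (C ⊗ₖ (1 : Matrix g g ℂ)))) =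
      trD (((γ5 * C + C * γ5) ⊗ₖ (1 : Matrix g g ℂ)) * W) := by
  have hk : ∀ C D : Matrix s s ℂ, (C * D) ⊗ₖ (1 : Matrix g g ℂ) =
      (C ⊗ₖ (1 : Matrix g g ℂ)) * (D ⊗ₖ (1 : Matrix g g ℂ)) := fun C D => by
    rw [← Matrix.mul_kronecker_mul, Matrix.one_mul]
  have ha : ∀ V W : Matrix (s × g) (s × g) ℂ, trD (V + W) = trD V + trD W := fun V W => by
    ext c d
    simp only [trD, Matrix.of_apply, Matrix.add_apply, Finset.sum_add_distrib]
  rw [Matrix.mul_add, ha, ← Matrix.mul_assoc, ← Matrix.mul_assoc, trD_mul_comm_kronecker_one,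
    Matrix.add_kronecker, Matrix.add_mul, ha, hk, hk, Matrix.mul_assoc (C ⊗ₖ 1)]

lemma integrable_const_mul_trace {F : R4 → Matrix g g ℂ}
    (hF : ∀ c d, Integrable fun p => F p c d) (k : ℂ) (β : Matrix g g ℂ) :
    Integrable fun p => k * (β * F p).trace := by
  simp only [Matrix.trace, Matrix.diag, Matrix.mul_apply]
  exact (integrable_finsetSum _ fun c _ => integrable_finsetSum _ fun d _ =>
    (hF d c).const_mul _).const_mul k

lemma phaseNorm_mul_integral_trace {F : R4 → Matrix g g ℂ}
    (hF : ∀ c d, Integrable fun p => F p c d) (k : ℂ) (β : Matrix g g ℂ) :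
    phaseNorm * ∫ p, k * (β * F p).trace =
      (β * Matrix.of fun c d => k * (phaseNorm * ∫ p, F p c d)).trace := by
  have e1 : ∫ p, (β * F p).trace = ∑ c, ∑ d, β c d * ∫ p, F p d c := by
    simp only [← integral_const_mul]
    refine (integral_finsetSum _ fun c _ => integrable_finsetSum _ fun d _ =>
      (hF d c).const_mul (β c d)).trans (Finset.sum_congr rfl fun c _ => ?_)
    exact integral_finsetSum _ fun d _ => (hF d c).const_mul (β c d)
  have e2 : (β * Matrix.of fun c d => k * (phaseNorm * ∫ p, F p c d)).trace =
      ∑ c, ∑ d, β c d * (k * (phaseNorm * ∫ p, F p d c)) := rfl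
  rw [integral_const_mul, e1, e2]
  simp only [Finset.mul_sum]
  exact Finset.sum_congr rfl fun c _ => Finset.sum_congr rfl fun d _ => by ring

end InternalTrace

/-! ### The averaged variation density in terms of current and breaking terms. -/

section VariationDensity

variable {s g : Type*} [Fintype s] [DecidableEq s] [Fintype g] [DecidableEq g]
  {A : Fin 4 → R4 → Matrix g g ℂ} {α : R4 → Matrix g g ℂ} {Q : SymPoly s} {γ5 : Matrix s s ℂ}
  {G : R4 → R4 → Matrix (s × g) (s × g) ℂ}

lemma exists_weylSymbol_eq_sum_axialOrder (hA : ∀ μ, SmoothMat (A μ)) (Q : SymPoly s)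
    (γ5 : Matrix s s ℂ) (hα : SmoothMat α) :
    ∃ (ι : Type) (_ : Fintype ι) (M : ι → Matrix s s ℂ) (N : ι → ℕ) (a b : ι → R4),
      (∀ x p, Q.symbol x p = ∑ q, lineSymbol (a q) (b q) x p ^ N q • M q) ∧
      ∀ x p, weylSymbol A (axialVariation Q A γ5 α) x p =
        ∑ l ∈ Finset.range (∑ q, N q + 3), axialOrder A γ5 M N a b α l x p := by
  obtain ⟨ι, _, M, N, a, b, h1, h2⟩ := Q.exists_line_decomposition (n := s × g) hA
  refine ⟨ι, inferInstance, M, N, a, b, h2, fun x p => ?_⟩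
  rw [(isWeylSymbol_axialVariation hA Q γ5 hα h1).weylSymbol_eq hA]
  exact sum_axialLineSymbol_eq γ5 M N a b x p

lemma weylSymbol_axialVariation_of_isSlowAt (hA : ∀ μ, SmoothMat (A μ)) (Q : SymPoly s)
    (γ5 : Matrix s s ℂ) (hα : SmoothMat α) {x : R4} (hx : IsSlowAt A α x) (p : R4) :
    weylSymbol A (axialVariation Q A γ5 α) x p =
      (Complex.I • (γ5 * Q.symbol x p + Q.symbol x p * γ5)) ⊗ₖ α x +
      ∑ μ, ((1 / 2 : ℂ) • dp μ (Q.comm γ5) x p) ⊗ₖ covD A μ α x := by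
  obtain ⟨ι, _, M, N, a, b, hQ, h⟩ := exists_weylSymbol_eq_sum_axialOrder hA Q γ5 hα
  rw [h, Finset.sum_range_succ', Finset.sum_range_succ', axialOrder_zero hQ,
    axialOrder_one hA hα hQ, Finset.sum_eq_zero fun l _ => axialOrder_eq_zero_of_isSlowAt hx γ5 l p,
    zero_add, add_comm]

lemma weylSymbol_axialVariation_of_dp (hA : ∀ μ, SmoothMat (A μ)) (γ5 : Matrix s s ℂ)
    (hα : SmoothMat α) (h3 : ∀ κ μ ν x p, dp κ (dp μ (dp ν Q.symbol)) x p = 0) (x p : R4) :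
    weylSymbol A (axialVariation Q A γ5 α) x p =
      (Complex.I • (γ5 * Q.symbol x p + Q.symbol x p * γ5)) ⊗ₖ α x +
      ∑ μ, ((1 / 2 : ℂ) • dp μ (Q.comm γ5) x p) ⊗ₖ covD A μ α x +
      ∑ μ, ∑ ν, (-(Complex.I / 8) • (γ5 * dp μ (dp ν Q.symbol) x p +
        dp μ (dp ν Q.symbol) x p * γ5)) ⊗ₖ covD A μ (covD A ν α) x := by
  obtain ⟨ι, _, M, N, a, b, hQ, h⟩ := exists_weylSymbol_eq_sum_axialOrder hA Q γ5 hα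
  rw [h, Finset.sum_range_succ', Finset.sum_range_succ', Finset.sum_range_succ',
    axialOrder_zero hQ, axialOrder_one hA hα hQ, axialOrder_two hA hα hQ,
    Finset.sum_eq_zero fun l _ => axialOrder_eq_zero_of_dp hA hα hQ h3 γ5 l x p]
  abel

lemma trace_smul_kronecker_mul (k : ℂ) (C : Matrix s s ℂ) (β : Matrix g g ℂ)
    (W : Matrix (s × g) (s × g) ℂ) :
    (((k • C) ⊗ₖ β) * W).trace = k * (β * trD ((C ⊗ₖ (1 : Matrix g g ℂ)) * W)).trace := by
  rw [Matrix.smul_kronecker, Matrix.smul_mul, Matrix.trace_smul, smul_eq_mul, trace_kronecker_mul]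

lemma currentIntegrand_eq (μ : Fin 4) (x p : R4) : currentIntegrand Q A γ5 G μ x p =
    trD ((dp μ (Q.comm γ5) x p ⊗ₖ (1 : Matrix g g ℂ)) * wigner A G x p) :=
  trD_mul_comm_kronecker_one _ _

/-- The assumed integrability of the two contracted integrands is all that splitting the integral
needs. The weight +1/2 of the commutator meets the -1/2 in `axialCurrent`, whence the minus sign. -/
lemma integral_first_order
    (hB : ∀ x c d, Integrable fun p => breakingIntegrand Q A γ5 G x p c d)
    (hJ : ∀ μ x c d, Integrable fun p => currentIntegrand Q A γ5 G μ x p c d) (x : R4)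
    (β : Matrix g g ℂ) (β₁ : Fin 4 → Matrix g g ℂ) :
    Integrable (fun p => (((Complex.I • (γ5 * Q.symbol x p + Q.symbol x p * γ5)) ⊗ₖ β +
      ∑ μ, ((1 / 2 : ℂ) • dp μ (Q.comm γ5) x p) ⊗ₖ β₁ μ) * wigner A G x p).trace) ∧
    phaseNorm * ∫ p, (((Complex.I • (γ5 * Q.symbol x p + Q.symbol x p * γ5)) ⊗ₖ β +
      ∑ μ, ((1 / 2 : ℂ) • dp μ (Q.comm γ5) x p) ⊗ₖ β₁ μ) * wigner A G x p).trace =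
      (β * chiralBreaking Q A γ5 G x).trace - ∑ μ, (β₁ μ * axialCurrent Q A γ5 G μ x).trace := by
  have e : ∀ p, (((Complex.I • (γ5 * Q.symbol x p + Q.symbol x p * γ5)) ⊗ₖ β +
      ∑ μ, ((1 / 2 : ℂ) • dp μ (Q.comm γ5) x p) ⊗ₖ β₁ μ) * wigner A G x p).trace =
      Complex.I * (β * breakingIntegrand Q A γ5 G x p).trace +
        ∑ μ, 1 / 2 * (β₁ μ * currentIntegrand Q A γ5 G μ x p).trace := fun p => by
    rw [Matrix.add_mul, Matrix.trace_add, trace_smul_kronecker_mul, ← trD_anticommutator,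
      Matrix.sum_mul, Matrix.trace_sum]
    simp only [trace_smul_kronecker_mul, currentIntegrand_eq]
    rfl
  have i1 := integrable_const_mul_trace (hB x) Complex.I β
  have i2 := fun μ => integrable_const_mul_trace (hJ μ x) (1 / 2) (β₁ μ)
  have i3 : Integrable fun p => ∑ μ, 1 / 2 * (β₁ μ * currentIntegrand Q A γ5 G μ x p).trace :=
    integrable_finsetSum _ fun μ _ => i2 μ
  simp only [e]
  refine ⟨i1.add i3, ?_⟩
  rw [integral_add i1 i3, integral_finsetSum _ fun μ _ => i2 μ, mul_add, Finset.mul_sum,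
    phaseNorm_mul_integral_trace (hB x), sub_eq_add_neg, ← Finset.sum_neg_distrib]
  refine congrArg₂ _ rfl (Finset.sum_congr rfl fun μ _ => ?_)
  rw [phaseNorm_mul_integral_trace (hJ μ x), ← Matrix.trace_neg, ← Matrix.mul_neg]
  congr 2
  ext c d
  simp only [axialCurrent, Matrix.of_apply, Matrix.neg_apply]
  ring

lemma variationDensity_of_isSlowAt (hA : ∀ μ, SmoothMat (A μ)) (hα : SmoothMat α)
    (hB : ∀ x c d, Integrable fun p => breakingIntegrand Q A γ5 G x p c d)
    (hJ : ∀ μ x c d, Integrable fun p => currentIntegrand Q A γ5 G μ x p c d) {x : R4}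
    (hx : IsSlowAt A α x) : variationDensity Q A γ5 G α x =
      (α x * chiralBreaking Q A γ5 G x).trace -
        ∑ μ, (covD A μ α x * axialCurrent Q A γ5 G μ x).trace := by
  simp only [variationDensity, weylSymbol_axialVariation_of_isSlowAt hA Q γ5 hα hx]
  exact (integral_first_order hB hJ x (α x) fun μ => covD A μ α x).2

lemma variationDensity_of_dp (hA : ∀ μ, SmoothMat (A μ)) (hα : SmoothMat α)
    (hB : ∀ x c d, Integrable fun p => breakingIntegrand Q A γ5 G x p c d)
    (hJ : ∀ μ x c d, Integrable fun p => currentIntegrand Q A γ5 G μ x p c d)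
    (h3 : ∀ κ μ ν x p, dp κ (dp μ (dp ν Q.symbol)) x p = 0)
    (h2 : ∀ μ ν x c d, Integrable fun p => secondIntegrand Q A γ5 G μ ν x p c d) (x : R4) :
    variationDensity Q A γ5 G α x =
      (α x * chiralBreaking Q A γ5 G x).trace -
        ∑ μ, (covD A μ α x * axialCurrent Q A γ5 G μ x).trace +
        ∑ μ, ∑ ν, (covD A μ (covD A ν α) x * secondBreaking Q A γ5 G μ ν x).trace := by
  obtain ⟨j1, j2⟩ := integral_first_order hB hJ x (α x) fun μ => covD A μ α x
  have e : ∀ p, ((∑ μ, ∑ ν, (-(Complex.I / 8) • (γ5 * dp μ (dp ν Q.symbol) x p +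
      dp μ (dp ν Q.symbol) x p * γ5)) ⊗ₖ covD A μ (covD A ν α) x) * wigner A G x p).trace =
      ∑ μ, ∑ ν, -(Complex.I / 8) *
        (covD A μ (covD A ν α) x * secondIntegrand Q A γ5 G μ ν x p).trace := fun p => by
    simp only [Matrix.sum_mul, Matrix.trace_sum, trace_smul_kronecker_mul, ← trD_anticommutator]
    rfl
  have i1 := fun μ ν => integrable_const_mul_trace (h2 μ ν x) (-(Complex.I / 8))
    (covD A μ (covD A ν α) x)
  have i2 := fun μ => integrable_finsetSum Finset.univ fun ν _ => i1 μ ν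
  simp only [variationDensity, weylSymbol_axialVariation_of_dp hA γ5 hα h3]
  simp only [Matrix.add_mul _ _ (wigner A G x _), Matrix.trace_add]
  simp only [← Matrix.trace_add, ← Matrix.add_mul _ _ (wigner A G x _), e]
  rw [integral_add j1 (integrable_finsetSum _ fun μ _ => i2 μ), mul_add, j2,
    integral_finsetSum _ fun μ _ => i2 μ, Finset.mul_sum]
  congr 1
  refine Finset.sum_congr rfl fun μ _ => ?_
  rw [integral_finsetSum _ fun ν _ => i1 μ ν, Finset.mul_sum]
  exact Finset.sum_congr rfl fun ν _ => phaseNorm_mul_integral_trace (h2 μ ν x) _ _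

end VariationDensity

/-! ### Invariance of the gauge algebra under differentiation and transport, and the probe
parameters. -/

section GaugeAlgebra

variable {g : Type*} [Fintype g] [DecidableEq g] {𝔤 : Submodule ℝ (Matrix g g ℂ)}
  {A : Fin 4 → R4 → Matrix g g ℂ} {α : R4 → Matrix g g ℂ}

lemma MatHasDerivAt.linearMap {F : ℝ → Matrix g g ℂ} {F' : Matrix g g ℂ} {t : ℝ}
    (hF : MatHasDerivAt F F' t) (f : Matrix g g ℂ →ₗ[ℝ] ℝ) :
    HasDerivAt (fun t => f (F t)) (f F') t := by
  have e : ∀ X : Matrix g g ℂ, f X = ∑ i, ∑ j,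
      LinearMap.toContinuousLinearMap (f ∘ₗ Matrix.singleLinearMap ℝ i j) (X i j) := fun X => by
    conv_lhs => rw [Matrix.matrix_eq_sum_single X]
    simp only [map_sum]
    rfl
  simp only [e]
  exact HasDerivAt.fun_sum fun i _ => HasDerivAt.fun_sum fun j _ =>
    (LinearMap.toContinuousLinearMap (f ∘ₗ Matrix.singleLinearMap ℝ i j)).hasFDerivAt.comp_hasDerivAt
      t (hF i j)

/-- A vector outside the subspace is detected by a real functional that vanishes on it; along F this
functional is constantly zero, and so is its derivative. -/
lemma mem_of_matHasDerivAt {F : ℝ → Matrix g g ℂ} {F' : Matrix g g ℂ} {t : ℝ}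
    (hF : MatHasDerivAt F F' t) (h : ∀ t, F t ∈ 𝔤) : F' ∈ 𝔤 := by
  by_contra hne
  obtain ⟨f, hf, hf0⟩ := Submodule.exists_le_ker_of_notMem hne
  refine hf ((hF.linearMap f).unique ?_)
  have : (fun t => f (F t)) = fun _ => 0 := funext fun t => hf0 (h t)
  rw [this]
  exact hasDerivAt_const t 0

lemma IsGaugeAlgebra.covD_mem (h𝔤 : IsGaugeAlgebra 𝔤) (hA𝔤 : ∀ μ x, A μ x ∈ 𝔤)
    (hα : SmoothMat α) (hα𝔤 : ∀ x, α x ∈ 𝔤) (μ : Fin 4) (x : R4) : covD A μ α x ∈ 𝔤 := by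
  refine 𝔤.sub_mem ?_ (h𝔤.bracket _ (hA𝔤 μ x) _ (hα𝔤 x))
  have h : MatHasDerivAt (fun t : ℝ => α (x + t • unitVec μ)) (partialMat μ α x) 0 := fun i j => by
    have := hasDerivAt_comp_line (hα i j) x (unitVec μ) 0
    rw [zero_smul, add_zero] at this
    exact this
  exact mem_of_matHasDerivAt h fun t => hα𝔤 _

/-- A solution of a linear differential equation whose coefficients preserve `𝔤` stays in `𝔤`. -/
lemma mem_of_linear_ode {L : ℝ → Matrix g g ℂ →ₗ[ℝ] Matrix g g ℂ}
    (hL : ∀ t, ∀ X ∈ 𝔤, L t X ∈ 𝔤) (hc : ∀ X i j, Continuous fun t => L t X i j)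
    {Y : ℝ → Matrix g g ℂ} (hY : ∀ t, MatHasDerivAt Y (L t (Y t)) t) (h0 : Y 0 ∈ 𝔤) (t : ℝ) :
    Y t ∈ 𝔤 := by
  classical
  let B := Module.finBasis ℝ (Matrix g g ℂ ⧸ 𝔤)
  let f : Fin (Module.finrank ℝ (Matrix g g ℂ ⧸ 𝔤)) → Matrix g g ℂ →ₗ[ℝ] ℝ :=
    fun k => B.coord k ∘ₗ 𝔤.mkQ
  have hf : ∀ X : Matrix g g ℂ, X ∈ 𝔤 ↔ ∀ k, f k X = 0 := fun X => by
    rw [← Submodule.Quotient.mk_eq_zero, ← B.forall_coord_eq_zero_iff]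
    rfl
  choose e he using fun k => 𝔤.mkQ_surjective (B k)
  have hfe : ∀ k l, f k (e l) = if k = l then 1 else 0 := fun k l => by
    change B.coord k (𝔤.mkQ (e l)) = _
    rw [he, Module.Basis.coord_apply, B.repr_self, Finsupp.single_apply]
    simp only [eq_comm]
  have hdec : ∀ X : Matrix g g ℂ, X - ∑ l, f l X • e l ∈ 𝔤 := fun X => by
    rw [hf]
    intro k
    simp [hfe]
  -- L maps 𝔤 to itself, so it descends to the quotient: the coordinates of Y modulo 𝔤 satisfy a
  -- closed linear system. They start at zero, and uniqueness keeps them there.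
  have hfL : ∀ t k (X : Matrix g g ℂ), f k (L t X) = ∑ l, f k (L t (e l)) * f l X :=
    fun t k X => by
      have h1 := (hf _).1 (hL t _ (hdec X)) k
      rw [map_sub, map_sub, sub_eq_zero] at h1
      rw [h1]
      simp only [map_sum, map_smul, smul_eq_mul]
      exact Finset.sum_congr rfl fun l _ => mul_comm _ _
  let a : ℝ → Matrix (Fin (Module.finrank ℝ (Matrix g g ℂ ⧸ 𝔤)))
      (Fin (Module.finrank ℝ (Matrix g g ℂ ⧸ 𝔤))) ℂ :=
    fun t => Matrix.of fun k l => ((f k (L t (e l)) : ℝ) : ℂ)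
  have ha : ∀ k l, Continuous fun t => a t k l := fun k l => by
    refine Complex.continuous_ofReal.comp ?_
    have h1 : ∀ t, L t (e l) = ∑ i, ∑ j, Matrix.single i j (L t (e l) i j) := fun t =>
      Matrix.matrix_eq_sum_single _
    have h2 : ∀ t, f k (L t (e l)) = ∑ i, ∑ j,
        LinearMap.toContinuousLinearMap (f k ∘ₗ Matrix.singleLinearMap ℝ i j) (L t (e l) i j) :=
      fun t => by
        rw [h1]
        simp only [map_sum]
        rw [← h1]
        rfl
    simp only [h2]
    exact continuous_finsetSum _ fun i _ => continuous_finsetSum _ fun j _ =>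
      (ContinuousLinearMap.continuous _).comp (hc (e l) i j)
  let F : ℝ → Matrix (Fin (Module.finrank ℝ (Matrix g g ℂ ⧸ 𝔤)))
      (Fin (Module.finrank ℝ (Matrix g g ℂ ⧸ 𝔤))) ℂ :=
    fun t => Matrix.of fun k _ => ((f k (Y t) : ℝ) : ℂ)
  have hF : ∀ t, MatHasDerivAt F (a t * F t) t := fun t k l => by
    refine (((hY t).linearMap (f k)).ofReal_comp).congr_deriv ?_
    rw [hfL, Complex.ofReal_sum]
    simp only [Complex.ofReal_mul]
    rfl
  have hF0 : F 0 = 0 := by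
    ext k l
    exact congrArg Complex.ofReal ((hf _).1 h0 k)
  have hFt := eq_dyson_mul ha hF t
  rw [hF0, Matrix.mul_zero] at hFt
  exact (hf _).2 fun k => Complex.ofReal_eq_zero.1 (congrFun (congrFun hFt k) k)

/-- Along the segment the conjugate solves Y' = [C, Y] with C = i b·A, and [C, Y] is a real
combination of the brackets i[A_μ, Y]. -/
lemma IsGaugeAlgebra.wilson_conj_mem (h𝔤 : IsGaugeAlgebra 𝔤) (hA : ∀ μ, SmoothMat (A μ))
    (hA𝔤 : ∀ μ x, A μ x ∈ 𝔤) {X : Matrix g g ℂ} (hX : X ∈ 𝔤) (z x : R4) :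
    wilson A z x * X * wilson A x z ∈ 𝔤 := by
  let C : ℝ → Matrix g g ℂ := fun t => conn A (z - x) (x + t • (z - x))
  let L : ℝ → Matrix g g ℂ →ₗ[ℝ] Matrix g g ℂ := fun t =>
    LinearMap.mulLeft ℝ (C t) - LinearMap.mulRight ℝ (C t)
  have hLX : ∀ t X, L t X = C t * X - X * C t := fun _ _ => rfl
  have hcont : ∀ i j, Continuous fun t => C t i j := fun i j =>
    (matContDiff_conn hA contDiff_const (x := fun t : ℝ => x + t • (z - x))
      (by fun_prop) i j).continuous
  have key := mem_of_linear_ode (𝔤 := 𝔤) (L := L) (fun t Y hY => ?_) (fun Y i j => ?_)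
    (Y := fun t => wilson A (x + t • (z - x)) x * X * wilson A x (x + t • (z - x)))
    (fun t => ?_) ?_ 1
  · simpa using key
  · have e : L t Y = ∑ μ, (z - x) μ • (Complex.I • (A μ (x + t • (z - x)) * Y -
        Y * A μ (x + t • (z - x)))) := by
      rw [hLX]
      change conn A (z - x) _ * Y - Y * conn A (z - x) _ = _
      simp only [conn, Matrix.smul_mul, Matrix.mul_smul, Matrix.sum_mul, Matrix.mul_sum,
        Finset.smul_sum, ← Finset.sum_sub_distrib]
      refine Finset.sum_congr rfl fun μ _ => ?_
      rw [← Complex.coe_smul, smul_comm Complex.I, smul_comm Complex.I, ← smul_sub, ← smul_sub]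
    rw [e]
    exact 𝔤.sum_mem fun μ _ => 𝔤.smul_mem _ (h𝔤.bracket _ (hA𝔤 _ _) _ hY)
  · simp only [hLX, Matrix.sub_apply, Matrix.mul_apply]
    exact (continuous_finsetSum _ fun k _ => (hcont i k).mul continuous_const).sub
      (continuous_finsetSum _ fun k _ => continuous_const.mul (hcont k j))
  · have h := ((wilson_hasDerivAt_left hA x (z - x) t).mul (matHasDerivAt_const X t)).mul
      (wilson_hasDerivAt_right hA x (z - x) t)
    have e : ∀ P P' D : Matrix g g ℂ, (D * P * X + P * 0) * P' + P * X * -(P' * D) =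
        D * (P * X * P') - P * X * P' * D := fun P P' D => by noncomm_ring
    rw [e] at h
    exact h
  · simpa [wilson_self] using hX

/-- A parameter function that vanishes at `x` and whose only covariant derivative there is
`X` in the direction `μ`. -/
def linearProbe (A : Fin 4 → R4 → Matrix g g ℂ) (X : Matrix g g ℂ) (x : R4) (μ : Fin 4) (z : R4) :
    Matrix g g ℂ :=
  (((z - x) μ : ℝ) : ℂ) • (wilson A z x * X * wilson A x z)

lemma smoothMat_linearProbe (hA : ∀ μ, SmoothMat (A μ)) (X : Matrix g g ℂ) (x : R4) (μ : Fin 4) :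
    SmoothMat (linearProbe A X x μ) :=
  MatContDiff.smul ((contDiff_coord μ).comp (f := fun z : R4 => z - x) (by fun_prop))
    (((matContDiff_wilson hA contDiff_id contDiff_const).mul (matContDiff_const X)).mul
      (matContDiff_wilson hA contDiff_const contDiff_id))

lemma linearProbe_self (X : Matrix g g ℂ) (x : R4) (μ : Fin 4) : linearProbe A X x μ x = 0 := by
  simp [linearProbe]

lemma linearProbe_mem (h𝔤 : IsGaugeAlgebra 𝔤) (hA : ∀ μ, SmoothMat (A μ))
    (hA𝔤 : ∀ μ x, A μ x ∈ 𝔤) {X : Matrix g g ℂ} (hX : X ∈ 𝔤) (x : R4) (μ : Fin 4) (z : R4) :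
    linearProbe A X x μ z ∈ 𝔤 := by
  rw [linearProbe, Complex.coe_smul]
  exact 𝔤.smul_mem _ (h𝔤.wilson_conj_mem hA hA𝔤 hX z x)

/-- Transport along rays from x undoes the conjugation in the probe and leaves a function linear in
t; hence all radial covariant derivatives at x of order at least two vanish. -/
lemma transport_linearProbe (hA : ∀ μ, SmoothMat (A μ)) (X : Matrix g g ℂ) (x y : R4) (μ : Fin 4)
    (t : ℝ) : transport A (linearProbe A X x μ) x (t • y) = ((t * y μ : ℝ) : ℂ) • X := by
  have h1 := wilson_mul_wilson_inv hA x (x + t • y)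
  have e : ∀ P P' : Matrix g g ℂ, P * (P' * X * P) * P' = P * P' * X * (P * P') := fun P P' => by
    noncomm_ring
  rw [transport, linearProbe, Matrix.mul_smul, Matrix.smul_mul, e, h1, Matrix.one_mul,
    Matrix.mul_one, add_sub_cancel_left]
  rfl

lemma covDir_iterate_linearProbe (hA : ∀ μ, SmoothMat (A μ)) (X : Matrix g g ℂ) (x y : R4)
    (μ : Fin 4) (l : ℕ) : ((covDir A y)^[l + 1] (linearProbe A X x μ)) x =
      if l = 0 then ((y μ : ℝ) : ℂ) • X else 0 := by
  ext i j
  rw [covDir_iterate_eq_iteratedDeriv hA (smoothMat_linearProbe hA X x μ)]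
  simp only [transport_linearProbe hA]
  have hd : deriv (fun t : ℝ => (((t * y μ : ℝ) : ℂ) • X) i j) = fun _ => ((y μ : ℝ) : ℂ) * X i j := by
    funext t
    refine HasDerivAt.deriv (HasDerivAt.mul_const ?_ _)
    exact ((hasDerivAt_mul_const (y μ)).ofReal_comp)
  rw [iteratedDeriv_succ', hd, iteratedDeriv_const]
  split_ifs <;> rfl

lemma covD_linearProbe (hA : ∀ μ, SmoothMat (A μ)) (X : Matrix g g ℂ) (x : R4) (μ ν : Fin 4) :
    covD A ν (linearProbe A X x μ) x = if μ = ν then X else 0 := by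
  have h := covDir_iterate_linearProbe hA X x (unitVec ν) μ 0
  rw [if_pos rfl, unitVec_apply] at h
  have e : covDir A (unitVec ν) (linearProbe A X x μ) x = covD A ν (linearProbe A X x μ) x := by
    simp [covDir, unitVec_apply, apply_ite Complex.ofReal]
  rw [← e]
  refine h.trans ?_
  split_ifs <;> simp

lemma isSlowAt_linearProbe (hA : ∀ μ, SmoothMat (A μ)) (X : Matrix g g ℂ) (x : R4) (μ : Fin 4) :
    IsSlowAt A (linearProbe A X x μ) x := fun y n hn => by
  obtain ⟨l, rfl⟩ := Nat.exists_eq_add_of_le' hn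
  rw [covDir_iterate_linearProbe hA, if_neg (by omega)]

end GaugeAlgebra

/-! ### Existence of the current and uniqueness of its components along 𝔤. -/

section NoetherCurrent

variable {s g : Type*} [Fintype s] [DecidableEq s] [Fintype g] [DecidableEq g]
  {A : Fin 4 → R4 → Matrix g g ℂ} {Q : SymPoly s} {γ5 : Matrix s s ℂ}
  {G : R4 → R4 → Matrix (s × g) (s × g) ℂ} {𝔤 : Submodule ℝ (Matrix g g ℂ)}

/-- For uniqueness, test with the probes: the term with B drops out because they vanish at x, and a
single component of J survives. Conversely 𝒟_μ α lies in 𝔤, so only those components of J enter the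
expansion. -/
lemma isAxialNoetherCurrent_iff (h𝔤 : IsGaugeAlgebra 𝔤) (hA : ∀ μ, SmoothMat (A μ))
    (hA𝔤 : ∀ μ x, A μ x ∈ 𝔤)
    (hB : ∀ x c d, Integrable fun p => breakingIntegrand Q A γ5 G x p c d)
    (hJ : ∀ μ x c d, Integrable fun p => currentIntegrand Q A γ5 G μ x p c d)
    (J : Fin 4 → R4 → Matrix g g ℂ) : IsAxialNoetherCurrent Q A γ5 𝔤 G J ↔
      ∀ μ x, ∀ X ∈ 𝔤, (X * J μ x).trace = (X * axialCurrent Q A γ5 G μ x).trace := by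
  constructor
  · rintro ⟨B, h⟩ μ x X hX
    have hs := smoothMat_linearProbe hA X x μ
    have hx := isSlowAt_linearProbe hA X x μ
    have h1 := h _ hs (linearProbe_mem h𝔤 hA hA𝔤 hX x μ) x hx
    rw [variationDensity_of_isSlowAt hA hs hB hJ hx, linearProbe_self] at h1
    simpa [covD_linearProbe hA, ite_mul, apply_ite Matrix.trace, Matrix.zero_mul] using h1.symm
  · intro h
    refine ⟨chiralBreaking Q A γ5 G, fun α hα hα𝔤 x hx => ?_⟩
    rw [variationDensity_of_isSlowAt hA hα hB hJ hx]
    congr 1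
    exact Finset.sum_congr rfl fun μ _ => (h μ x _ (h𝔤.covD_mem hA𝔤 hα hα𝔤 μ x)).symm

end NoetherCurrent

end WignerWeyl

end

theorem theorem8 {r g : Type*} [Fintype r] [DecidableEq r] [Fintype g] [DecidableEq g]
    (γ : Fin 4 → Matrix (Fin 4) (Fin 4) ℂ)
    (hγ : ∀ μ ν, γ μ * γ ν + γ ν * γ μ = if μ = ν then 2 else 0)
    (𝔤 : Submodule ℝ (Matrix g g ℂ)) (h𝔤 : WignerWeyl.IsGaugeAlgebra 𝔤)
    (A : Fin 4 → WignerWeyl.R4 → Matrix g g ℂ)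
    (hA : ∀ μ, WignerWeyl.SmoothMat (A μ)) (hA𝔤 : ∀ μ x, A μ x ∈ 𝔤)
    (Q : WignerWeyl.SymPoly (Fin 4 × r))
    (G : WignerWeyl.R4 → WignerWeyl.R4 → Matrix ((Fin 4 × r) × g) ((Fin 4 × r) × g) ℂ)
    (hG : WignerWeyl.IsGreenFunction Q A G)
    (hGW : ∀ x i j, MeasureTheory.Integrable
      (fun y : WignerWeyl.R4 => G (x - (1 / 2 : ℝ) • y) (x + (1 / 2 : ℝ) • y) i j))
    (hB : ∀ x a b, MeasureTheory.Integrable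
      (fun p => WignerWeyl.breakingIntegrand Q A (WignerWeyl.gammaFive γ) G x p a b))
    (hJ : ∀ μ x a b, MeasureTheory.Integrable
      (fun p => WignerWeyl.currentIntegrand Q A (WignerWeyl.gammaFive γ) G μ x p a b)) :
    (∀ J : Fin 4 → WignerWeyl.R4 → Matrix g g ℂ,
      WignerWeyl.IsAxialNoetherCurrent Q A (WignerWeyl.gammaFive γ) 𝔤 G J ↔
        ∀ μ x, ∀ X ∈ 𝔤, (X * J μ x).trace =
          (X * WignerWeyl.axialCurrent Q A (WignerWeyl.gammaFive γ) G μ x).trace) ∧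
    (∀ α : WignerWeyl.R4 → Matrix g g ℂ, WignerWeyl.SmoothMat α → (∀ x, α x ∈ 𝔤) →
      ∀ x, WignerWeyl.IsSlowAt A α x →
        WignerWeyl.variationDensity Q A (WignerWeyl.gammaFive γ) G α x =
          (α x * WignerWeyl.chiralBreaking Q A (WignerWeyl.gammaFive γ) G x).trace
          - ∑ μ, (WignerWeyl.covD A μ α x *
              WignerWeyl.axialCurrent Q A (WignerWeyl.gammaFive γ) G μ x).trace) ∧
    ((∀ κ μ ν x p, WignerWeyl.dp κ (WignerWeyl.dp μ (WignerWeyl.dp ν Q.symbol)) x p = 0) →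
      (∀ μ ν x a b, MeasureTheory.Integrable
        (fun p => WignerWeyl.secondIntegrand Q A (WignerWeyl.gammaFive γ) G μ ν x p a b)) →
      ∀ α : WignerWeyl.R4 → Matrix g g ℂ, WignerWeyl.SmoothMat α → (∀ x, α x ∈ 𝔤) → ∀ x,
        WignerWeyl.variationDensity Q A (WignerWeyl.gammaFive γ) G α x =
          (α x * WignerWeyl.chiralBreaking Q A (WignerWeyl.gammaFive γ) G x).trace
          - ∑ μ, (WignerWeyl.covD A μ α x *
              WignerWeyl.axialCurrent Q A (WignerWeyl.gammaFive γ) G μ x).trace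
          + ∑ μ, ∑ ν, (WignerWeyl.covD A μ (WignerWeyl.covD A ν α) x *
              WignerWeyl.secondBreaking Q A (WignerWeyl.gammaFive γ) G μ ν x).trace) := by
  refine ⟨WignerWeyl.isAxialNoetherCurrent_iff h𝔤 hA hA𝔤 hB hJ, fun α hα _ x hx => ?_,
    fun h3 h2 α hα _ x => ?_⟩
  · exact WignerWeyl.variationDensity_of_isSlowAt hA hα hB hJ hx
  · exact WignerWeyl.variationDensity_of_dp hA hα hB hJ h3 h2 x
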